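/- Let $d\ge 1$. For $h>0$ put $\alpha_h(x)=\sqrt h\,\arctan(x/\sqrt h)$ and $\lambda_h(\xi)=\alpha_h(h|\xi|^2)$ for $\xi\in\mathbb R^d$. For $s\ge 0$ and $\phi:\mathbb R^d\to\mathbb C$ let $$\|\phi\|_{L^1_s}=\int_{\mathbb R^d}(1+|\xi|^s)|\phi(\xi)|\,d\xi,\qquad \|\phi\|_{L^2_s}^2=\int_{\mathbb R^d}(1+|\xi|^{2s})|\phi(\xi)|^2\,d\xi ,$$ and write $L^1=L^1_0$, $L^2=L^2_0$. Let $$P(\phi,\psi)=\int_{\xi_1+\xi_2-\eta_1-\eta_2=0}\phi(\xi_1)\phi(\xi_2)\psi(\eta_1)\psi(\eta_2)\,d\xi_1d\xi_2d\eta_1,\qquad H(\phi,\psi)=\int_{\mathbb R^d}|\xi|^2\phi\psi\,d\xi+P(\phi,\psi)$$ be the Hamiltonian of cubic defocusing NLS in Fourier variables. Let $\Phi_{A_0}^1(\phi)(\xi)=e^{-i\lambda_h(\xi)}\phi(\xi)$, and let $\Phi_P^t$ be the flow on $L^1(\mathbb R^d)$ of $i\partial_t\phi=\frac{\partial P}{\partial\psi}(\phi,\bar\phi)$,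 that is $i\,\partial_t\phi(\xi)=2\int_{\xi_1+\xi_2-\eta=\xi}\phi(\xi_1)\phi(\xi_2)\bar\phi(\eta)\,d\xi_1d\xi_2$. Consider numerical solutions $$\phi_{n+1}=\Phi_P^h\circ\Phi_{A_0}^1(\phi_n),\qquad n\ge 0,\quad \phi_0\in L^1 .$$ A polynomial Hamiltonian is a finite sum over $\ell\ge2$ and $\delta\in\{\pm1\}^\ell$ of integrals $\int_{\delta_1\xi_1+\dots+\delta_\ell\xi_\ell=0}a_{\delta}(\xi)\prod_{i=1}^{\ell} z(\xi_i,\delta_i)\,d\xi$, where $z(\cdot,1)=\phi$, $z(\cdot,-1)=\psi$, with bounded measurable coefficients, and real for $\psi=\bar\phi\in L^1\cap L^2$. Finally let $$H_h^{(1)}(\phi,\bar\phi)=\int_{\mathbb R^d}\frac1{\sqrt h}\arctan(\sqrt h|\xi|^2)|\phi(\xi)|^2d\xi+\int_{\xi_1+\xi_2-\eta_1-\eta_2=0}\frac{i\Lambda}{e^{i\Lambda}-1}\,\phi(\xi_1)\phi(\xi_2)\bar\phi(\eta_1)\bar\phi(\eta_2)\,d\xi_1d\xi_2d\eta_1,$$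 with $\Lambda=\lambda_h(\xi_1)+\lambda_h(\xi_2)-\lambda_h(\eta_1)-\lambda_h(\eta_2)$, the quotient being $1$ at $\Lambda=0$. Theorem. For every $M\geq 0$ there are $h_0>0$, $c>0$ and polynomial Hamiltonians $H_h$ such that the following holds for all $0<h\le h_0$. (1) For every $R$ there is a constant $C$, depending only on $d,M,R$, such that $|H_h(\phi,\bar\phi)-H_h^{(1)}(\phi,\bar\phi)|\le Ch$ whenever $\|\phi\|_{L^1}\le M$ and $\|\phi\|_{L^2}^2\le R$; and for every numerical solution with $\|\phi_n\|_{L^1}\le M$ for all $n$ and $\|\phi_0\|_{L^2}^2\le R$, and all $n$ with $nh\le \exp(ch^{-1/2})$, one has $\phi_n\in L^2$ and $$|H_h(\phi_n,\bar\phi_n)-H_h(\phi_0,\bar\phi_0)|\le C\exp(-ch^{-1/2}),\qquad |H^{(1)}_h(\phi_n,\bar\phi_n)-H^{(1)}_h(\phi_0,\bar\phi_0)|\le Ch .$$ (2) For every $\alpha>0$ and $R$ there is a constant $C$, depending only on $d,M,R,\alpha$, such that for every numerical solution with $\|\phi_n\|_{L^1}\le M$ for all $n$ and $\|\phi_0\|_{L^2_1}^2\le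 R$ (that is, $u_0\in H^1(\mathbb R^d)$ for $\phi_0=\hat u_0$), and all $n$ with $nh\le\exp(ch^{-1/2})$, $$\int_{|\xi|\le\alpha h^{-1/4}}|\xi|^2|\phi_n(\xi)|^2d\xi+\frac1{\sqrt h}\int_{|\xi|\ge\alpha h^{-1/4}}|\phi_n(\xi)|^2d\xi\le C .$$ (3) For every $s\ge3$ and $R$ there is a constant $C$, depending only on $d,M,R,s$, such that for every numerical solution with $\|\phi_n\|_{L^1_s}\le M$ and $\|\phi_n\|_{L^2_s}^2\le R$ for all $n$, and all $n$ with $nh\le\exp(ch^{-1/2})$, $$|H(\phi_n,\bar\phi_n)-H(\phi_0,\bar\phi_0)|\le Ch .$$ -/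

import Mathlib

open MeasureTheory
open scoped NNReal ENNReal

noncomputable section

namespace NLSSplitting

/-- Fourier space `ℝ^d` with the Euclidean norm. -/
abbrev V (d : ℕ) : Type := EuclideanSpace ℝ (Fin d)

/-- The Banach space `L¹(ℝ^d; ℂ)`. A real state `z = (φ, φ̄)` is represented by `φ`. -/
abbrev L1 (d : ℕ) : Type := Lp ℂ 1 (volume : Measure (V d))

variable {d : ℕ}

/-- Pointwise complex conjugate of a function. -/
def conjF (φ : V d → ℂ) : V d → ℂ := fun ξ => (starRingEnd ℂ) (φ ξ)

/-- The norm `‖z‖_{L¹_s} = ½ ∫ (1 + |ξ|^s) (|φ| + |ψ|) dξ` at `z = (φ, φ̄)`. -/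
def normL1 (s : ℝ) (φ : V d → ℂ) : ℝ≥0∞ :=
  ∫⁻ ξ, ENNReal.ofReal ((1 + ‖ξ‖ ^ s) * ‖φ ξ‖)

/-- The squared norm `∫ (1 + |ξ|^{2s}) |φ|² dξ` of `L²_s`. -/
def sqNormL2 (s : ℝ) (φ : V d → ℂ) : ℝ≥0∞ :=
  ∫⁻ ξ, ENNReal.ofReal ((1 + ‖ξ‖ ^ (2 * s)) * ‖φ ξ‖ ^ 2)

/-- The filter function `α_h(x) = √h arctan (x / √h)`. -/
def filterFun (h x : ℝ) : ℝ := Real.sqrt h * Real.arctan (x / Real.sqrt h)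

/-- The frequencies `λ(ξ) = α_h(h |ξ|²)` of `A₀`. -/
def freq (h : ℝ) (ξ : V d) : ℝ := filterFun h (h * ‖ξ‖ ^ 2)

/-- `φ' = Φ_{A₀}^1(φ)`: the time-one flow of `i ∂ₜ φ = λ(ξ) φ`. -/
def LinearStep (h : ℝ) (φ φ' : L1 d) : Prop :=
  ∀ᵐ ξ : V d, φ' ξ = Complex.exp (-Complex.I * (freq h ξ : ℂ)) * φ ξ

/-- The nonlinearity
`P(φ, ψ) = ∫_{ξ₁+ξ₂-η₁-η₂=0} φ(ξ₁) φ(ξ₂) ψ(η₁) ψ(η₂)`, with `η₂ = ξ₁ + ξ₂ - η₁`. -/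
def quartic (φ ψ : V d → ℂ) : ℂ :=
  ∫ p : V d × V d × V d,
    φ p.1 * φ p.2.1 * ψ p.2.2 * ψ (p.1 + p.2.1 - p.2.2)

/-- The `φ`-component `-i ∂P/∂ψ` of the Hamiltonian vector field of `P` at `z = (φ, φ̄)`:
`-2i ∫_{ξ₁+ξ₂-η=ξ} φ(ξ₁) φ(ξ₂) φ̄(η)`. -/
def quarticField (φ : V d → ℂ) (ξ : V d) : ℂ :=
  -2 * Complex.I * ∫ p : V d × V d, φ p.1 * φ p.2 * conjF φ (p.1 + p.2 - ξ)

/-- `φ' = Φ_P^t(φ)`: a `C¹` solution in `L¹` of `i ∂ₜ φ = ∂P/∂ψ (φ, φ̄)` leads from `φ` at time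
`0` to `φ'` at time `t`. -/
def NonlinearStep (t : ℝ) (φ φ' : L1 d) : Prop :=
  ∃ γ v : ℝ → L1 d, γ 0 = φ ∧ γ t = φ' ∧
    ∀ r ∈ Set.Icc 0 t, HasDerivWithinAt γ (v r) (Set.Icc 0 t) r ∧
      ∀ᵐ ξ : V d, v r ξ = quarticField (γ r) ξ

/-- `φ_{n+1} = Φ_P^h ∘ Φ_{A₀}^1 (φ_n)` for all `n`. -/
def IsNumericalSolution (h : ℝ) (φ : ℕ → L1 d) : Prop :=
  ∀ n, ∃ χ : L1 d, LinearStep h (φ n) χ ∧ NonlinearStep h χ (φ (n + 1))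

/-- The value `z(ξ, ε)` for `z = (φ, ψ)` and `ε = ±1`. -/
def coord (φ ψ : V d → ℂ) (ε : ℤˣ) (ξ : V d) : ℂ := if ε = 1 then φ ξ else ψ ξ

/-- The momentum `δ₁ ξ₁ + ⋯ + δ_ℓ ξ_ℓ`. -/
def momentum {ℓ : ℕ} (δ : Fin ℓ → ℤˣ) (ξ : Fin ℓ → V d) : V d := ∑ i, δ i • ξ i

/-- The point of zero momentum whose first `m` entries are prescribed. -/
def zeroMomentum {m : ℕ} (δ : Fin (m + 1) → ℤˣ) (ξ : Fin m → V d) : Fin (m + 1) → V d :=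
  Fin.snoc (α := fun _ => V d) ξ
    (-(δ (Fin.last m) • momentum (fun i => δ i.castSucc) ξ))

lemma momentum_zeroMomentum {m : ℕ} (δ : Fin (m + 1) → ℤˣ) (ξ : Fin m → V d) :
    momentum δ (zeroMomentum δ ξ) = 0 := by
  simp only [momentum, zeroMomentum, Fin.sum_univ_castSucc, Fin.snoc_castSucc, Fin.snoc_last,
    smul_neg, smul_smul, Int.units_mul_self, one_smul, add_neg_cancel]

/-- The polynomial
`∑_{ℓ=2}^{k} ∑_{δ ∈ {±1}^ℓ} ∫_{δ₁ξ₁+⋯+δ_ℓξ_ℓ=0} a(ξ, δ) z(ξ₁,δ₁) ⋯ z(ξ_ℓ,δ_ℓ) dξ`,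
where `ℓ = m + 1` and the last variable is eliminated. -/
def polyEval (k : ℕ) (a : (m : ℕ) → (Fin (m + 1) → ℤˣ) → (Fin (m + 1) → V d) → ℂ)
    (φ ψ : V d → ℂ) : ℂ :=
  ∑ m ∈ Finset.Ico 1 k, ∑ δ : Fin (m + 1) → ℤˣ, ∫ ξ : Fin m → V d,
    a m δ (zeroMomentum δ ξ) * ∏ i, coord φ ψ (δ i) (zeroMomentum δ ξ i)

/-- Real polynomial Hamiltonians of zero momentum with bounded coefficients. -/
structure PolyHam (d : ℕ) where
  /-- a bound for the degree -/
  deg : ℕ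
  /-- the coefficients -/
  coeff : (m : ℕ) → (Fin (m + 1) → ℤˣ) → (Fin (m + 1) → V d) → ℂ
  measurable_coeff : ∀ m δ, Measurable (coeff m δ)
  bounded_coeff : ∃ K : ℝ, ∀ m ∈ Finset.Ico 1 deg, ∀ δ ξ, momentum δ ξ = 0 →
    ‖coeff m δ ξ‖ ≤ K
  real : ∀ φ : L1 d, sqNormL2 0 φ < ⊤ → (polyEval deg coeff φ (conjF φ)).im = 0

/-- The value `H(φ, φ̄)` of a polynomial Hamiltonian at a real state. -/
def PolyHam.eval (H : PolyHam d) (φ : V d → ℂ) : ℂ := polyEval H.deg H.coeff φ (conjF φ)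

/-- `x ↦ i x / (e^{ix} - 1)`, with its limit `1` at `x = 0`. -/
def multiplier (x : ℝ) : ℂ :=
  if x = 0 then 1 else Complex.I * (x : ℂ) / (Complex.exp (Complex.I * (x : ℂ)) - 1)

/-- The first modified energy `H_h^{(1)}(φ, φ̄)`. -/
def firstModifiedEnergy (h : ℝ) (φ : V d → ℂ) : ℂ :=
  (∫ ξ : V d, ((1 / Real.sqrt h * Real.arctan (Real.sqrt h * ‖ξ‖ ^ 2) * ‖φ ξ‖ ^ 2 : ℝ) : ℂ)) +
  ∫ p : V d × V d × V d,
    multiplier (freq h p.1 + freq h p.2.1 - freq h p.2.2 - freq h (p.1 + p.2.1 - p.2.2)) *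
      (φ p.1 * φ p.2.1 * conjF φ p.2.2 * conjF φ (p.1 + p.2.1 - p.2.2))

/-- The original energy `H(φ, φ̄) = ∫ |ξ|² |φ|² dξ + P(φ, φ̄)`. -/
def energy (φ : V d → ℂ) : ℂ :=
  (∫ ξ : V d, ((‖ξ‖ ^ 2 * ‖φ ξ‖ ^ 2 : ℝ) : ℂ)) + quartic φ (conjF φ)

end NLSSplitting

end

open NLSSplitting

noncomputable section

set_option linter.unusedSectionVars false

namespace NLSSplitting

section BanachAlgebra

open NormedSpace

variable {R : Type*} [NormedRing R] [NormedAlgebra ℝ R] [CompleteSpace R]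

lemma exp_add_of_commute_real {x y : R} (hxy : Commute x y) : exp (x + y) = exp x * exp y := by
  let _ : NormedAlgebra ℚ R := NormedAlgebra.restrictScalars ℚ ℝ R
  exact exp_add_of_commute hxy

lemma exp_neg_mul_exp (x : R) : exp (-x) * exp x = 1 := by
  rw [← exp_add_of_commute_real (Commute.neg_left (Commute.refl x)), neg_add_cancel, exp_zero]

lemma exp_mul_exp_neg (x : R) : exp x * exp (-x) = 1 := by
  rw [← exp_add_of_commute_real (Commute.neg_right (Commute.refl x)), add_neg_cancel, exp_zero]

lemma norm_exp_sub_one_le (x : R) : ‖exp x - 1‖ ≤ Real.exp ‖x‖ - 1 := by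
  have h := exp_series_hasSum_exp' (𝕂 := ℝ) x
  have h1 := (hasSum_nat_add_iff' 1).2 h
  have h2 : HasSum (fun n : ℕ => ((n.factorial : ℝ)⁻¹) * ‖x‖ ^ n) (Real.exp ‖x‖) := by
    have := exp_series_hasSum_exp' (𝕂 := ℝ) (‖x‖)
    simpa [Real.exp_eq_exp_ℝ] using this
  have h3 := (hasSum_nat_add_iff' 1).2 h2
  simp only [Finset.range_one, Finset.sum_singleton, Nat.factorial_zero, Nat.cast_one, inv_one,
    pow_zero, one_smul, one_mul] at h1 h3
  refine h1.norm_le_of_bounded h3 fun n => ?_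
  rw [norm_smul]
  refine mul_le_mul ?_ (norm_pow_le' x (Nat.succ_pos n)) (norm_nonneg _) (by positivity)
  rw [Real.norm_of_nonneg (by positivity)]

lemma hasDerivAt_exp_of_commute {f : ℝ → R} {f' : R} {t : ℝ} (hf : HasDerivAt f f' t)
    (hc : ∀ s, Commute (f t) (f s)) :
    HasDerivAt (fun s => exp (f s)) (exp (f t) * f') t := by
  have h0 : HasDerivAt (fun s => f s - f t) f' t := hf.sub_const (f t)
  have h1 : HasFDerivAt (𝕜 := ℝ) (exp : R → R) (1 : R →L[ℝ] R) (f t - f t) := by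
    rw [sub_self]; exact hasFDerivAt_exp_zero
  have h2 := h1.comp_hasDerivAt t h0
  have h3 := h2.const_mul (exp (f t))
  refine HasDerivAt.congr_of_eventuallyEq h3 (Filter.Eventually.of_forall fun s => ?_)
  have hcm : Commute (f t) (f s - f t) := (hc s).sub_right (Commute.refl _)
  show exp (f s) = exp (f t) * exp (f s - f t)
  rw [← exp_add_of_commute_real hcm]
  congr 1
  abel

/-- The terms of the logarithmic series of `1 + t v`. -/
def logTerm (v : R) (t : ℝ) (k : ℕ) : R := ((-1) ^ k * t ^ (k + 1) / (k + 1) : ℝ) • v ^ (k + 1)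

lemma norm_neg_pow_smul_le (v : R) (hv : ‖v‖ ≤ 1 / 4) {t : ℝ} (ht : t ∈ Set.Ioo (-2 : ℝ) 2)
    (k : ℕ) : ‖((-1) ^ k * t ^ k : ℝ) • v ^ (k + 1)‖ ≤ ‖v‖ * (1 / 2) ^ k := by
  have ht' : |t| ≤ 2 := abs_le.2 ⟨ht.1.le, ht.2.le⟩
  rw [norm_smul, norm_mul, norm_pow, norm_pow, norm_neg, norm_one, one_pow, one_mul,
    Real.norm_eq_abs]
  calc |t| ^ k * ‖v ^ (k + 1)‖ ≤ 2 ^ k * ‖v‖ ^ (k + 1) := by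
        gcongr
        exact norm_pow_le' v (Nat.succ_pos k)
    _ ≤ 2 ^ k * ((1 / 4) ^ k * ‖v‖) := by rw [pow_succ]; gcongr
    _ = ‖v‖ * (1 / 2) ^ k := by
        rw [← mul_assoc, ← mul_pow, mul_comm]; norm_num

lemma hasDerivAt_logTerm (v : R) (k : ℕ) (t : ℝ) :
    HasDerivAt (fun s => logTerm v s k) (((-1) ^ k * t ^ k : ℝ) • v ^ (k + 1)) t := by
  unfold logTerm
  have h := (((hasDerivAt_pow (k + 1) t).const_mul ((-1 : ℝ) ^ k)).div_const ((k : ℝ) + 1))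
  have h2 := h.smul_const (v ^ (k + 1))
  convert! h2 using 2
  have : ((k : ℝ) + 1) ≠ 0 := by positivity
  push_cast
  field_simp

lemma summable_neg_pow_smul (v : R) (hv : ‖v‖ ≤ 1 / 4) {t : ℝ} (ht : t ∈ Set.Ioo (-2 : ℝ) 2) :
    Summable fun k : ℕ => ((-1) ^ k * t ^ k : ℝ) • v ^ (k + 1) :=
  Summable.of_norm_bounded (summable_geometric_two.mul_left ‖v‖)
    (fun k => norm_neg_pow_smul_le v hv ht k)

lemma hasDerivAt_logSeries (v : R) (hv : ‖v‖ ≤ 1 / 4) {t : ℝ} (ht : t ∈ Set.Ioo (-2 : ℝ) 2) :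
    HasDerivAt (fun s => ∑' k, logTerm v s k)
      (∑' k : ℕ, ((-1) ^ k * t ^ k : ℝ) • v ^ (k + 1)) t := by
  refine hasDerivAt_tsum_of_isPreconnected (summable_geometric_two.mul_left ‖v‖) isOpen_Ioo
    isPreconnected_Ioo (fun k y _ => hasDerivAt_logTerm v k y)
    (fun k y hy => norm_neg_pow_smul_le v hv hy k) (y₀ := 0) (by norm_num) ?_ ht
  convert! summable_zero (α := R) (β := ℕ) using 2 with k
  simp [logTerm]

lemma one_add_smul_mul_tsum (v : R) (hv : ‖v‖ ≤ 1 / 4) {t : ℝ} (ht : t ∈ Set.Ioo (-2 : ℝ) 2) :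
    (∑' k : ℕ, ((-1) ^ k * t ^ k : ℝ) • v ^ (k + 1)) * (1 + t • v) = v := by
  have hs := summable_neg_pow_smul v hv ht
  rw [mul_add, mul_one]
  conv_lhs => enter [1]; rw [hs.tsum_eq_zero_add]
  rw [← hs.tsum_mul_right, add_assoc, ← Summable.tsum_add]
  · simp only [pow_zero, mul_one, one_smul, zero_add, pow_one, add_eq_left]
    convert! tsum_zero using 3 with k
    rw [smul_mul_smul_comm, ← pow_succ, ← add_smul]
    rw [show ((-1 : ℝ) ^ (k + 1) * t ^ (k + 1) + (-1) ^ k * t ^ k * t) = 0 by ring, zero_smul]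
  · exact (summable_nat_add_iff 1).2 hs
  · exact hs.mul_right _

lemma summable_logTerm (v : R) (hv : ‖v‖ ≤ 1 / 4) {t : ℝ} (ht : t ∈ Set.Ioo (-2 : ℝ) 2) :
    Summable (logTerm v t) := by
  refine Summable.of_norm_bounded (g := fun k => 2 * ‖v‖ * (1 / 2) ^ k)
    (summable_geometric_two.mul_left (2 * ‖v‖)) fun k => ?_
  have h := norm_neg_pow_smul_le v hv ht k
  have h2 : logTerm v t k = (t / (k + 1) : ℝ) • (((-1) ^ k * t ^ k : ℝ) • v ^ (k + 1)) := by
    rw [logTerm, smul_smul]; congr 1; ring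
  rw [h2, norm_smul, mul_assoc]
  refine mul_le_mul ?_ h (norm_nonneg _) (by norm_num)
  rw [norm_div, Real.norm_eq_abs, Real.norm_of_nonneg (by positivity : (0 : ℝ) ≤ (k : ℝ) + 1),
    div_le_iff₀ (by positivity)]
  have : |t| ≤ 2 := abs_le.2 ⟨ht.1.le, ht.2.le⟩
  nlinarith [(Nat.cast_nonneg k : (0 : ℝ) ≤ k)]

/-- A logarithm in a real Banach algebra, given by the logarithmic series. -/
theorem exists_log (v : R) (hv : ‖v‖ ≤ 1 / 4) :
    ∃ D : R, HasSum (logTerm v 1) D ∧ exp D = 1 + v ∧ ‖D‖ ≤ 2 * ‖v‖ := by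
  have h1 : (1 : ℝ) ∈ Set.Ioo (-2 : ℝ) 2 := by norm_num
  have hcomm : ∀ s t : ℝ, s ∈ Set.Ioo (-2 : ℝ) 2 → t ∈ Set.Ioo (-2 : ℝ) 2 →
      Commute (∑' k, logTerm v s k) (∑' k, logTerm v t k) := by
    intro s t hs ht
    refine Commute.tsum_left _ fun i => Commute.tsum_right _ fun j => ?_
    unfold logTerm
    exact ((Commute.pow_pow (Commute.refl v) _ _).smul_left _).smul_right _
  refine ⟨∑' k, logTerm v 1 k, (summable_logTerm v hv h1).hasSum, ?_, ?_⟩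
  · let f : ℝ → R := fun s => if s ∈ Set.Ioo (-2 : ℝ) 2 then ∑' k, logTerm v s k else 0
    have hfe : ∀ s ∈ Set.Ioo (-2 : ℝ) 2, f s = ∑' k, logTerm v s k := fun s hs => by
      simp only [f, if_pos hs]
    have hfc : ∀ s t, Commute (f s) (f t) := by
      intro s t
      by_cases hs : s ∈ Set.Ioo (-2 : ℝ) 2
      · by_cases ht : t ∈ Set.Ioo (-2 : ℝ) 2
        · rw [hfe s hs, hfe t ht]; exact hcomm s t hs ht
        · simp only [f, if_neg ht]; exact Commute.zero_right _
      · simp only [f, if_neg hs]; exact Commute.zero_left _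
    have hfd : ∀ t ∈ Set.Ioo (-2 : ℝ) 2, HasDerivAt f
        (∑' k : ℕ, ((-1) ^ k * t ^ k : ℝ) • v ^ (k + 1)) t := fun t ht => by
      refine (hasDerivAt_logSeries v hv ht).congr_of_eventuallyEq ?_
      filter_upwards [isOpen_Ioo.mem_nhds ht] with s hs using hfe s hs
    have hg : ∀ t ∈ Set.Ioo (-2 : ℝ) 2, HasDerivAt (fun s => exp (-(f s)) * (1 + s • v)) 0 t := by
      intro t ht
      have e1 := hasDerivAt_exp_of_commute (hfd t ht).neg
        (fun s => ((hfc t s).neg_left).neg_right)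
      have e2 : HasDerivAt (fun s : ℝ => (1 : R) + s • v) v t := by
        simpa using ((hasDerivAt_id t).smul_const v).const_add (1 : R)
      have e3 := e1.mul e2
      refine HasDerivAt.congr_deriv e3 ?_
      rw [mul_assoc, neg_mul, one_add_smul_mul_tsum v hv ht]
      simp
    have hconst := (convex_Ioo (-2 : ℝ) 2).is_const_of_fderivWithin_eq_zero (𝕜 := ℝ)
      (f := fun s => exp (-(f s)) * (1 + s • v)) (x := 0) (y := 1)
      (fun t ht => (hg t ht).differentiableAt.differentiableWithinAt)
      (fun t ht => by
        rw [fderivWithin_of_isOpen isOpen_Ioo ht, (hg t ht).hasFDerivAt.fderiv]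
        ext; simp) (by norm_num) h1
    have f0 : f 0 = 0 := by
      rw [hfe 0 (by norm_num)]
      convert! tsum_zero using 3 with k
      simp [logTerm]
    simp only [f0, neg_zero, exp_zero, zero_smul, add_zero, mul_one, one_smul, hfe 1 h1] at hconst
    have := congrArg (fun z => exp (∑' k, logTerm v 1 k) * z) hconst
    simp only [← mul_assoc, exp_mul_exp_neg, mul_one, one_mul] at this
    exact this
  · have hb : ∀ k, ‖logTerm v 1 k‖ ≤ ‖v‖ * (1 / 2) ^ k := by
      intro k
      have h := norm_neg_pow_smul_le v hv h1 k
      have h2 : logTerm v 1 k = (1 / (k + 1) : ℝ) • (((-1) ^ k * 1 ^ k : ℝ) • v ^ (k + 1)) := by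
        rw [logTerm, smul_smul]; congr 1; ring
      rw [h2, norm_smul]
      refine (mul_le_of_le_one_left (norm_nonneg _) ?_).trans h
      rw [norm_div, norm_one, Real.norm_of_nonneg (by positivity : (0 : ℝ) ≤ (k : ℝ) + 1),
        div_le_one (by positivity)]
      simp
    have := tsum_of_norm_bounded ((hasSum_geometric_two).mul_left ‖v‖) hb
    linarith

end BanachAlgebra

section Invariance

open NormedSpace

variable {X : Type*} [NormedAddCommGroup X] [NormedSpace ℝ X] [CompleteSpace X]

lemma pow_apply_mem {S : Submodule ℝ X} {T : X →L[ℝ] X} (hT : ∀ x ∈ S, T x ∈ S) (k : ℕ) :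
    ∀ x ∈ S, (T ^ k) x ∈ S := by
  induction k with
  | zero => intro x hx; simpa using hx
  | succ k ih => intro x hx; rw [pow_succ]; exact ih _ (hT x hx)

lemma hasSum_apply_mem {S : Submodule ℝ X} (hS : IsClosed (S : Set X)) {ι : Type*}
    {f : ι → X →L[ℝ] X} {T : X →L[ℝ] X} (hf : HasSum f T) (h : ∀ i, ∀ x ∈ S, f i x ∈ S) :
    ∀ x ∈ S, T x ∈ S := by
  intro x hx
  have h1 : HasSum (fun i => f i x) (T x) := hf.mapL (ContinuousLinearMap.apply ℝ X x)
  exact hS.mem_of_tendsto h1 (Filter.Eventually.of_forall fun s => S.sum_mem fun i _ => h i x hx)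

lemma exp_apply_mem {S : Submodule ℝ X} (hS : IsClosed (S : Set X)) {T : X →L[ℝ] X}
    (hT : ∀ x ∈ S, T x ∈ S) : ∀ x ∈ S, exp T x ∈ S :=
  hasSum_apply_mem hS (exp_series_hasSum_exp' (𝕂 := ℝ) T) fun k x hx => by
    rw [smul_apply]
    exact S.smul_mem _ (pow_apply_mem hT k x hx)

lemma smul_apply_mem {S : Submodule ℝ X} {T : X →L[ℝ] X} (hT : ∀ x ∈ S, T x ∈ S) (s : ℝ) :
    ∀ x ∈ S, (s • T) x ∈ S := fun x hx => S.smul_mem s (hT x hx)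

lemma pow_apply_eigen {S : Submodule ℝ X} {T : X →L[ℝ] X} (hT : ∀ x ∈ S, T x ∈ S)
    {l : X →L[ℝ] ℂ} {μ : ℂ} (hl : ∀ x ∈ S, l (T x) = μ * l x) (k : ℕ) :
    ∀ x ∈ S, l ((T ^ k) x) = μ ^ k * l x := by
  induction k with
  | zero => intro x _; simp
  | succ k ih =>
    intro x hx
    rw [pow_succ, mul_apply_eq_comp, ih _ (hT x hx), hl x hx, pow_succ, mul_assoc]

lemma hasSum_apply_eigen {S : Submodule ℝ X} {ι : Type*}
    {f : ι → X →L[ℝ] X} {T : X →L[ℝ] X} (hf : HasSum f T) {l : X →L[ℝ] ℂ} {m : ι → ℂ} {μ : ℂ}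
    (hm : HasSum m μ) (h : ∀ i, ∀ x ∈ S, l (f i x) = m i * l x) :
    ∀ x ∈ S, l (T x) = μ * l x := by
  intro x hx
  have h1 : HasSum (fun i => l (f i x)) (l (T x)) :=
    (hf.mapL (ContinuousLinearMap.apply ℝ X x)).mapL l
  simp only [fun i => h i x hx] at h1
  exact h1.unique (hm.mul_right (l x))

lemma exp_apply_eigen {S : Submodule ℝ X} {T : X →L[ℝ] X} (hT : ∀ x ∈ S, T x ∈ S)
    {l : X →L[ℝ] ℂ} {μ : ℂ} (hl : ∀ x ∈ S, l (T x) = μ * l x) :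
    ∀ x ∈ S, l (exp T x) = Complex.exp μ * l x := by
  refine hasSum_apply_eigen (exp_series_hasSum_exp' (𝕂 := ℝ) T)
    (m := fun k => (k.factorial : ℂ)⁻¹ * μ ^ k) ?_ ?_
  · rw [Complex.exp_eq_exp_ℂ]
    simpa using exp_series_hasSum_exp' (𝕂 := ℂ) μ
  · intro k x hx
    rw [smul_apply, map_smul, pow_apply_eigen hT hl k x hx, mul_assoc]
    simp

lemma logTerm_apply_mem {S : Submodule ℝ X} {V : X →L[ℝ] X} (hV : ∀ x ∈ S, V x ∈ S) (k : ℕ) :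
    ∀ x ∈ S, logTerm V 1 k x ∈ S := fun x hx =>
  S.smul_mem _ (pow_apply_mem hV (k + 1) x hx)

lemma log_apply_eigen {S : Submodule ℝ X} {V D : X →L[ℝ] X} (hV : ∀ x ∈ S, V x ∈ S)
    (hD : HasSum (logTerm V 1) D) {l : X →L[ℝ] ℂ} {μ : ℂ} (hμ : ‖μ‖ < 1)
    (hl : ∀ x ∈ S, l (V x) = μ * l x) :
    ∀ x ∈ S, l (D x) = Complex.log (1 + μ) * l x := by
  have h1 := (hasSum_nat_add_iff' 1).2 (Complex.hasSum_taylorSeries_log hμ)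
  simp only [Finset.range_one, Finset.sum_singleton, Nat.cast_zero, div_zero, sub_zero] at h1
  refine hasSum_apply_eigen hD h1 fun k x hx => ?_
  rw [logTerm, smul_apply, map_smul, pow_apply_eigen hV hl _ x hx,
    Complex.real_smul]
  push_cast
  ring

end Invariance

section Conjugation

open NormedSpace

variable {R : Type*} [NormedRing R] [NormedAlgebra ℝ R] [CompleteSpace R]

lemma hasDerivAt_exp_smul (D : R) (s : ℝ) :
    HasDerivAt (fun u : ℝ => exp (u • D)) (D * exp (s • D)) s := hasDerivAt_exp_smul_const' D s

lemma hasDerivAt_exp_neg_smul (D : R) (s : ℝ) :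
    HasDerivAt (fun u : ℝ => exp (u • -D)) (-(exp (s • -D) * D)) s := by
  have := hasDerivAt_exp_smul_const (𝕂 := ℝ) (-D) s
  rwa [mul_neg] at this

lemma continuous_exp_smul (D : R) : Continuous fun u : ℝ => exp (u • D) :=
  continuous_iff_continuousAt.2 fun s => (hasDerivAt_exp_smul D s).continuousAt

lemma exp_smul_neg_mul (D : R) (s : ℝ) : exp (s • -D) * exp (s • D) = 1 := by
  rw [smul_neg, exp_neg_mul_exp]

lemma hasDerivAt_conj (D T : R) (s : ℝ) :
    HasDerivAt (fun u : ℝ => exp (u • -D) * T * exp (u • D))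
      (exp (s • -D) * (T * D - D * T) * exp (s • D)) s := by
  have h := ((hasDerivAt_exp_neg_smul D s).mul_const T).mul (hasDerivAt_exp_smul D s)
  refine HasDerivAt.congr_deriv h ?_
  noncomm_ring

lemma integral_conj (D T : R) :
    ∫ s in (0 : ℝ)..1, exp (s • -D) * (T * D - D * T) * exp (s • D) =
      exp (-D) * T * exp D - T := by
  rw [intervalIntegral.integral_eq_sub_of_hasDerivAt (fun s _ => hasDerivAt_conj D T s)]
  · simp
  · exact (((continuous_exp_smul (-D)).mul continuous_const).mul
      (continuous_exp_smul D)).intervalIntegrable _ _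

lemma mul_integral_exp_neg (D : R) :
    D * ∫ s in (0 : ℝ)..1, exp (s • -D) = 1 - exp (-D) := by
  have h : ∀ s ∈ Set.uIcc (0 : ℝ) 1,
      HasDerivAt (fun u : ℝ => -exp (u • -D)) (D * exp (s • -D)) s := fun s _ => by
    have := (hasDerivAt_exp_smul (-D) s).fun_neg
    rwa [neg_mul, neg_neg] at this
  have h2 := intervalIntegral.integral_eq_sub_of_hasDerivAt h
    ((continuous_const.mul (continuous_exp_smul (-D))).intervalIntegrable _ _)
  have h3 := (ContinuousLinearMap.mul ℝ R D).intervalIntegral_comp_comm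
    (a := 0) (b := 1) (μ := volume) ((continuous_exp_smul (-D)).intervalIntegrable 0 1)
  simp only [ContinuousLinearMap.mul_apply'] at h3
  rw [← h3, h2]
  simp [exp_zero]
  abel

lemma norm_exp_smul_sub_one_le {D : R} {ε : ℝ} (hD : Real.exp ‖D‖ - 1 ≤ ε) {s : ℝ}
    (hs : s ∈ Set.Icc (0 : ℝ) 1) : ‖exp (s • D) - 1‖ ≤ ε := by
  refine (norm_exp_sub_one_le _).trans (le_trans ?_ hD)
  gcongr
  rw [norm_smul, Real.norm_of_nonneg hs.1]
  exact mul_le_of_le_one_left (norm_nonneg _) hs.2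

end Conjugation

section LieInterpolation

open NormedSpace

variable {X : Type*} [NormedAddCommGroup X] [NormedSpace ℝ X] [CompleteSpace X]

lemma exp_neg_apply_exp_apply (D : X →L[ℝ] X) (x : X) : exp (-D) (exp D x) = x := by
  rw [← mul_apply_eq_comp, exp_neg_mul_exp, one_apply_eq_self]

lemma exp_apply_exp_neg_apply (D : X →L[ℝ] X) (x : X) : exp D (exp (-D) x) = x := by
  rw [← mul_apply_eq_comp, exp_mul_exp_neg, one_apply_eq_self]

/-- The defect of `D` being a derivation of `β`. -/
def derivDefect (β : X →L[ℝ] X →L[ℝ] X) (D : X →L[ℝ] X) (x y : X) : X :=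
  β (D x) y + β x (D y) - D (β x y)

lemma hasDerivAt_exp_bilin (β : X →L[ℝ] X →L[ℝ] X) (D : X →L[ℝ] X) (x y : X) (s : ℝ) :
    HasDerivAt (fun u : ℝ => exp (u • -D) (β (exp (u • D) x) (exp (u • D) y)))
      (exp (s • -D) (derivDefect β D (exp (s • D) x) (exp (s • D) y))) s := by
  have h1 : HasDerivAt (fun u : ℝ => exp (u • D) x) (D (exp (s • D) x)) s :=
    ((hasDerivAt_exp_smul D s).clm_apply (hasDerivAt_const s x)).congr_deriv (by simp)
  have h2 : HasDerivAt (fun u : ℝ => exp (u • D) y) (D (exp (s • D) y)) s :=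
    ((hasDerivAt_exp_smul D s).clm_apply (hasDerivAt_const s y)).congr_deriv (by simp)
  have h3 := (β.hasFDerivAt.comp_hasDerivAt s h1).clm_apply h2
  have h4 := (hasDerivAt_exp_neg_smul D s).clm_apply h3
  refine HasDerivAt.congr_deriv h4 ?_
  simp only [derivDefect, neg_apply, mul_apply_eq_comp, map_add, map_sub, Function.comp_apply]
  abel

lemma exp_map_bilin {β : X →L[ℝ] X →L[ℝ] X} {D : X →L[ℝ] X}
    (hD : ∀ x y, D (β x y) = β (D x) y + β x (D y)) (s : ℝ) (x y : X) :
    exp (s • D) (β x y) = β (exp (s • D) x) (exp (s • D) y) := by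
  have h0 : ∀ x y, derivDefect β D x y = 0 := fun x y => by rw [derivDefect, hD, sub_self]
  have hc := is_const_of_deriv_eq_zero
    (fun u => (hasDerivAt_exp_bilin β D x y u).differentiableAt)
    (fun u => by rw [(hasDerivAt_exp_bilin β D x y u).deriv, h0, map_zero]) s 0
  simp only [zero_smul, exp_zero, one_apply_eq_self] at hc
  rw [← hc, smul_neg, exp_apply_exp_neg_apply]

lemma norm_triple_sub_le {E F G : Type*} [NormedAddCommGroup E] [NormedSpace ℝ E]
    [NormedAddCommGroup F] [NormedSpace ℝ F] [NormedAddCommGroup G] [NormedSpace ℝ G]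
    (B : E →L[ℝ] F →L[ℝ] G) (P : G →L[ℝ] G) (Q : E →L[ℝ] E) (T : F →L[ℝ] F)
    (hP : ‖P - 1‖ ≤ 1 / 10) (hQ : ‖Q - 1‖ ≤ 1 / 10) (hT : ‖T - 1‖ ≤ 1 / 10) (x : E) (y : F) :
    ‖B x y - P (B (Q x) (T y))‖ ≤ 1 / 2 * (‖B‖ * ‖x‖ * ‖y‖) := by
  have e : B x y - P (B (Q x) (T y)) =
      -(B (Q x) (T y - y) + B (Q x - x) y + (P - 1) (B (Q x) (T y))) := by
    simp only [map_sub, sub_apply, one_apply_eq_self]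
    abel
  have hQx : ‖Q x - x‖ ≤ 1 / 10 * ‖x‖ := by
    simpa using (Q - 1).le_of_opNorm_le hQ x
  have hTy : ‖T y - y‖ ≤ 1 / 10 * ‖y‖ := by
    simpa using (T - 1).le_of_opNorm_le hT y
  have hQn : ‖Q x‖ ≤ 11 / 10 * ‖x‖ := by
    have := norm_add_le (Q x - x) x
    rw [sub_add_cancel] at this; linarith
  have hTn : ‖T y‖ ≤ 11 / 10 * ‖y‖ := by
    have := norm_add_le (T y - y) y
    rw [sub_add_cancel] at this; linarith
  have b1 : ‖B (Q x) (T y - y)‖ ≤ ‖B‖ * (11 / 10 * ‖x‖) * (1 / 10 * ‖y‖) :=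
    (B.le_opNorm₂ _ _).trans (by gcongr)
  have b2 : ‖B (Q x - x) y‖ ≤ ‖B‖ * (1 / 10 * ‖x‖) * ‖y‖ :=
    (B.le_opNorm₂ _ _).trans (by gcongr)
  have b3 : ‖B (Q x) (T y)‖ ≤ ‖B‖ * (11 / 10 * ‖x‖) * (11 / 10 * ‖y‖) :=
    (B.le_opNorm₂ _ _).trans (by gcongr)
  have b4 : ‖(P - 1) (B (Q x) (T y))‖ ≤ 1 / 10 * (‖B‖ * (11 / 10 * ‖x‖) * (11 / 10 * ‖y‖)) :=
    ((P - 1).le_of_opNorm_le hP _).trans (by gcongr)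
  rw [e, norm_neg]
  have hn : 0 ≤ ‖B‖ * ‖x‖ * ‖y‖ := by positivity
  refine (norm_add₃_le).trans ?_
  nlinarith

lemma eq_zero_of_integral_eq_zero {F : Type*} [NormedAddCommGroup F] [NormedSpace ℝ F]
    [CompleteSpace F] (x : F) {f : ℝ → F} (hf : Continuous f)
    (h0 : ∫ s in (0 : ℝ)..1, f s = 0) {C : ℝ} (h : ∀ s ∈ Set.Icc (0 : ℝ) 1, ‖x - f s‖ ≤ C) :
    ‖x‖ ≤ C := by
  have h1 : ∫ s in (0 : ℝ)..1, (x - f s) = x := by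
    rw [intervalIntegral.integral_sub (by simp) (hf.intervalIntegrable _ _), h0]
    simp
  rw [← h1]
  have := intervalIntegral.norm_integral_le_of_norm_le_const (a := 0) (b := 1) (C := C)
    (f := fun s => x - f s) (fun s hs => h s (by
      rw [Set.uIoc_of_le zero_le_one] at hs; exact ⟨hs.1.le, hs.2⟩))
  simpa using this

lemma derivation_of_exp_automorphism {β : X →L[ℝ] X →L[ℝ] X} {D : X →L[ℝ] X}
    (hs : Real.exp ‖D‖ - 1 ≤ 1 / 10)
    (hD : ∀ x y, exp D (β x y) = β (exp D x) (exp D y)) (x y : X) :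
    D (β x y) = β (D x) y + β x (D y) := by
  let δ : X →L[ℝ] X →L[ℝ] X :=
    β.comp D + ((ContinuousLinearMap.compL ℝ X X X).flip D).comp β -
      ((ContinuousLinearMap.compL ℝ X X X) D).comp β
  have hδ : ∀ x y, δ x y = derivDefect β D x y := fun x y => rfl
  have hs' : Real.exp ‖-D‖ - 1 ≤ 1 / 10 := by rwa [norm_neg]
  have hint : ∀ x y, ∫ s in (0 : ℝ)..1,
      exp (s • -D) (δ (exp (s • D) x) (exp (s • D) y)) = 0 := by
    intro x y
    refine (intervalIntegral.integral_eq_sub_of_hasDerivAt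
      (fun s _ => hasDerivAt_exp_bilin β D x y s) ?_).trans ?_
    rotate_left
    · simp only [one_smul, ← hD, exp_neg_apply_exp_apply, zero_smul, exp_zero, one_apply_eq_self,
        sub_self]
    · refine Continuous.intervalIntegrable ?_ _ _
      exact (continuous_exp_smul (-D)).clm_apply
        ((δ.continuous.comp ((continuous_exp_smul D).clm_apply continuous_const)).clm_apply
          ((continuous_exp_smul D).clm_apply continuous_const))
  have hb : ∀ x y, ‖δ x y‖ ≤ 1 / 2 * ‖δ‖ * ‖x‖ * ‖y‖ := by
    intro x y
    refine (eq_zero_of_integral_eq_zero (δ x y) ?_ (hint x y) (C := 1 / 2 * (‖δ‖ * ‖x‖ * ‖y‖))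
      fun s hs1 => ?_).trans (by ring_nf; exact le_rfl)
    · exact (continuous_exp_smul (-D)).clm_apply
        ((δ.continuous.comp ((continuous_exp_smul D).clm_apply continuous_const)).clm_apply
          ((continuous_exp_smul D).clm_apply continuous_const))
    · exact norm_triple_sub_le δ _ _ _ (norm_exp_smul_sub_one_le hs' hs1)
        (norm_exp_smul_sub_one_le hs hs1) (norm_exp_smul_sub_one_le hs hs1) x y
  have h2 : ‖δ‖ ≤ 1 / 2 * ‖δ‖ := δ.opNorm_le_bound₂ (by positivity) hb
  have h3 : ‖δ‖ = 0 := by linarith [norm_nonneg δ]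
  have h4 : δ x y = 0 := by
    have := hb x y
    rw [h3] at this
    simpa using this
  rw [hδ, derivDefect, sub_eq_zero] at h4
  exact h4.symm

lemma exp_bound_aux {x : ℝ} (hx : x ≤ 9 / 100) : Real.exp x - 1 ≤ 1 / 10 := by
  have h1 : Real.exp x ≤ Real.exp (9 / 100) := Real.exp_le_exp.2 hx
  have h2 := Real.exp_bound' (x := 9 / 100) (by norm_num) (by norm_num) (n := 3) (by norm_num)
  norm_num [Finset.sum_range_succ, Nat.factorial] at h2
  linarith

lemma exp_mul_exp_sub_one_le {A B : X →L[ℝ] X} (hA : ‖A‖ ≤ 1 / 50) (hB : ‖B‖ ≤ 1 / 50) :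
    ‖exp A * exp B - 1‖ ≤ 9 / 200 := by
  have key : ∀ T : X →L[ℝ] X, ‖T‖ ≤ 1 / 50 → ‖exp T - 1‖ ≤ 21 / 1000 := by
    intro T hT
    refine (norm_exp_sub_one_le T).trans ?_
    have h1 : Real.exp ‖T‖ ≤ Real.exp (1 / 50) := Real.exp_le_exp.2 hT
    have h2 := Real.exp_bound' (x := 1 / 50) (by norm_num) (by norm_num) (n := 3) (by norm_num)
    norm_num [Finset.sum_range_succ, Nat.factorial] at h2
    linarith
  have e : exp A * exp B - 1 = (exp A - 1) * (exp B - 1) + (exp A - 1) + (exp B - 1) := by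
    noncomm_ring
  rw [e]
  refine (norm_add₃_le).trans ?_
  have h1 := (norm_mul_le (exp A - 1) (exp B - 1)).trans
    (mul_le_mul (key A hA) (key B hB) (norm_nonneg _) (by norm_num))
  linarith [key A hA, key B hB]

/-- `K = ∫₀¹ e^{-sD} ds`. -/
def expMean (D : X →L[ℝ] X) : X →L[ℝ] X := ∫ s in (0 : ℝ)..1, exp (s • -D)

lemma expMean_apply (D : X →L[ℝ] X) (x : X) :
    expMean D x = ∫ s in (0 : ℝ)..1, exp (s • -D) x := by
  have := (ContinuousLinearMap.apply ℝ X x).intervalIntegral_comp_comm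
    (a := 0) (b := 1) (μ := volume) ((continuous_exp_smul (-D)).intervalIntegrable 0 1)
  simpa [expMean] using this.symm

lemma norm_expMean_sub_one_le {D : X →L[ℝ] X} (hs : Real.exp ‖D‖ - 1 ≤ 1 / 10) :
    ‖1 - expMean D‖ ≤ 1 / 10 := by
  have hs' : Real.exp ‖-D‖ - 1 ≤ 1 / 10 := by rwa [norm_neg]
  have h1 : ∫ s in (0 : ℝ)..1, ((1 : X →L[ℝ] X) - exp (s • -D)) = 1 - expMean D := by
    rw [intervalIntegral.integral_sub (by simp)
      ((continuous_exp_smul (-D)).intervalIntegrable _ _)]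
    simp [expMean]
  rw [← h1]
  have := intervalIntegral.norm_integral_le_of_norm_le_const (a := 0) (b := 1) (C := 1 / 10)
    (f := fun s : ℝ => (1 : X →L[ℝ] X) - exp (s • -D)) (fun s hs => by
      rw [Set.uIoc_of_le zero_le_one] at hs
      rw [norm_sub_rev]
      exact norm_exp_smul_sub_one_le hs' ⟨hs.1.le, hs.2⟩)
  simpa using this

lemma expMean_apply_mem {S : Submodule ℝ X} (hS : IsClosed (S : Set X)) {D : X →L[ℝ] X}
    (hD : ∀ x ∈ S, D x ∈ S) : ∀ x ∈ S, expMean D x ∈ S := by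
  intro x hx
  rw [expMean_apply]
  have hc : Continuous fun s : ℝ => exp (s • -D) x :=
    (continuous_exp_smul (-D)).clm_apply continuous_const
  have hm : ∀ s : ℝ, exp (s • -D) x ∈ S := fun s =>
    exp_apply_mem hS (smul_apply_mem (fun x hx => by simpa using hD x hx) s) x hx
  have : CompleteSpace S := hS.completeSpace_coe
  let f : ℝ → S := fun s => ⟨_, hm s⟩
  have hf : Continuous f := hc.subtype_mk _
  have := S.subtypeL.intervalIntegral_comp_comm (a := 0) (b := 1) (μ := volume)
    (hf.intervalIntegrable 0 1)
  simp only [Submodule.subtypeL_apply, f] at this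
  rw [this]
  exact Submodule.coe_mem _

/-- The solution of `K y = x` for `K` close to the identity. -/
lemma exists_solution_near_one {K : X →L[ℝ] X} (hK : ‖1 - K‖ ≤ 1 / 10) (x : X) :
    ∃ y, K y = x ∧ ‖y‖ ≤ 2 * ‖x‖ ∧ ∀ S : Submodule ℝ X, IsClosed (S : Set X) →
      (∀ z ∈ S, K z ∈ S) → x ∈ S → y ∈ S := by
  have hlt : ‖1 - K‖ < 1 := by linarith
  have hs := (summable_geometric_of_norm_lt_one (x := 1 - K) hlt)
  have hmul := mul_neg_geom_series (1 - K) hlt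
  rw [sub_sub_cancel] at hmul
  have hy : K ((∑' n : ℕ, (1 - K) ^ n) x) = x := by
    rw [← mul_apply_eq_comp, hmul, one_apply_eq_self]
  refine ⟨(∑' n : ℕ, (1 - K) ^ n) x, hy, ?_, ?_⟩
  · set y := (∑' n : ℕ, (1 - K) ^ n) x
    have h1 : y = x + (1 - K) y := by simp [hy]
    have h2 := (1 - K).le_of_opNorm_le hK y
    have h3 := norm_add_le x ((1 - K) y)
    rw [← h1] at h3
    linarith [norm_nonneg x]
  · intro S hS hKS hx
    refine hasSum_apply_mem hS hs.hasSum (fun n => pow_apply_mem (fun z hz => ?_) n) x hx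
    simpa using S.sub_mem hz (hKS z hz)

lemma exp_conj_of_commutator {E B : X →L[ℝ] X} (h : E * B - B * E = B) :
    E * exp B = exp B * E + exp B * B := by
  have h1 := integral_conj B E
  have hc : ∀ s : ℝ, exp (s • -B) * (E * B - B * E) * exp (s • B) = B := by
    intro s
    have hcm : Commute B (exp (s • B)) := Commute.exp_right ((Commute.refl B).smul_right s)
    rw [h, mul_assoc, hcm.eq, ← mul_assoc, exp_smul_neg_mul, one_mul]
  simp only [hc, intervalIntegral.integral_const, sub_zero, one_smul] at h1
  have h2 : exp B * B = exp B * (exp (-B) * E * exp B - E) := congrArg (exp B * ·) h1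
  rw [mul_sub, ← mul_assoc, ← mul_assoc, exp_mul_exp_neg, one_mul] at h2
  rw [h2]
  abel

lemma commute_exp_of_commute {E A : X →L[ℝ] X} (h : E * A = A * E) :
    E * exp A = exp A * E := Commute.exp_right (show Commute E A from h)

/-- In a graded Banach Lie algebra, `e^{ad a} e^{ad p}` with small `a` of degree `0` and small `p`
of degree `1` fixes every `Z` of degree-zero part `a` with `E Z = K⁻¹ p`. -/
theorem lie_interpolation {β : X →L[ℝ] X →L[ℝ] X} (hanti : ∀ x y, β x y = -β y x)
    (hjac : ∀ x y z, β x (β y z) = β (β x y) z + β y (β x z)) {E : X →L[ℝ] X}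
    (hE : ∀ x y, E (β x y) = β (E x) y + β x (E y)) {a p : X} (ha : E a = 0) (hp : E p = p)
    (hA : ‖β a‖ ≤ 1 / 50) (hB : ‖β p‖ ≤ 1 / 50) :
    ∃ (D : X →L[ℝ] X) (Y : X), ‖Y‖ ≤ 2 * ‖p‖ ∧
      (∀ S : Submodule ℝ X, IsClosed (S : Set X) → (∀ x ∈ S, β a x ∈ S) → (∀ x ∈ S, β p x ∈ S) →
        p ∈ S → Y ∈ S ∧ ∀ (l : X →L[ℝ] ℂ) (θ : ℝ), |θ| ≤ 1 / 4 →
          (∀ x ∈ S, l (β a x) = -(Complex.I * θ) * l x) → (∀ x ∈ S, l (β p x) = 0) →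
          l (D p) = -(Complex.I * θ) * l p ∧
          l p = (∫ s in (0 : ℝ)..1, Complex.exp (s * (Complex.I * θ))) * l Y) ∧
      ∀ Z, E Z = Y → E (D p + β p Z) = D p + β p Z ∧
        E (exp (β a) (exp (β p) Z) - Z) = exp (β a) (exp (β p) (D p + β p Z)) := by
  set U : X →L[ℝ] X := exp (β a) * exp (β p) with hU
  have hV : ‖U - 1‖ ≤ 9 / 200 := exp_mul_exp_sub_one_le hA hB
  obtain ⟨D, hDs, hDe, hDn⟩ := exists_log (U - 1) (by linarith)
  have hexp : exp D = U := by rw [hDe]; abel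
  have hs : Real.exp ‖D‖ - 1 ≤ 1 / 10 := exp_bound_aux (by linarith)
  have hs' : Real.exp ‖-D‖ - 1 ≤ 1 / 10 := by rwa [norm_neg]
  obtain ⟨Y, hKY, hYn, hYS⟩ := exists_solution_near_one (norm_expMean_sub_one_le hs) p
  have hUaut : ∀ x y, U (β x y) = β (U x) (U y) := by
    intro x y
    have h1 := exp_map_bilin (β := β) (D := β p) (fun x y => hjac p x y) 1
    have h2 := exp_map_bilin (β := β) (D := β a) (fun x y => hjac a x y) 1
    simp only [one_smul] at h1 h2
    simp only [hU, mul_apply_eq_comp, h1, h2]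
  have hDder := derivation_of_exp_automorphism (β := β) hs (by rwa [hexp])
  have hDflow := fun s x y => exp_map_bilin (β := β) hDder s x y
  have hEA : E * β a = β a * E := by
    ext x; simp only [mul_apply_eq_comp, hE, ha, map_zero, zero_apply, zero_add]
  have hEB : E * β p - β p * E = β p := by
    ext x; simp only [sub_apply, mul_apply_eq_comp, hE, hp, add_sub_cancel_right]
  have hEU : E * U = U * E + U * β p := by
    rw [hU, ← mul_assoc, commute_exp_of_commute hEA, mul_assoc, exp_conj_of_commutator hEB]
    noncomm_ring
  -- the commutator of the degree with the logarithm
  have hED : E * D - D * E = β Y := by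
    have hconj : ∀ (s : ℝ), exp (s • -D) * β Y * exp (s • D) = β (exp (s • -D) Y) := by
      intro s
      ext x
      have := hDflow (-s) Y (exp (s • D) x)
      simp only [neg_smul, ← smul_neg] at this
      rw [mul_apply_eq_comp, mul_apply_eq_comp, this, ← mul_apply_eq_comp (exp (s • -D)),
        exp_smul_neg_mul, one_apply_eq_self]
    have hcY : Continuous fun s : ℝ => exp (s • -D) Y :=
      (continuous_exp_smul (-D)).clm_apply continuous_const
    have h1 : ∫ s in (0 : ℝ)..1, exp (s • -D) * β Y * exp (s • D) = β p := by
      simp only [hconj]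
      rw [β.intervalIntegral_comp_comm (hcY.intervalIntegrable 0 1), ← expMean_apply, hKY]
    have h2 : ∫ s in (0 : ℝ)..1, exp (s • -D) * (E * D - D * E) * exp (s • D) = β p := by
      rw [integral_conj, hexp, mul_assoc, hEU, ← hexp, mul_add, ← mul_assoc, ← mul_assoc,
        exp_neg_mul_exp, one_mul, one_mul]
      abel
    have hcont : ∀ T : X →L[ℝ] X, Continuous fun s : ℝ => exp (s • -D) * T * exp (s • D) :=
      fun T => ((continuous_exp_smul (-D)).mul continuous_const).mul (continuous_exp_smul D)
    set T := β Y - (E * D - D * E) with hT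
    have h3 : ∫ s in (0 : ℝ)..1, exp (s • -D) * T * exp (s • D) = 0 := by
      have e : ∀ s : ℝ, exp (s • -D) * T * exp (s • D) = exp (s • -D) * β Y * exp (s • D) -
          exp (s • -D) * (E * D - D * E) * exp (s • D) := fun s => by
        rw [hT, mul_sub, sub_mul]
      simp only [e]
      rw [intervalIntegral.integral_sub ((hcont _).intervalIntegrable _ _)
        ((hcont _).intervalIntegrable _ _), h1, h2, sub_self]
    have h4 : ‖T‖ ≤ 1 / 2 * ‖T‖ := by
      refine eq_zero_of_integral_eq_zero T (hcont T) h3 fun s hs1 => ?_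
      have p1 := norm_exp_smul_sub_one_le hs' hs1
      have p2 := norm_exp_smul_sub_one_le hs hs1
      have e : T - exp (s • -D) * T * exp (s • D) =
          -((exp (s • -D) - 1) * T * (exp (s • D) - 1) + (exp (s • -D) - 1) * T +
            T * (exp (s • D) - 1)) := by noncomm_ring
      rw [e, norm_neg]
      refine (norm_add₃_le).trans ?_
      have q1 := norm_mul_le ((exp (s • -D) - 1) * T) (exp (s • D) - 1)
      have q2 := norm_mul_le (exp (s • -D) - 1) T
      have q3 := norm_mul_le T (exp (s • D) - 1)
      have hTn := norm_nonneg T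
      have r2 : ‖exp (s • -D) - 1‖ * ‖T‖ ≤ 1 / 10 * ‖T‖ := by gcongr
      have r3 : ‖T‖ * ‖exp (s • D) - 1‖ ≤ ‖T‖ * (1 / 10) := by gcongr
      have r1 : ‖(exp (s • -D) - 1) * T‖ * ‖exp (s • D) - 1‖ ≤ (1 / 10 * ‖T‖) * (1 / 10) := by
        gcongr
        exact q2.trans r2
      linarith
    have h5 : T = 0 := by
      have : ‖T‖ ≤ 0 := by linarith
      exact norm_le_zero_iff.1 this
    rw [hT, sub_eq_zero] at h5
    exact h5.symm
  refine ⟨D, Y, hYn, ?_, ?_⟩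
  · intro S hS hSA hSB hpS
    have hSU : ∀ x ∈ S, U x ∈ S := fun x hx => by
      rw [hU, mul_apply_eq_comp]
      exact exp_apply_mem hS hSA _ (exp_apply_mem hS hSB x hx)
    have hSV : ∀ x ∈ S, (U - 1) x ∈ S := fun x hx => by
      simpa using S.sub_mem (hSU x hx) hx
    have hSD : ∀ x ∈ S, D x ∈ S := hasSum_apply_mem hS hDs (logTerm_apply_mem hSV)
    have hYm : Y ∈ S := hYS S hS (expMean_apply_mem hS hSD) hpS
    refine ⟨hYm, fun l θ hθ hlA hlB => ?_⟩
    have hlU : ∀ x ∈ S, l (U x) = Complex.exp (-(Complex.I * θ)) * l x := fun x hx => by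
      rw [hU, mul_apply_eq_comp, exp_apply_eigen hSA hlA _ (exp_apply_mem hS hSB x hx),
        exp_apply_eigen (T := β p) (μ := 0) hSB (fun x hx => by rw [hlB x hx, zero_mul]) x hx]
      simp
    have hlV : ∀ x ∈ S, l ((U - 1) x) = (Complex.exp (-(Complex.I * θ)) - 1) * l x :=
      fun x hx => by
        rw [sub_apply, one_apply_eq_self, map_sub, hlU x hx, sub_mul, one_mul]
    have hnI : ‖-(Complex.I * (θ : ℂ))‖ ≤ 1 / 4 := by simpa using hθ
    have hlD := log_apply_eigen (μ := Complex.exp (-(Complex.I * θ)) - 1) hSV hDs (by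
      have := Complex.norm_exp_sub_one_le (x := -(Complex.I * (θ : ℂ))) (by linarith)
      linarith) hlV
    have hlog : Complex.log (1 + (Complex.exp (-(Complex.I * θ)) - 1)) = -(Complex.I * θ) := by
      rw [add_sub_cancel, Complex.log_exp]
      · simp; linarith [(abs_le.1 hθ).2, Real.pi_gt_three]
      · simp; linarith [(abs_le.1 hθ).1, Real.pi_gt_three]
    rw [hlog] at hlD
    refine ⟨hlD p hpS, ?_⟩
    have hfl : ∀ s : ℝ, l (exp (s • -D) Y) = Complex.exp (s * (Complex.I * θ)) * l Y := by
      intro s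
      refine exp_apply_eigen (S := S) (T := s • -D)
        (smul_apply_mem (fun x hx => by simpa using hSD x hx) s) (fun x hx => ?_) Y hYm
      rw [smul_apply, neg_apply, map_smul, map_neg, hlD x hx, Complex.real_smul]
      ring
    have hcY : Continuous fun s : ℝ => exp (s • -D) Y :=
      (continuous_exp_smul (-D)).clm_apply continuous_const
    conv_lhs => rw [← hKY, expMean_apply,
      ← l.intervalIntegral_comp_comm (hcY.intervalIntegrable 0 1)]
    simp only [hfl]
    exact intervalIntegral.integral_mul_const _ _
  · intro Z hZ
    have hEDp : E (D p) = D p + β Y p := by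
      have := congrArg (fun T : X →L[ℝ] X => T p) hED
      simp only [sub_apply, mul_apply_eq_comp, hp] at this
      rw [← this]; abel
    refine ⟨?_, ?_⟩
    · rw [map_add, hEDp, hE, hp, hZ, hanti Y p]
      abel
    · have h1 : E (U Z) = U Y + U (β p Z) := by
        have := congrArg (fun T : X →L[ℝ] X => T Z) hEU
        simpa only [add_apply, mul_apply_eq_comp, hZ] using this
      have h2 : D p = Y - exp (-D) Y := by
        have := congrArg (fun T : X →L[ℝ] X => T Y) (mul_integral_exp_neg D)
        simp only [mul_apply_eq_comp, sub_apply, one_apply_eq_self] at this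
        rw [← this]
        congr 1
        exact hKY.symm
      have h3 : U (exp (-D) Y) = Y := by rw [← hexp, exp_apply_exp_neg_apply]
      show E (U Z - Z) = U (D p + β p Z)
      rw [map_sub, h1, hZ, map_add, h2, map_sub, h3]
      abel

end LieInterpolation

section Words

/-- Complex conjugation iterated `k` times. -/
def cj (k : ℕ) (z : ℂ) : ℂ := if Even k then z else (starRingEnd ℂ) z

lemma cj_congr {k l : ℕ} (h : Even k ↔ Even l) (z : ℂ) : cj k z = cj l z := by simp only [cj, h]

@[simp] lemma cj_zero (z : ℂ) : cj 0 z = z := by simp [cj]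

lemma cj_succ (k : ℕ) (z : ℂ) : cj (k + 1) z = (starRingEnd ℂ) (cj k z) := by
  by_cases h : Even k <;> simp [cj, h, Nat.even_add_one]

lemma cj_cj (k l : ℕ) (z : ℂ) : cj k (cj l z) = cj (k + l) z := by
  by_cases h : Even k <;> by_cases h' : Even l <;> simp [cj, h, h', Nat.even_add]

lemma cj_mul (k : ℕ) (z w : ℂ) : cj k (z * w) = cj k z * cj k w := by
  by_cases h : Even k <;> simp [cj, h]

lemma cj_add (k : ℕ) (z w : ℂ) : cj k (z + w) = cj k z + cj k w := by
  by_cases h : Even k <;> simp [cj, h]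

lemma cj_apply_zero (k : ℕ) : cj k 0 = 0 := by
  by_cases h : Even k <;> simp [cj, h]

lemma cj_ofReal_mul (k : ℕ) (r : ℝ) (z : ℂ) : cj k (r * z) = r * cj k z := by
  by_cases h : Even k <;> simp [cj, h]

@[simp] lemma norm_cj (k : ℕ) (z : ℂ) : ‖cj k z‖ = ‖z‖ := by
  by_cases h : Even k <;> simp [cj, h]

variable {α : Type*}

/-- Sum over all ways to write a word as a concatenation of two words. -/
def spl (F : List α → List α → ℂ) : List α → ℂ
  | [] => F [] []
  | x :: t => F [] (x :: t) + spl (fun q r => F (x :: q) r) t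

lemma spl_congr {F G : List α → List α → ℂ} {u : List α}
    (h : ∀ q r, q ++ r = u → F q r = G q r) : spl F u = spl G u := by
  induction u generalizing F G with
  | nil => exact h [] [] rfl
  | cons x t ih =>
    simp only [spl]
    rw [h [] (x :: t) rfl, ih (fun q r hqr => h (x :: q) r (by simp [hqr]))]

lemma spl_add (F G : List α → List α → ℂ) (u : List α) :
    spl (fun q r => F q r + G q r) u = spl F u + spl G u := by
  induction u generalizing F G with
  | nil => rfl
  | cons x t ih => simp only [spl, ih]; ring

lemma spl_mul_left (c : ℂ) (F : List α → List α → ℂ) (u : List α) :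
    spl (fun q r => c * F q r) u = c * spl F u := by
  induction u generalizing F with
  | nil => rfl
  | cons x t ih => simp only [spl, ih]; ring

lemma spl_zero (u : List α) : spl (fun _ _ => (0 : ℂ)) u = 0 := by
  induction u with
  | nil => rfl
  | cons x t ih => simp only [spl, ih]; ring

lemma spl_cj (k : ℕ) (F : List α → List α → ℂ) (u : List α) :
    spl (fun q r => cj k (F q r)) u = cj k (spl F u) := by
  induction u generalizing F with
  | nil => rfl
  | cons x t ih => simp only [spl, ih, cj_add]

lemma spl_spl (F : List α → List α → List α → ℂ) (u : List α) :
    spl (fun m r => spl (fun p q => F p q r) m) u = spl (fun p s => spl (fun q r => F p q r) s) u := by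
  induction u generalizing F with
  | nil => rfl
  | cons x t ih =>
    simp only [spl, spl_add, ih]
    ring

lemma spl_comm (F : List α → List α → List α → List α → ℂ) (u v : List α) :
    spl (fun p q => spl (fun r s => F p q r s) v) u =
      spl (fun r s => spl (fun p q => F p q r s) u) v := by
  induction u generalizing F with
  | nil => rfl
  | cons x t ih => simp only [spl, spl_add, ih]

lemma spl_append_cons (F : List α → List α → ℂ) (p : List α) (x : α) (r : List α) :
    spl F (p ++ x :: r) =
      spl (fun p₁ p₂ => F p₁ (p₂ ++ x :: r)) p + spl (fun r₁ r₂ => F (p ++ x :: r₁) r₂) r := by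
  induction p generalizing F with
  | nil => rfl
  | cons y t ih => simp only [List.cons_append, spl, ih]; ring

lemma spl_eq_sum (F : List α → List α → ℂ) (u : List α) :
    spl F u = ∑ k ∈ Finset.range (u.length + 1), F (u.take k) (u.drop k) := by
  induction u generalizing F with
  | nil => simp [spl]
  | cons x t ih =>
    rw [List.length_cons, Finset.sum_range_succ', spl, ih, add_comm]
    rfl

lemma norm_spl_le {F : List α → List α → ℂ} {u : List α} {C : ℝ}
    (h : ∀ q r, q ++ r = u → ‖F q r‖ ≤ C) : ‖spl F u‖ ≤ (u.length + 1) * C := by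
  rw [spl_eq_sum]
  refine (norm_sum_le_of_le _ (fun k _ => h _ _ (List.take_append_drop k u))).trans ?_
  simp

lemma spl_eq_of_length {F : List α → List α → ℂ} {u : List α} {k : ℕ}
    (h : ∀ q r, q ++ r = u → q.length ≠ k → F q r = 0) :
    spl F u = if k ≤ u.length then F (u.take k) (u.drop k) else 0 := by
  rw [spl_eq_sum]
  split_ifs with hk
  · refine Finset.sum_eq_single_of_mem k (by simp; omega) fun j hj hjk => ?_
    refine h _ _ (List.take_append_drop j u) ?_
    simp only [Finset.mem_range] at hj
    rw [List.length_take]; omega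
  · refine Finset.sum_eq_zero fun j hj => ?_
    refine h _ _ (List.take_append_drop j u) ?_
    simp only [Finset.mem_range] at hj
    rw [List.length_take]; omega

variable {d : ℕ}

/-- The alternating sum of a word. -/
def alt : List (V d) → V d
  | [] => 0
  | x :: t => x - alt t

lemma alt_append (p q : List (V d)) :
    alt (p ++ q) = if Even p.length then alt p + alt q else alt p - alt q := by
  induction p with
  | nil => simp [alt]
  | cons x t ih =>
    simp only [List.cons_append, alt, ih, List.length_cons, Nat.even_add_one]
    by_cases h : Even t.length <;> simp [h] <;> abel

lemma alt_contract (p q r : List (V d)) (hq : Odd q.length) :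
    alt (p ++ alt q :: r) = alt (p ++ (q ++ r)) := by
  have hq' : ¬ Even q.length := Nat.not_even_iff_odd.2 hq
  simp only [alt_append, alt, hq', if_false]

/-- Coefficients of formal vector fields, as functions on words. -/
abbrev Wd (d : ℕ) := List (V d) → ℂ

/-- Insertion of the vector field `c` in the slots of `f`. -/
def ins (c f : Wd d) : Wd d := fun u =>
  spl (fun p s => spl (fun q r =>
    if Odd q.length then cj p.length (c q) * f (p ++ alt q :: r) else 0) s) u

/-- The bracket of formal vector fields. -/
def br (b c : Wd d) : Wd d := fun u => ins b c u - ins c b u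

lemma ins_congr {c c' f f' : Wd d} {u : List (V d)} (hu : Odd u.length)
    (hc : ∀ q : List (V d), Odd q.length → q.length ≤ u.length → c q = c' q)
    (hf : ∀ q : List (V d), Odd q.length → q.length ≤ u.length → f q = f' q) :
    ins c f u = ins c' f' u := by
  refine spl_congr fun p s hps => spl_congr fun q r hqr => ?_
  split_ifs with hq
  · have hl : u.length = p.length + (q.length + r.length) := by
      rw [← hps, ← hqr]; simp
    obtain ⟨k, hk⟩ := hq
    obtain ⟨m, hm⟩ := hu
    rw [hc q ⟨k, hk⟩ (by omega), hf _ ⟨m - k, by simp; omega⟩ (by simp; omega)]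
  · rfl

lemma br_congr {c c' f f' : Wd d} {u : List (V d)} (hu : Odd u.length)
    (hc : ∀ q : List (V d), Odd q.length → q.length ≤ u.length → c q = c' q)
    (hf : ∀ q : List (V d), Odd q.length → q.length ≤ u.length → f q = f' q) :
    br c f u = br c' f' u := by
  rw [br, br, ins_congr hu hc hf, ins_congr hu hf hc]

lemma ins_add_left (c c' f : Wd d) (u : List (V d)) :
    ins (fun q => c q + c' q) f u = ins c f u + ins c' f u := by
  simp only [ins, ← spl_add]
  refine spl_congr fun p s _ => spl_congr fun q r _ => ?_
  split_ifs <;> simp [cj_add, add_mul]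

lemma ins_add_right (c f f' : Wd d) (u : List (V d)) :
    ins c (fun q => f q + f' q) u = ins c f u + ins c f' u := by
  simp only [ins, ← spl_add]
  refine spl_congr fun p s _ => spl_congr fun q r _ => ?_
  split_ifs <;> simp [mul_add]

lemma ins_smul_left (t : ℝ) (c f : Wd d) (u : List (V d)) :
    ins (fun q => t * c q) f u = t * ins c f u := by
  simp only [ins, ← spl_mul_left]
  refine spl_congr fun p s _ => spl_congr fun q r _ => ?_
  split_ifs <;> simp [cj_ofReal_mul, mul_assoc]

lemma ins_smul_right (t : ℝ) (c f : Wd d) (u : List (V d)) :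
    ins c (fun q => t * f q) u = t * ins c f u := by
  simp only [ins, ← spl_mul_left]
  refine spl_congr fun p s _ => spl_congr fun q r _ => ?_
  split_ifs
  · ring
  · simp

lemma br_add_left (c c' f : Wd d) (u : List (V d)) :
    br (fun q => c q + c' q) f u = br c f u + br c' f u := by
  simp only [br, ins_add_left, ins_add_right]; ring

lemma br_add_right (c f f' : Wd d) (u : List (V d)) :
    br c (fun q => f q + f' q) u = br c f u + br c f' u := by
  simp only [br, ins_add_left, ins_add_right]; ring

lemma br_smul_left (t : ℝ) (c f : Wd d) (u : List (V d)) :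
    br (fun q => t * c q) f u = t * br c f u := by
  simp only [br, ins_smul_left, ins_smul_right]; ring

lemma br_smul_right (t : ℝ) (c f : Wd d) (u : List (V d)) :
    br c (fun q => t * f q) u = t * br c f u := by
  simp only [br, ins_smul_left, ins_smul_right]; ring

lemma br_anti (b c : Wd d) (u : List (V d)) : br b c u = -br c b u := by simp [br]

lemma norm_ins_le {c f : Wd d} {u : List (V d)} {C F : ℝ} (hC : 0 ≤ C) (hF : 0 ≤ F)
    (hc : ∀ q, ‖c q‖ ≤ C) (hf : ∀ q, ‖f q‖ ≤ F) :
    ‖ins c f u‖ ≤ (u.length + 1) * ((u.length + 1) * (C * F)) := by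
  refine norm_spl_le fun p s hps => (norm_spl_le (C := C * F) fun q r _ => ?_).trans ?_
  · split_ifs
    · rw [norm_mul, norm_cj]; gcongr
      exacts [hc q, hf _]
    · simp; positivity
  · have : s.length ≤ u.length := by rw [← hps]; simp
    gcongr

/-- The part of an iterated insertion where the two inserted words are disjoint. -/
def insDisj (b c f : Wd d) : Wd d := fun u =>
  spl (fun p s => spl (fun q r => spl (fun r₁ s₂ => spl (fun q' r' =>
    if Odd q.length ∧ Odd q'.length then
      cj p.length (b q) * cj (p.length + 1 + r₁.length) (c q') *
        f (p ++ alt q :: (r₁ ++ alt q' :: r')) else 0) s₂) r) s) u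

lemma ins_ins (b c f : Wd d) (u : List (V d)) :
    ins b (ins c f) u = insDisj b c f u + insDisj c b f u + ins (ins b c) f u := by
  let G : List (V d) → List (V d) → List (V d) → ℂ := fun p q r =>
    if Odd q.length then cj p.length (c q) * f (p ++ alt q :: r) else 0
  let B : List (V d) → List (V d) → ℂ := fun p q => if Odd q.length then cj p.length (b q) else 0
  have h0 : ins b (ins c f) u = spl (fun p s => spl (fun q r => B p q *
      (spl (fun r₁ s₂ => spl (fun q' r' => G (p ++ alt q :: r₁) q' r') s₂) r +
       spl (fun p₁ p₂ => spl (fun q' p₃ => G p₁ q' (p₃ ++ alt q :: r)) p₂) p +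
       spl (fun p₁ p₂ => spl (fun r₁ r₂ => G p₁ (p₂ ++ alt q :: r₁) r₂) r) p)) s) u := by
    refine spl_congr fun p s _ => spl_congr fun q r _ => ?_
    simp only [B]
    split_ifs with hq
    · congr 1
      rw [ins, spl_append_cons]
      simp only [spl_append_cons, spl_add, G]
      ring
    · simp
  rw [h0]
  simp only [mul_add, spl_add]
  congr 1
  · congr 1
    · refine spl_congr fun p s _ => spl_congr fun q r _ => ?_
      rw [← spl_mul_left]
      refine spl_congr fun r₁ s₂ _ => ?_
      rw [← spl_mul_left]
      refine spl_congr fun q' r' _ => ?_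
      simp only [B, G]
      have hl : (p ++ alt q :: r₁).length = p.length + 1 + r₁.length := by simp; omega
      rw [hl, List.append_assoc, List.cons_append]
      by_cases hq : Odd q.length <;> by_cases hq' : Odd q'.length <;>
        simp [hq, hq', mul_assoc]
    · calc _ = spl (fun p s => spl (fun q r => spl (fun p₁ p₂ => spl (fun q' p₃ =>
            B (p₁ ++ p₂) q * G p₁ q' (p₃ ++ alt q :: r)) p₂) p) s) u := by
            refine spl_congr fun p s _ => spl_congr fun q r _ => ?_
            rw [← spl_mul_left]
            refine spl_congr fun p₁ p₂ h => ?_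
            rw [← spl_mul_left, h]
        _ = spl (fun p s => spl (fun p₁ p₂ => spl (fun q r => spl (fun q' p₃ =>
            B (p₁ ++ p₂) q * G p₁ q' (p₃ ++ alt q :: r)) p₂) s) p) u := by
            refine spl_congr fun p s _ => ?_
            rw [spl_comm]
        _ = spl (fun p₁ t => spl (fun p₂ s => spl (fun q r => spl (fun q' p₃ =>
            B (p₁ ++ p₂) q * G p₁ q' (p₃ ++ alt q :: r)) p₂) s) t) u :=
            spl_spl (fun p₁ p₂ s => spl (fun q r => spl (fun q' p₃ =>
              B (p₁ ++ p₂) q * G p₁ q' (p₃ ++ alt q :: r)) p₂) s) u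
        _ = spl (fun p₁ t => spl (fun p₂ s => spl (fun q' p₃ => spl (fun q r =>
            B (p₁ ++ (q' ++ p₃)) q * G p₁ q' (p₃ ++ alt q :: r)) s) p₂) t) u := by
            refine spl_congr fun p₁ t _ => spl_congr fun p₂ s _ => ?_
            rw [spl_comm]
            refine spl_congr fun q' p₃ h => spl_congr fun q r _ => ?_
            rw [h]
        _ = spl (fun p₁ t => spl (fun q' t' => spl (fun p₃ s => spl (fun q r =>
            B (p₁ ++ (q' ++ p₃)) q * G p₁ q' (p₃ ++ alt q :: r)) s) t') t) u := by
            refine spl_congr fun p₁ t _ => ?_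
            exact spl_spl (fun q' p₃ s => spl (fun q r =>
              B (p₁ ++ (q' ++ p₃)) q * G p₁ q' (p₃ ++ alt q :: r)) s) t
        _ = _ := by
            refine spl_congr fun p s _ => spl_congr fun q r _ => spl_congr fun r₁ s₂ _ =>
              spl_congr fun q' r' _ => ?_
            simp only [B, G]
            by_cases hq : Odd q.length <;> by_cases hq' : Odd q'.length <;> simp only [hq, hq',
              if_true, if_false, zero_mul, mul_zero, true_and, false_and, and_false]
            rw [cj_congr (l := p.length + 1 + r₁.length)]
            · ring
            · have := Nat.not_even_iff_odd.2 hq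
              simp only [List.length_append, Nat.even_add, this, Nat.not_even_one]
              tauto
  · calc _ = spl (fun p s => spl (fun q r => spl (fun p₁ p₂ => spl (fun r₁ r₂ =>
            B (p₁ ++ p₂) q * G p₁ (p₂ ++ alt q :: r₁) r₂) r) p) s) u := by
            refine spl_congr fun p s _ => spl_congr fun q r _ => ?_
            rw [← spl_mul_left]
            refine spl_congr fun p₁ p₂ h => ?_
            rw [← spl_mul_left, h]
      _ = spl (fun p s => spl (fun p₁ p₂ => spl (fun q r => spl (fun r₁ r₂ =>
            B (p₁ ++ p₂) q * G p₁ (p₂ ++ alt q :: r₁) r₂) r) s) p) u := by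
            refine spl_congr fun p s _ => ?_
            rw [spl_comm]
      _ = spl (fun p₁ t => spl (fun p₂ s => spl (fun q r => spl (fun r₁ r₂ =>
            B (p₁ ++ p₂) q * G p₁ (p₂ ++ alt q :: r₁) r₂) r) s) t) u :=
            spl_spl (fun p₁ p₂ s => spl (fun q r => spl (fun r₁ r₂ =>
              B (p₁ ++ p₂) q * G p₁ (p₂ ++ alt q :: r₁) r₂) r) s) u
      _ = spl (fun p₁ t => spl (fun p₂ s => spl (fun m r₂ => spl (fun q r₁ =>
            B (p₁ ++ p₂) q * G p₁ (p₂ ++ alt q :: r₁) r₂) m) s) t) u := by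
            refine spl_congr fun p₁ t _ => spl_congr fun p₂ s _ => ?_
            exact (spl_spl (fun q r₁ r₂ => B (p₁ ++ p₂) q * G p₁ (p₂ ++ alt q :: r₁) r₂) s).symm
      _ = spl (fun p₁ t => spl (fun m r₂ => spl (fun p₂ m' => spl (fun q r₁ =>
            B (p₁ ++ p₂) q * G p₁ (p₂ ++ alt q :: r₁) r₂) m') m) t) u := by
            refine spl_congr fun p₁ t _ => ?_
            exact (spl_spl (fun p₂ m' r₂ => spl (fun q r₁ =>
              B (p₁ ++ p₂) q * G p₁ (p₂ ++ alt q :: r₁) r₂) m') t).symm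
      _ = _ := by
            refine spl_congr fun p₁ t _ => spl_congr fun m r₂ _ => ?_
            have hcj : cj p₁.length (ins b c m) = spl (fun p₂ m' => spl (fun q r₁ =>
                cj p₁.length (if Odd q.length then cj p₂.length (b q) * c (p₂ ++ alt q :: r₁)
                  else 0)) m') m := by
              simp only [ins, spl_cj]
            have hterm : ∀ p₂ m' q r₁ : List (V d), p₂ ++ m' = m → q ++ r₁ = m' →
                B (p₁ ++ p₂) q * G p₁ (p₂ ++ alt q :: r₁) r₂ =
                if Odd m.length then cj p₁.length (if Odd q.length then
                  cj p₂.length (b q) * c (p₂ ++ alt q :: r₁) else 0) *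
                  f (p₁ ++ alt m :: r₂) else 0 := by
              intro p₂ m' q r₁ h1 h2
              by_cases hq : Odd q.length
              · have hodd : Odd (p₂ ++ alt q :: r₁).length ↔ Odd m.length := by
                  rw [← h1, ← h2]
                  obtain ⟨k, hk⟩ := hq
                  simp only [List.length_append, List.length_cons, hk, Nat.odd_iff]
                  omega
                have halt : alt (p₂ ++ alt q :: r₁) = alt m := by
                  rw [alt_contract _ _ _ hq, h2, h1]
                simp only [B, G, hq, if_true, hodd, halt, List.length_append (as := p₁), cj_mul, cj_cj]
                split_ifs <;> ring
              · simp [B, hq, cj_apply_zero]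
            by_cases hm : Odd m.length
            · simp only [hm, if_true] at hterm ⊢
              rw [hcj, mul_comm, ← spl_mul_left]
              refine spl_congr fun p₂ m' h1 => ?_
              rw [← spl_mul_left]
              refine spl_congr fun q r₁ h2 => ?_
              rw [hterm p₂ m' q r₁ h1 h2, mul_comm]
            · simp only [hm, if_false] at hterm ⊢
              rw [← spl_zero m]
              refine spl_congr fun p₂ m' h1 => ?_
              rw [← spl_zero m']
              exact spl_congr fun q r₁ h2 => hterm p₂ m' q r₁ h1 h2

lemma ins_br (b c f : Wd d) (u : List (V d)) :
    ins b (ins c f) u - ins c (ins b f) u = ins (br b c) f u := by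
  have h : br b c = fun q => ins b c q + ((-1 : ℝ) : ℂ) * ins c b q := by
    funext q; simp [br]; ring
  rw [h, ins_add_left, ins_smul_left, ins_ins, ins_ins]
  push_cast
  ring

lemma br_jacobi (x y z : Wd d) (u : List (V d)) :
    br x (br y z) u = br (br x y) z u + br y (br x z) u := by
  have e : ∀ a b c : Wd d, ins a (br b c) u = ins a (ins b c) u - ins a (ins c b) u := by
    intro a b c
    have h : br b c = fun q => ins b c q + ((-1 : ℝ) : ℂ) * ins c b q := by
      funext q; simp [br]; ring
    rw [h, ins_add_right, ins_smul_right]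
    push_cast
    ring
  have h1 := ins_br x y z u
  have h2 := ins_br x z y u
  have h3 := ins_br y z x u
  have h5 : br x (br y z) u = ins x (br y z) u - ins (br y z) x u := rfl
  have h6 : br (br x y) z u = ins (br x y) z u - ins z (br x y) u := rfl
  have h7 : br y (br x z) u = ins y (br x z) u - ins (br x z) y u := rfl
  rw [h5, h6, h7, e, e, e, ← h1, ← h2, ← h3]
  ring

/-- The degree `ℓ` of a word of length `2ℓ + 1`. -/
def wdeg (u : List (V d)) : ℕ := (u.length - 1) / 2

lemma ins_wdeg (c f : Wd d) {u : List (V d)} (hu : Odd u.length) :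
    ((wdeg u : ℝ) : ℂ) * ins c f u =
      ins (fun q => ((wdeg q : ℝ) : ℂ) * c q) f u +
        ins c (fun q => ((wdeg q : ℝ) : ℂ) * f q) u := by
  simp only [ins, ← spl_mul_left, ← spl_add]
  refine spl_congr fun p s hps => ?_
  refine spl_congr fun q r hqr => ?_
  split_ifs with hq
  · have : (wdeg u : ℝ) = wdeg q + wdeg (p ++ alt q :: r) := by
      have hl : u.length = p.length + (q.length + r.length) := by
        rw [← hps, ← hqr]; simp
      obtain ⟨k, hk⟩ := hq
      obtain ⟨m, hm⟩ := hu
      rw [← Nat.cast_add]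
      congr 1
      simp only [wdeg, List.length_append, List.length_cons]
      omega
    rw [this, cj_ofReal_mul]
    push_cast
    ring
  · simp

lemma br_wdeg (c f : Wd d) {u : List (V d)} (hu : Odd u.length) :
    ((wdeg u : ℝ) : ℂ) * br c f u =
      br (fun q => ((wdeg q : ℝ) : ℂ) * c q) f u +
        br c (fun q => ((wdeg q : ℝ) : ℂ) * f q) u := by
  simp only [br, mul_sub, ins_wdeg _ _ hu]
  ring

end Words

section QuarticWord

variable {d : ℕ}

/-- The coefficients of the vector field of `h P`. -/
def pw (h : ℝ) : Wd d := fun u => if u.length = 3 then -(2 * Complex.I * h) else 0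

/-- The coefficients of the linear vector field with frequencies `lam`. -/
def aw (lam : V d → ℝ) : Wd d
  | [x] => -(Complex.I * lam x)
  | _ => 0

/-- Contraction of the three letters at positions `j, j + 1, j + 2`. -/
def trip (j : ℕ) (u : List (V d)) : List (V d) :=
  u.take j ++ alt ((u.drop j).take 3) :: (u.drop j).drop 3

/-- The contribution to the bracket with `h P` of a triple of letters inside a word. -/
def trTerm (h : ℝ) (j : ℕ) (b : Wd d) : Wd d := fun u =>
  cj j (-(2 * Complex.I * h)) * b (trip j u)

/-- The contribution to the bracket with `h P` of a triple of letters that contains the closing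
letter. -/
def clTerm (h : ℝ) (i : ℕ) (b : Wd d) : Wd d := fun u =>
  2 * Complex.I * h * cj i (b ((u.drop i).take (u.length - 2)))

lemma ins_pw (h : ℝ) (b : Wd d) (u : List (V d)) :
    ins (pw h) b u = ∑ j ∈ Finset.range (u.length - 2), trTerm h j b u := by
  have h3 : Odd 3 := by decide
  have key : ∀ p s : List (V d), spl (fun q r =>
      if Odd q.length then cj p.length (pw h q) * b (p ++ alt q :: r) else 0) s =
      if 3 ≤ s.length then cj p.length (-(2 * Complex.I * h)) *
        b (p ++ alt (s.take 3) :: s.drop 3) else 0 := by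
    intro p s
    rw [spl_eq_of_length (k := 3)]
    · by_cases hs : 3 ≤ s.length
      · have hl : (s.take 3).length = 3 := by simp [hs]
        simp [hs, pw, h3]
      · simp [hs]
    · intro q r _ hq
      simp [pw, hq, cj_apply_zero]
  rw [ins, spl_eq_sum]
  simp only [key]
  symm
  refine Finset.sum_subset_zero_on_sdiff (fun j hj => ?_) (fun j hj => ?_) (fun j hj => ?_)
  · simp only [Finset.mem_range] at hj ⊢; omega
  · simp only [Finset.mem_sdiff, Finset.mem_range] at hj
    rw [if_neg]
    rw [List.length_drop]; omega
  · simp only [Finset.mem_range] at hj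
    rw [if_pos (by rw [List.length_drop]; omega), List.length_take, min_eq_left (by omega)]
    rfl

lemma ins_pw_right (h : ℝ) (b : Wd d) {u : List (V d)} (hu : Odd u.length) (h3 : 3 ≤ u.length) :
    ins b (pw h) u = -∑ i ∈ Finset.range 3, clTerm h i b u := by
  have hodd : Odd (u.length - 2) := by
    obtain ⟨k, hk⟩ := hu; exact ⟨k - 1, by omega⟩
  have key : ∀ p s : List (V d), p ++ s = u → spl (fun q r =>
      if Odd q.length then cj p.length (b q) * pw h (p ++ alt q :: r) else 0) s =
      if p.length ≤ 2 then -(2 * Complex.I * h * cj p.length (b (s.take (u.length - 2))))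
        else 0 := by
    intro p s hps
    have hl : u.length = p.length + s.length := by rw [← hps]; simp
    rw [spl_eq_of_length (k := u.length - 2)]
    · by_cases hs : p.length ≤ 2
      · have hl2 : (s.take (u.length - 2)).length = u.length - 2 := by
          rw [List.length_take]; omega
        have hl3 : (p ++ alt (s.take (u.length - 2)) :: s.drop (u.length - 2)).length = 3 := by
          simp only [List.length_append, List.length_cons, List.length_drop]; omega
        rw [if_pos (by omega), if_pos (by rw [hl2]; exact hodd), if_pos hs, pw, if_pos hl3]
        ring
      · rw [if_neg (by omega), if_neg hs]
    · intro q r hqr hq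
      have hl3 : (p ++ alt q :: r).length ≠ 3 := by
        have : s.length = q.length + r.length := by rw [← hqr]; simp
        simp only [List.length_append, List.length_cons]; omega
      simp only [pw, if_neg hl3, mul_zero, ite_self]
  rw [ins, spl_congr (G := fun p s => if p.length ≤ 2 then
    -(2 * Complex.I * h * cj p.length (b (s.take (u.length - 2)))) else 0) key, spl_eq_sum,
    ← Finset.sum_neg_distrib]
  symm
  refine Finset.sum_subset_zero_on_sdiff (fun j hj => ?_) (fun j hj => ?_) (fun j hj => ?_)
  · simp only [Finset.mem_range] at hj ⊢; omega
  · simp only [Finset.mem_sdiff, Finset.mem_range] at hj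
    rw [if_neg]
    rw [List.length_take]; omega
  · simp only [Finset.mem_range] at hj
    rw [List.length_take, min_eq_left (by omega), if_pos (by omega)]
    rfl

lemma br_pw (h : ℝ) (b : Wd d) {u : List (V d)} (hu : Odd u.length) (h3 : 3 ≤ u.length) :
    br (pw h) b u = ∑ j ∈ Finset.range (u.length - 2), trTerm h j b u +
      ∑ i ∈ Finset.range 3, clTerm h i b u := by
  rw [br, ins_pw, ins_pw_right h b hu h3, sub_neg_eq_add]

lemma br_pw_of_length_one (h : ℝ) (b : Wd d) {u : List (V d)} (h1 : u.length = 1) :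
    br (pw h) b u = 0 := by
  have e : ins b (pw h) u = 0 := by
    rw [← spl_zero u]
    refine spl_congr fun p s hps => ?_
    rw [← spl_zero s]
    refine spl_congr fun q r hqr => ?_
    split_ifs with hq
    · have hl : u.length = p.length + (q.length + r.length) := by rw [← hps, ← hqr]; simp
      have hl3 : (p ++ alt q :: r).length ≠ 3 := by
        simp only [List.length_append, List.length_cons]; omega
      rw [pw, if_neg hl3, mul_zero]
    · rw [spl_zero]
  rw [br, ins_pw, e, h1]
  simp

lemma norm_br_pw_le {h : ℝ} (hh : 0 ≤ h) {b : Wd d} {u : List (V d)} (hu : Odd u.length) {C : ℝ}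
    (hb : ∀ q : List (V d), q.length + 2 = u.length → ‖b q‖ ≤ C) (hC : 0 ≤ C) :
    ‖br (pw h) b u‖ ≤ (u.length + 1) * (2 * h * C) := by
  have hn : ‖(2 * Complex.I * h : ℂ)‖ = 2 * h := by simp [abs_of_nonneg hh]
  by_cases h3 : 3 ≤ u.length
  · rw [br_pw h b hu h3]
    have b1 : ‖∑ j ∈ Finset.range (u.length - 2), trTerm h j b u‖ ≤
        (u.length - 2 : ℕ) * (2 * h * C) := by
      refine (norm_sum_le_of_le (n := fun _ => 2 * h * C) _ fun j hj => ?_).trans (by simp)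
      simp only [Finset.mem_range] at hj
      rw [trTerm, norm_mul, norm_cj, norm_neg, hn]
      gcongr
      refine hb _ ?_
      simp only [trip, List.length_append, List.length_cons, List.length_take, List.length_drop]
      omega
    have b2 : ‖∑ i ∈ Finset.range 3, clTerm h i b u‖ ≤ 3 * (2 * h * C) := by
      refine (norm_sum_le_of_le (n := fun _ => 2 * h * C) _ fun j hj => ?_).trans (by simp)
      simp only [Finset.mem_range] at hj
      rw [clTerm, norm_mul, norm_cj, hn]
      gcongr
      refine hb _ ?_
      rw [List.length_take, List.length_drop]
      omega
    refine (norm_add_le_of_le b1 b2).trans (le_of_eq ?_)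
    rw [Nat.cast_sub (by omega)]
    push_cast
    ring
  · have h1 : u.length = 1 := by obtain ⟨k, hk⟩ := hu; omega
    rw [br_pw_of_length_one h b h1, norm_zero]
    positivity

/-- The alternating sum of the frequencies of a word. -/
def altFreq (lam : V d → ℝ) : List (V d) → ℝ
  | [] => 0
  | x :: t => lam x - altFreq lam t

/-- The frequency of a word, its closing letter included. -/
def wFreq (lam : V d → ℝ) (u : List (V d)) : ℝ := altFreq lam u - lam (alt u)

lemma spl_aw (lam : V d → ℝ) (k : ℕ) (f : Wd d) (u : List (V d)) :
    spl (fun p s => spl (fun q r =>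
      if Odd q.length then cj (k + p.length) (aw lam q) * f (p ++ alt q :: r) else 0) s) u =
      cj k (-Complex.I) * altFreq lam u * f u := by
  induction u generalizing k f with
  | nil => simp [spl, altFreq]
  | cons x t ih =>
    have h1 : spl (fun q r => if Odd q.length then cj (k + ([] : List (V d)).length) (aw lam q) *
        f ([] ++ alt q :: r) else 0) (x :: t) = cj k (-Complex.I) * lam x * f (x :: t) := by
      rw [spl_eq_of_length (k := 1)]
      · have : -(Complex.I * (lam x : ℂ)) = lam x * -Complex.I := by ring
        have h0 : cj k (-(Complex.I * (lam x : ℂ))) = cj k (-Complex.I) * lam x := by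
          rw [this, cj_ofReal_mul, mul_comm]
        simp [aw, alt, h0]
      · intro q r _ hq
        have : aw lam q = 0 := by
          match q, hq with
          | [], _ => rfl
          | _ :: _ :: _, _ => rfl
        simp [this, cj_apply_zero]
    have h2 := ih (k + 1) (fun v => f (x :: v))
    rw [spl, h1, altFreq]
    have h3 : spl (fun p s => spl (fun q r => if Odd q.length then
        cj (k + (x :: p).length) (aw lam q) * f (x :: p ++ alt q :: r) else 0) s) t =
        cj (k + 1) (-Complex.I) * altFreq lam t * f (x :: t) := by
      rw [← h2]
      refine spl_congr fun p s _ => spl_congr fun q r _ => ?_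
      rw [List.length_cons, show k + (p.length + 1) = k + 1 + p.length by ring, List.cons_append]
    rw [h3]
    have h4 : cj (k + 1) (-Complex.I) = -cj k (-Complex.I) := by
      rw [cj_succ]; by_cases hk : Even k <;> simp [cj, hk]
    rw [h4]
    push_cast
    ring

lemma br_aw (lam : V d → ℝ) (b : Wd d) {u : List (V d)} (hu : Odd u.length) :
    br (aw lam) b u = -(Complex.I * wFreq lam u) * b u := by
  have h1 : ins (aw lam) b u = -Complex.I * altFreq lam u * b u := by
    have := spl_aw lam 0 b u
    simp only [zero_add, cj_zero] at this
    exact this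
  have h2 : ins b (aw lam) u = b u * -(Complex.I * lam (alt u)) := by
    have haw : ∀ l : List (V d), l.length ≠ 1 → aw lam l = 0 := by
      intro l hl
      match l, hl with
      | [], _ => rfl
      | _ :: _ :: _, _ => rfl
    rw [ins, spl_eq_of_length (k := 0)]
    · rw [if_pos (Nat.zero_le _), spl_eq_of_length (k := u.length)]
      · simp [hu, aw]
      · intro q r hqr hq
        have : (u.take 0 ++ alt q :: r).length ≠ 1 := by
          have : q.length + r.length = u.length := by
            have := congrArg List.length hqr; simpa using this
          simp; rintro rfl; simp at this; omega
        rw [haw _ this]; simp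
    · intro p s _ hp
      rw [← spl_zero s]
      refine spl_congr fun q r _ => ?_
      have : (p ++ alt q :: r).length ≠ 1 := by
        simp only [List.length_append, List.length_cons]; omega
      rw [haw _ this]; simp [spl_zero]
  rw [br, h1, h2, wFreq]
  push_cast
  ring

end QuarticWord

section Rotation

variable {d : ℕ}

/-- Rotation of the letters of a word, closing letter included. -/
def rot (f : Wd d) : Wd d := fun u => -(starRingEnd ℂ) (f (alt u :: u.dropLast))

/-- Hamiltonian vector fields: the coefficients are invariant under rotation. -/
def Cyc (f : Wd d) : Prop := ∀ u : List (V d), Odd u.length → rot f u = f u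

lemma alt_rot {u : List (V d)} (hu : Odd u.length) {l : List (V d)} {x : V d} (h : u = l ++ [x]) :
    alt (alt u :: u.dropLast) = x := by
  subst h
  have hl : Even l.length := by
    rw [List.length_append, List.length_singleton] at hu
    by_contra hne
    exact (Nat.not_even_iff_odd.2 hu) (Nat.even_add_one.2 hne)
  rw [List.dropLast_concat, alt, alt_append, if_pos hl]
  simp [alt]

lemma alt_trip {j : ℕ} {u : List (V d)} (hj : j + 3 ≤ u.length) : alt (trip j u) = alt u := by
  rw [trip, alt_contract, List.take_append_drop, List.take_append_drop]
  rw [List.length_take, List.length_drop, min_eq_left (by omega)]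
  decide

lemma trip_append_singleton {j : ℕ} {l : List (V d)} (x : V d) (hj : j + 3 ≤ l.length) :
    trip j (l ++ [x]) = trip j l ++ [x] := by
  simp only [trip]
  rw [List.take_append_of_le_length (by omega), List.drop_append_of_le_length (by omega),
    List.take_append_of_le_length (by rw [List.length_drop]; omega),
    List.drop_append_of_le_length (by rw [List.length_drop]; omega)]
  simp

lemma length_trip {j : ℕ} {u : List (V d)} (hj : j + 3 ≤ u.length) :
    (trip j u).length + 2 = u.length := by
  simp only [trip, List.length_append, List.length_cons, List.length_take, List.length_drop]
  omega

lemma conj_two_I_mul (h : ℝ) :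
    (starRingEnd ℂ) (2 * Complex.I * h) = -(2 * Complex.I * h) := by
  rw [map_mul, map_mul, Complex.conj_I, Complex.conj_ofReal, Complex.conj_ofNat]
  ring

lemma odd_sub_two {n m : ℕ} (hn : Odd n) (h : m + 2 = n) : Odd m := by
  obtain ⟨k, hk⟩ := hn; exact ⟨k - 1, by omega⟩

lemma exists_concat {u : List (V d)} (hu : Odd u.length) : ∃ l x, u = l ++ [x] := by
  have : u ≠ [] := by rintro rfl; simp at hu
  exact ⟨u.dropLast, u.getLast this, (List.dropLast_append_getLast this).symm⟩

lemma rot_trTerm_succ {h : ℝ} {b : Wd d} (hb : Cyc b) {u : List (V d)} (hu : Odd u.length) {j : ℕ}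
    (hj : j + 3 < u.length) : rot (trTerm h (j + 1) b) u = trTerm h j b u := by
  obtain ⟨l, x, rfl⟩ := exists_concat hu
  have hjl : j + 3 ≤ l.length := by simp at hj; omega
  have h1 := hb (trip j (l ++ [x])) (odd_sub_two hu (length_trip (by omega)))
  rw [rot, alt_trip (by omega), trip_append_singleton x hjl, List.dropLast_concat] at h1
  have h2 : trip (j + 1) (alt (l ++ [x]) :: l) = alt (l ++ [x]) :: trip j l := by
    simp [trip]
  rw [rot, trTerm, trTerm, List.dropLast_concat, h2, trip_append_singleton x hjl, ← h1, map_mul,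
    cj_succ, Complex.conj_conj]
  ring

lemma rot_trTerm_zero {h : ℝ} {b : Wd d} (hb : Cyc b) {u : List (V d)} (hu : Odd u.length)
    (h3 : 3 ≤ u.length) : rot (trTerm h 0 b) u = clTerm h 2 b u := by
  match u, h3 with
  | x :: y :: z :: t, _ =>
    have ht : Odd (z :: t).length := odd_sub_two hu (by simp)
    have h1 := hb _ ht
    have h2 : trip 0 (alt (x :: y :: z :: t) :: x :: y :: (z :: t).dropLast) =
        alt (z :: t) :: (z :: t).dropLast := by
      simp [trip, alt]
    have h4 : ((x :: y :: z :: t).drop 2).take ((x :: y :: z :: t).length - 2) = z :: t := by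
      simp
    rw [rot] at h1
    rw [rot, trTerm, clTerm, h4, ← h1]
    rw [show (x :: y :: z :: t).dropLast = x :: y :: (z :: t).dropLast from rfl, h2]
    simp only [cj_zero, map_neg, map_mul _ (-(2 * Complex.I * (h : ℂ))), conj_two_I_mul]
    rw [show cj 2 (-(starRingEnd ℂ) (b (alt (z :: t) :: (z :: t).dropLast))) =
      (-(starRingEnd ℂ) (b (alt (z :: t) :: (z :: t).dropLast))) from by simp [cj]]
    ring

lemma rot_clTerm_two {h : ℝ} {b : Wd d} {u : List (V d)}
    (h3 : 3 ≤ u.length) : rot (clTerm h 2 b) u = clTerm h 1 b u := by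
  match u, h3 with
  | x :: y :: z :: t, _ =>
    have e1 : (((alt (x :: y :: z :: t) :: (x :: y :: z :: t).dropLast).drop 2).take
        ((alt (x :: y :: z :: t) :: (x :: y :: z :: t).dropLast).length - 2)) =
        (y :: z :: t).dropLast := by
      simp
    have e2 : ((x :: y :: z :: t).drop 1).take ((x :: y :: z :: t).length - 2) =
        (y :: z :: t).dropLast := by
      rw [List.dropLast_eq_take]; simp
    rw [rot, clTerm, clTerm, e1, e2, map_mul, conj_two_I_mul]
    simp [cj]

lemma rot_clTerm_one {h : ℝ} {b : Wd d} {u : List (V d)}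
    (h3 : 3 ≤ u.length) : rot (clTerm h 1 b) u = clTerm h 0 b u := by
  have e1 : ((alt u :: u.dropLast).drop 1).take ((alt u :: u.dropLast).length - 2) =
      (u.drop 0).take (u.length - 2) := by
    simp only [List.drop_succ_cons, List.drop_zero, List.length_cons, List.length_dropLast]
    rw [List.dropLast_eq_take, List.take_take]
    congr 1
    omega
  rw [rot, clTerm, clTerm, e1, map_mul, conj_two_I_mul]
  simp [cj]

lemma rot_clTerm_zero {h : ℝ} {b : Wd d} (hb : Cyc b) {u : List (V d)} (hu : Odd u.length)
    (h3 : 3 ≤ u.length) : rot (clTerm h 0 b) u = trTerm h (u.length - 3) b u := by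
  have hev : Even (u.length - 3) := by
    obtain ⟨k, hk⟩ := hu; exact ⟨k - 1, by omega⟩
  have h1 := hb (trip (u.length - 3) u) (odd_sub_two hu (length_trip (by omega)))
  rw [rot, alt_trip (by omega)] at h1
  have e1 : (trip (u.length - 3) u).dropLast = u.take (u.length - 3) := by
    have : (u.drop (u.length - 3)).drop 3 = [] := by
      rw [List.drop_drop, List.drop_eq_nil_iff]; omega
    rw [trip, this, List.dropLast_concat]
  have e2 : ((alt u :: u.dropLast).drop 0).take ((alt u :: u.dropLast).length - 2) =
      alt u :: u.take (u.length - 3) := by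
    have e3 : (alt u :: u.dropLast).length - 2 = (u.length - 3) + 1 := by
      simp only [List.length_cons, List.length_dropLast]; omega
    rw [e3, List.drop_zero, List.take_succ_cons, List.dropLast_eq_take, List.take_take]
    congr 2
    omega
  rw [e1] at h1
  rw [rot, clTerm, trTerm, e2, ← h1, map_mul, conj_two_I_mul]
  simp [cj, hev]

lemma rot_add (f g : Wd d) (u : List (V d)) : rot (fun v => f v + g v) u = rot f u + rot g u := by
  simp [rot]; ring

lemma rot_sum {ι : Type*} (s : Finset ι) (f : ι → Wd d) (u : List (V d)) :
    rot (fun v => ∑ i ∈ s, f i v) u = ∑ i ∈ s, rot (f i) u := by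
  simp [rot]

lemma length_rot {u : List (V d)} (hu : Odd u.length) :
    (alt u :: u.dropLast).length = u.length := by
  have : 0 < u.length := hu.pos
  simp only [List.length_cons, List.length_dropLast]; omega

lemma Cyc.br_pw {h : ℝ} {b : Wd d} (hb : Cyc b) : Cyc (br (pw h) b) := by
  intro u hu
  by_cases h3 : 3 ≤ u.length
  · have hl := length_rot hu
    have e1 : rot (br (pw h) b) u = rot (fun v => ∑ j ∈ Finset.range (u.length - 2),
        trTerm h j b v + ∑ i ∈ Finset.range 3, clTerm h i b v) u := by
      rw [rot, rot, NLSSplitting.br_pw h b (by rwa [hl]) (by rwa [hl]), hl]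
    obtain ⟨k, hk⟩ : ∃ k, u.length = k + 3 := ⟨u.length - 3, by omega⟩
    rw [e1, NLSSplitting.br_pw h b hu h3, rot_add, rot_sum, rot_sum,
      show u.length - 2 = k + 1 by omega, Finset.sum_range_succ', rot_trTerm_zero hb hu h3,
      Finset.sum_congr rfl (fun j hj => rot_trTerm_succ (h := h) hb hu (by
        simp only [Finset.mem_range] at hj; omega)), Finset.sum_range_succ (n := k)]
    simp only [Finset.sum_range_succ, Finset.sum_range_zero, zero_add, rot_clTerm_two h3,
      rot_clTerm_one h3, rot_clTerm_zero hb hu h3, show u.length - 3 = k by omega]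
    ring
  · have h1 : u.length = 1 := by obtain ⟨k, hk⟩ := hu; omega
    rw [rot, br_pw_of_length_one h b h1, br_pw_of_length_one h b (by rw [length_rot hu, h1])]
    simp

lemma altFreq_append (lam : V d → ℝ) (p q : List (V d)) : altFreq lam (p ++ q) =
    if Even p.length then altFreq lam p + altFreq lam q else altFreq lam p - altFreq lam q := by
  induction p with
  | nil => simp [altFreq]
  | cons x t ih =>
    simp only [List.cons_append, altFreq, ih, List.length_cons, Nat.even_add_one]
    by_cases h : Even t.length <;> simp [h] <;> ring

lemma wFreq_rot (lam : V d → ℝ) {u : List (V d)} (hu : Odd u.length) :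
    wFreq lam (alt u :: u.dropLast) = -wFreq lam u := by
  obtain ⟨l, x, rfl⟩ := exists_concat hu
  have hl : Even l.length := by
    rw [List.length_append, List.length_singleton] at hu
    by_contra hne
    exact (Nat.not_even_iff_odd.2 hu) (Nat.even_add_one.2 hne)
  rw [wFreq, alt_rot hu rfl, wFreq, List.dropLast_concat, altFreq, altFreq_append, if_pos hl]
  simp [altFreq]
  ring

lemma Cyc.br_aw {lam : V d → ℝ} {b : Wd d} (hb : Cyc b) : Cyc (br (aw lam) b) := by
  intro u hu
  have h1 := hb u hu
  rw [rot] at h1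
  rw [rot, NLSSplitting.br_aw lam b (by rwa [length_rot hu]), NLSSplitting.br_aw lam b hu,
    wFreq_rot lam hu, ← h1]
  simp

lemma cyc_pw (h : ℝ) : Cyc (pw h : Wd d) := by
  intro u hu
  rw [rot, pw, pw, length_rot hu]
  split_ifs
  · rw [map_neg, conj_two_I_mul, neg_neg]
  · simp

lemma cyc_aw (lam : V d → ℝ) : Cyc (aw lam) := by
  intro u hu
  match u, hu with
  | [x], _ => simp [rot, aw, alt]
  | x :: y :: t, _ => simp [rot, aw]

end Rotation

section WordMeasurability

variable {d : ℕ}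

/-- Measurability of a function on words, on each set of words of fixed length. -/
def MeasW {E : Type*} [MeasurableSpace E] (f : List (V d) → E) : Prop :=
  ∀ n, Measurable fun ξ : Fin n → V d => f (List.ofFn ξ)

/-- A word of constant length that depends measurably on a parameter. -/
def MList {Ω : Type*} [MeasurableSpace Ω] (n : ℕ) (L : Ω → List (V d)) : Prop :=
  (∀ ω, (L ω).length = n) ∧ ∀ i, Measurable fun ω => (L ω).getD i 0

variable {Ω : Type*} [MeasurableSpace Ω]

lemma MeasW.comp {E : Type*} [MeasurableSpace E] {f : List (V d) → E} (hf : MeasW f) {n : ℕ}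
    {L : Ω → List (V d)} (hL : MList n L) : Measurable fun ω => f (L ω) := by
  have h1 : ∀ ω, L ω = List.ofFn (fun i : Fin n => (L ω).getD i 0) := by
    intro ω
    refine List.ext_getElem (by rw [hL.1 ω, List.length_ofFn]) fun i h1 h2 => ?_
    rw [List.getElem_ofFn]
    simp [h1]
  have h2 : (fun ω => f (L ω)) = (fun ξ : Fin n → V d => f (List.ofFn ξ)) ∘
      fun ω => fun i : Fin n => (L ω).getD i 0 := by
    funext ω
    rw [Function.comp_apply, ← h1 ω]
  rw [h2]
  exact (hf n).comp (measurable_pi_lambda _ fun i => hL.2 i)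

lemma mList_ofFn (n : ℕ) : MList n fun ξ : Fin n → V d => List.ofFn ξ := by
  refine ⟨fun ξ => List.length_ofFn, fun i => ?_⟩
  by_cases hi : i < n
  · have : (fun ξ : Fin n → V d => (List.ofFn ξ).getD i 0) = fun ξ => ξ ⟨i, hi⟩ := by
      funext ξ
      rw [List.getD_eq_getElem _ _ (by simpa using hi), List.getElem_ofFn]
    rw [this]
    exact measurable_pi_apply _
  · have : (fun ξ : Fin n → V d => (List.ofFn ξ).getD i 0) = fun ξ => 0 := by
      funext ξ
      rw [List.getD_eq_default _ _ (by simpa using hi)]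
    rw [this]
    exact measurable_const

lemma MList.take {n : ℕ} {L : Ω → List (V d)} (hL : MList n L) (k : ℕ) :
    MList (min k n) fun ω => (L ω).take k := by
  refine ⟨fun ω => by rw [List.length_take, hL.1 ω], fun i => ?_⟩
  by_cases hi : i < k
  · have := hL.2 i
    simpa [List.getD_eq_getElem?_getD, List.getElem?_take, hi] using this
  · simp [List.getD_eq_getElem?_getD, hi]

lemma MList.drop {n : ℕ} {L : Ω → List (V d)} (hL : MList n L) (k : ℕ) :
    MList (n - k) fun ω => (L ω).drop k := by
  refine ⟨fun ω => by rw [List.length_drop, hL.1 ω], fun i => ?_⟩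
  have := hL.2 (k + i)
  simpa [List.getD_eq_getElem?_getD, List.getElem?_drop] using this

lemma MList.append {n m : ℕ} {L L' : Ω → List (V d)} (hL : MList n L) (hL' : MList m L') :
    MList (n + m) fun ω => L ω ++ L' ω := by
  refine ⟨fun ω => by rw [List.length_append, hL.1 ω, hL'.1 ω], fun i => ?_⟩
  by_cases hi : i < n
  · have := hL.2 i
    simpa [List.getD_eq_getElem?_getD, List.getElem?_append, hi, hL.1] using this
  · have := hL'.2 (i - n)
    simpa [List.getD_eq_getElem?_getD, List.getElem?_append, hi, hL.1] using this

lemma MList.cons {m : ℕ} {x : Ω → V d} {L : Ω → List (V d)} (hx : Measurable x)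
    (hL : MList m L) : MList (m + 1) fun ω => x ω :: L ω := by
  refine ⟨fun ω => by rw [List.length_cons, hL.1 ω], fun i => ?_⟩
  cases i with
  | zero => simpa using hx
  | succ i => simpa using hL.2 i

lemma measW_alt : MeasW (alt : List (V d) → V d) := by
  intro n
  induction n with
  | zero => simp [List.ofFn_zero, alt]
  | succ n ih =>
    simp only [List.ofFn_succ, alt]
    refine (measurable_pi_apply 0).sub ?_
    exact ih.comp (measurable_pi_lambda _ fun i => measurable_pi_apply i.succ)

lemma measW_altFreq {lam : V d → ℝ} (hlam : Measurable lam) : MeasW (altFreq lam) := by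
  intro n
  induction n with
  | zero => simp [List.ofFn_zero, altFreq]
  | succ n ih =>
    simp only [List.ofFn_succ, altFreq]
    refine (hlam.comp (measurable_pi_apply 0)).sub ?_
    exact ih.comp (measurable_pi_lambda _ fun i => measurable_pi_apply i.succ)

lemma measurable_cj (k : ℕ) : Measurable (cj k) := by
  by_cases hk : Even k
  · have : cj k = id := by funext z; simp [cj, hk]
    rw [this]; exact measurable_id
  · have : cj k = starRingEnd ℂ := by funext z; simp [cj, hk]
    rw [this]; exact Complex.continuous_conj.measurable

lemma MeasW.ins {c f : Wd d} (hc : MeasW c) (hf : MeasW f) : MeasW (ins c f) := by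
  intro n
  simp only [NLSSplitting.ins, spl_eq_sum, List.length_drop, List.length_ofFn, List.length_take]
  refine Finset.measurable_sum _ fun i _ => Finset.measurable_sum _ fun k _ => ?_
  split_ifs
  · have h1 := ((mList_ofFn (d := d) n).drop i).take k
    refine ((measurable_cj _).comp (hc.comp h1)).mul (hf.comp (n := min i n + (n - i - k + 1)) ?_)
    exact ((mList_ofFn n).take i).append
      (MList.cons (measW_alt.comp h1) (((mList_ofFn n).drop i).drop k))
  · exact measurable_const

lemma MeasW.br {c f : Wd d} (hc : MeasW c) (hf : MeasW f) : MeasW (br c f) := fun n =>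
  (hc.ins hf n).sub (hf.ins hc n)

lemma measW_of_length {E : Type*} [MeasurableSpace E] (g : ℕ → E) :
    MeasW fun u : List (V d) => g u.length := by
  intro n
  simp

lemma measW_ite {P : ℕ → Prop} [DecidablePred P] {f g : Wd d} (hf : MeasW f) (hg : MeasW g) :
    MeasW fun u => if P u.length then f u else g u := by
  intro n
  simp only [List.length_ofFn]
  split_ifs
  · exact hf n
  · exact hg n

lemma MeasW.mul {f g : Wd d} (hf : MeasW f) (hg : MeasW g) : MeasW fun u => f u * g u :=
  fun n => (hf n).mul (hg n)

lemma measW_const (z : ℂ) : MeasW fun _ : List (V d) => z := fun _ => measurable_const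

lemma measW_pw (h : ℝ) : MeasW (pw h : Wd d) :=
  measW_of_length fun n => if n = 3 then -(2 * Complex.I * h) else 0

lemma measW_aw {lam : V d → ℝ} (hlam : Measurable lam) : MeasW (aw lam) := by
  intro n
  match n with
  | 0 => simp [List.ofFn_zero, aw]
  | 1 =>
    have : (fun ξ : Fin 1 → V d => aw lam (List.ofFn ξ)) =
        fun ξ => -(Complex.I * lam (ξ 0)) := by
      funext ξ; simp [aw]
    rw [this]
    exact (measurable_const.mul
      (Complex.measurable_ofReal.comp (hlam.comp (measurable_pi_apply 0)))).neg
  | n + 2 => simp [List.ofFn_succ, aw]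

end WordMeasurability

section WordSpace

variable {d : ℕ}

/-- Bounded measurable functions on words, as a subspace of `ℓ^∞`. -/
def wordSubmodule (d : ℕ) : Submodule ℝ (lp (fun _ : List (V d) => ℂ) ∞) where
  carrier := {f | MeasW (fun u => f u)}
  add_mem' := fun hf hg n => (hf n).add (hg n)
  zero_mem' := fun _ => measurable_const
  smul_mem' := fun c _ hf n => (hf n).const_smul c

instance : CompleteSpace (wordSubmodule d) := by
  suffices h : IsClosed (wordSubmodule d : Set (lp (fun _ : List (V d) => ℂ) ∞)) from
    h.completeSpace_coe
  refine IsSeqClosed.isClosed fun F f hF hf n => ?_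
  refine measurable_of_tendsto_metrizable (fun k => hF k n) ?_
  rw [tendsto_pi_nhds]
  intro ξ
  have h1 : Filter.Tendsto (fun k => (F k : ∀ _ : List (V d), ℂ)) Filter.atTop
      (nhds (f : ∀ _ : List (V d), ℂ)) := lp.uniformContinuous_coe.continuous.continuousAt.tendsto.comp hf
  exact (tendsto_pi_nhds.1 h1) (List.ofFn ξ)

/-- The Banach space of bounded measurable functions on words. -/
def wordSpace (d : ℕ) : Type := wordSubmodule d

instance : NormedAddCommGroup (wordSpace d) := inferInstanceAs (NormedAddCommGroup (wordSubmodule d))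
instance : NormedSpace ℝ (wordSpace d) := inferInstanceAs (NormedSpace ℝ (wordSubmodule d))
instance : CompleteSpace (wordSpace d) := inferInstanceAs (CompleteSpace (wordSubmodule d))

/-- The value of an element of the word space at a word. -/
def wv (f : wordSpace d) : Wd d := fun u => f.1 u

@[simp] lemma wv_add (f g : wordSpace d) (u : List (V d)) : wv (f + g) u = wv f u + wv g u := rfl
@[simp] lemma wv_sub (f g : wordSpace d) (u : List (V d)) : wv (f - g) u = wv f u - wv g u := rfl
@[simp] lemma wv_neg (f : wordSpace d) (u : List (V d)) : wv (-f) u = -wv f u := rfl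
@[simp] lemma wv_smul (c : ℝ) (f : wordSpace d) (u : List (V d)) : wv (c • f) u = c * wv f u := by
  show c • (f.1 u) = _
  rw [Complex.real_smul]; rfl
@[simp] lemma wv_zero (u : List (V d)) : wv (0 : wordSpace d) u = 0 := rfl

lemma wv_ext {f g : wordSpace d} (h : ∀ u, wv f u = wv g u) : f = g :=
  Subtype.ext (lp.ext (funext h))

lemma measW_wv (f : wordSpace d) : MeasW (wv f) := f.2

lemma norm_wv_le (f : wordSpace d) (u : List (V d)) : ‖wv f u‖ ≤ ‖f‖ :=
  lp.norm_apply_le_norm ENNReal.top_ne_zero f.1 u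

lemma norm_le_of_wv {f : wordSpace d} {C : ℝ} (hC : 0 ≤ C) (h : ∀ u, ‖wv f u‖ ≤ C) : ‖f‖ ≤ C :=
  lp.norm_le_of_forall_le hC h

/-- The element of the word space given by a bounded measurable function. -/
def mkW (f : Wd d) (hm : MeasW f) {C : ℝ} (hC : ∀ u, ‖f u‖ ≤ C) : wordSpace d :=
  ⟨⟨f, memℓp_infty ⟨C, by rintro _ ⟨u, rfl⟩; exact hC u⟩⟩, hm⟩

@[simp] lemma wv_mkW (f : Wd d) (hm : MeasW f) {C : ℝ} (hC : ∀ u, ‖f u‖ ≤ C) (u : List (V d)) :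
    wv (mkW f hm hC) u = f u := rfl

/-- Evaluation at a word. -/
def evW (u : List (V d)) : wordSpace d →L[ℝ] ℂ :=
  LinearMap.mkContinuous
    { toFun := fun f => wv f u
      map_add' := fun f g => rfl
      map_smul' := fun c f => rfl } 1 fun f => by
        rw [one_mul]; exact norm_wv_le f u

@[simp] lemma evW_apply (u : List (V d)) (f : wordSpace d) : evW u f = wv f u := rfl

end WordSpace

section TruncatedBracket

variable {d : ℕ}

/-- Words of odd length at most `2 N + 1`. -/
def InRange (N : ℕ) (u : List (V d)) : Prop := Odd u.length ∧ u.length ≤ 2 * N + 1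

instance (N : ℕ) : DecidablePred (InRange N : List (V d) → Prop) := fun u => by
  unfold InRange; infer_instance

lemma InRange.wdeg_le {N : ℕ} {u : List (V d)} (hu : InRange N u) : wdeg u ≤ N := by
  have := hu.2; unfold wdeg; omega

lemma InRange.length_eq {N : ℕ} {u : List (V d)} (hu : InRange N u) :
    u.length = 2 * wdeg u + 1 := by
  obtain ⟨⟨k, hk⟩, -⟩ := hu; unfold wdeg; omega

/-- Truncation and multiplication by a weight that depends on the degree. -/
def tw (N : ℕ) (ρ : ℕ → ℝ) (f : Wd d) : Wd d := fun u =>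
  if InRange N u then (ρ (wdeg u) : ℂ) * f u else 0

lemma MeasW.tw {N : ℕ} {ρ : ℕ → ℝ} {f : Wd d} (hf : MeasW f) : MeasW (tw N ρ f) := by
  refine measW_ite (P := fun n => Odd n ∧ n ≤ 2 * N + 1) (MeasW.mul ?_ hf) (measW_const 0)
  exact measW_of_length fun n => ((ρ ((n - 1) / 2) : ℝ) : ℂ)

/-- A common bound for the weights. -/
def wB (N : ℕ) (ρ : ℕ → ℝ) : ℝ := ∑ l ∈ Finset.range (N + 1), |ρ l|

lemma wB_nonneg (N : ℕ) (ρ : ℕ → ℝ) : 0 ≤ wB N ρ := Finset.sum_nonneg fun _ _ => abs_nonneg _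

lemma norm_tw_le {N : ℕ} {ρ : ℕ → ℝ} {f : Wd d} {C : ℝ} (hC : 0 ≤ C)
    (hf : ∀ u, InRange N u → ‖f u‖ ≤ C) (u : List (V d)) : ‖tw N ρ f u‖ ≤ wB N ρ * C := by
  rw [tw]
  split_ifs with hu
  · rw [norm_mul, Complex.norm_real, Real.norm_eq_abs]
    refine mul_le_mul ?_ (hf u hu) (norm_nonneg _) (wB_nonneg N ρ)
    exact Finset.single_le_sum (f := fun l => |ρ l|) (fun _ _ => abs_nonneg _)
      (Finset.mem_range.2 (Nat.lt_succ_of_le hu.wdeg_le))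
  · rw [norm_zero]; exact mul_nonneg (wB_nonneg N ρ) hC

/-- The weighted truncated bracket, on functions. -/
def brT (N : ℕ) (ρ : ℕ → ℝ) (b c : Wd d) : Wd d :=
  tw N ρ (br (tw N ρ⁻¹ b) (tw N ρ⁻¹ c))

lemma norm_brT_le (N : ℕ) (ρ : ℕ → ℝ) {b c : Wd d} {B C : ℝ} (hB : 0 ≤ B) (hC : 0 ≤ C)
    (hb : ∀ u, ‖b u‖ ≤ B) (hc : ∀ u, ‖c u‖ ≤ C) (u : List (V d)) :
    ‖brT N ρ b c u‖ ≤
      (wB N ρ * (2 * ((2 * N + 2) * ((2 * N + 2) * (wB N ρ⁻¹ * wB N ρ⁻¹))))) * B * C := by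
  have h0 := wB_nonneg N ρ⁻¹
  have hb' := norm_tw_le (N := N) (ρ := ρ⁻¹) hB fun u _ => hb u
  have hc' := norm_tw_le (N := N) (ρ := ρ⁻¹) hC fun u _ => hc u
  have hlen : ∀ u : List (V d), InRange N u → (u.length : ℝ) + 1 ≤ 2 * N + 2 := by
    intro u hu
    have : u.length + 1 ≤ 2 * N + 2 := by have := hu.2; omega
    exact_mod_cast this
  have h1 : ∀ u : List (V d), InRange N u → ‖br (tw N ρ⁻¹ b) (tw N ρ⁻¹ c) u‖ ≤
      2 * ((2 * N + 2) * ((2 * N + 2) * ((wB N ρ⁻¹ * B) * (wB N ρ⁻¹ * C)))) := by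
    intro u hu
    have hl := hlen u hu
    have e1 := norm_ins_le (u := u) (mul_nonneg h0 hB) (mul_nonneg h0 hC) hb' hc'
    have e2 := norm_ins_le (u := u) (mul_nonneg h0 hC) (mul_nonneg h0 hB) hc' hb'
    have e3 : ((u.length : ℝ) + 1) * ((u.length + 1) * ((wB N ρ⁻¹ * B) * (wB N ρ⁻¹ * C))) ≤
        (2 * N + 2) * ((2 * N + 2) * ((wB N ρ⁻¹ * B) * (wB N ρ⁻¹ * C))) := by gcongr
    rw [br]
    refine (norm_sub_le _ _).trans ?_
    rw [mul_comm (wB N ρ⁻¹ * C) (wB N ρ⁻¹ * B)] at e2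
    linarith
  refine (norm_tw_le (by positivity) h1 u).trans (le_of_eq (by ring))

lemma tw_smul (N : ℕ) (ρ : ℕ → ℝ) (t : ℝ) (f : wordSpace d) :
    tw N ρ (wv (t • f)) = fun u => t * tw N ρ (wv f) u := by
  funext u
  simp only [tw, wv_smul]
  split_ifs
  · ring
  · simp

lemma tw_add (N : ℕ) (ρ : ℕ → ℝ) (f g : wordSpace d) :
    tw N ρ (wv (f + g)) = fun u => tw N ρ (wv f) u + tw N ρ (wv g) u := by
  funext u
  simp only [tw, wv_add]
  split_ifs
  · ring
  · simp

/-- The weighted truncated bracket. -/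
def bW (N : ℕ) (ρ : ℕ → ℝ) : wordSpace d →L[ℝ] wordSpace d →L[ℝ] wordSpace d :=
  LinearMap.mkContinuous₂
    (LinearMap.mk₂ ℝ
      (fun b c => mkW (brT N ρ (wv b) (wv c)) (((measW_wv b).tw.br (measW_wv c).tw).tw)
        (norm_brT_le N ρ (norm_nonneg b) (norm_nonneg c) (norm_wv_le b) (norm_wv_le c)))
      (fun b b' c => wv_ext fun u => by
        simp only [wv_mkW, wv_add, brT, tw_add]
        rw [tw, tw, tw, br_add_left]
        split_ifs
        · ring
        · simp)
      (fun t b c => wv_ext fun u => by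
        simp only [wv_mkW, wv_smul, brT, tw_smul]
        rw [tw, tw, br_smul_left]
        split_ifs
        · ring
        · simp)
      (fun b c c' => wv_ext fun u => by
        simp only [wv_mkW, wv_add, brT, tw_add]
        rw [tw, tw, tw, br_add_right]
        split_ifs
        · ring
        · simp)
      (fun t b c => wv_ext fun u => by
        simp only [wv_mkW, wv_smul, brT, tw_smul]
        rw [tw, tw, br_smul_right]
        split_ifs
        · ring
        · simp))
    (wB N ρ * (2 * ((2 * N + 2) * ((2 * N + 2) * (wB N ρ⁻¹ * wB N ρ⁻¹)))))
    (fun b c => norm_le_of_wv (by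
        have := wB_nonneg N ρ
        have := wB_nonneg N ρ⁻¹
        positivity) fun u =>
      norm_brT_le N ρ (norm_nonneg b) (norm_nonneg c) (norm_wv_le b) (norm_wv_le c) u)

lemma wv_bW (N : ℕ) (ρ : ℕ → ℝ) (b c : wordSpace d) (u : List (V d)) :
    wv (bW N ρ b c) u = tw N ρ (br (tw N ρ⁻¹ (wv b)) (tw N ρ⁻¹ (wv c))) u := rfl

lemma wv_bW_eq (N : ℕ) (ρ : ℕ → ℝ) (b c : wordSpace d) :
    wv (bW N ρ b c) = tw N ρ (br (tw N ρ⁻¹ (wv b)) (tw N ρ⁻¹ (wv c))) :=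
  funext fun u => wv_bW N ρ b c u

lemma bW_anti (N : ℕ) (ρ : ℕ → ℝ) (b c : wordSpace d) : bW N ρ b c = -bW N ρ c b := by
  have key : ∀ f g : Wd d, ∀ u, tw N ρ (br f g) u = -tw N ρ (br g f) u := by
    intro f g u
    simp only [tw]
    split_ifs
    · rw [br_anti, mul_neg]
    · rw [neg_zero]
  exact wv_ext fun u => by rw [wv_neg, wv_bW, wv_bW, key]

lemma InRange.of_le {N : ℕ} {u q : List (V d)} (hu : InRange N u) (hq : Odd q.length)
    (h : q.length ≤ u.length) : InRange N q := ⟨hq, h.trans hu.2⟩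

lemma tw_inv_tw {N : ℕ} {ρ : ℕ → ℝ} (hρ : ∀ l, ρ l ≠ 0) (f : Wd d) {q : List (V d)}
    (hq : InRange N q) : tw N ρ⁻¹ (tw N ρ f) q = f q := by
  rw [tw, if_pos hq, tw, if_pos hq, ← mul_assoc, ← Complex.ofReal_mul, Pi.inv_apply,
    inv_mul_cancel₀ (hρ _), Complex.ofReal_one, one_mul]

lemma bW_jacobi {N : ℕ} {ρ : ℕ → ℝ} (hρ : ∀ l, ρ l ≠ 0) (x y z : wordSpace d) :
    bW (d := d) N ρ x (bW (d := d) N ρ y z) =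
      bW (d := d) N ρ (bW (d := d) N ρ x y) z + bW (d := d) N ρ y (bW (d := d) N ρ x z) := by
  refine wv_ext fun u => ?_
  by_cases hu : InRange N u
  · have key : ∀ a b : wordSpace d, ∀ q : List (V d), Odd q.length → q.length ≤ u.length →
        tw N ρ⁻¹ (wv (bW N ρ a b)) q = br (tw N ρ⁻¹ (wv a)) (tw N ρ⁻¹ (wv b)) q := by
      intro a b q hq hqu
      rw [wv_bW_eq]
      exact tw_inv_tw hρ _ (hu.of_le hq hqu)
    rw [wv_add, wv_bW, wv_bW, wv_bW, tw, tw, tw, if_pos hu, if_pos hu, if_pos hu,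
      br_congr hu.1 (fun _ _ _ => rfl) (key y z), br_congr hu.1 (key x y) (fun _ _ _ => rfl),
      br_congr hu.1 (fun _ _ _ => rfl) (key x z), br_jacobi]
    ring
  · simp [wv_bW, tw, hu]

/-- The degree operator. -/
def degW (N : ℕ) : wordSpace d →L[ℝ] wordSpace d :=
  LinearMap.mkContinuous
    { toFun := fun f => mkW (tw N (fun l => (l : ℝ)) (wv f)) (measW_wv f).tw
        (norm_tw_le (norm_nonneg f) fun u _ => norm_wv_le f u)
      map_add' := fun f g => wv_ext fun u => by simp only [wv_mkW, wv_add, tw_add]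
      map_smul' := fun c f => wv_ext fun u => by
        simp only [wv_mkW, wv_smul, tw_smul, RingHom.id_apply] }
    (wB N fun l => (l : ℝ))
    fun f => norm_le_of_wv (mul_nonneg (wB_nonneg _ _) (norm_nonneg f)) fun u =>
      norm_tw_le (norm_nonneg f) (fun u _ => norm_wv_le f u) u

lemma wv_degW (N : ℕ) (f : wordSpace d) (u : List (V d)) :
    wv (degW N f) u = if InRange N u then (((wdeg u : ℕ) : ℝ) : ℂ) * wv f u else 0 := rfl

lemma degW_bW {N : ℕ} {ρ : ℕ → ℝ} (x y : wordSpace d) :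
    degW N (bW N ρ x y) = bW N ρ (degW N x) y + bW N ρ x (degW N y) := by
  refine wv_ext fun u => ?_
  by_cases hu : InRange N u
  · have key : ∀ a : wordSpace d, ∀ q : List (V d), Odd q.length → q.length ≤ u.length →
        tw N ρ⁻¹ (wv (degW N a)) q = (((wdeg q : ℕ) : ℝ) : ℂ) * tw N ρ⁻¹ (wv a) q := by
      intro a q hq hqu
      have hqr := hu.of_le hq hqu
      rw [tw, tw, if_pos hqr, if_pos hqr, wv_degW, if_pos hqr]
      ring
    rw [wv_add, wv_degW, if_pos hu, wv_bW, wv_bW, wv_bW, tw, tw, tw, if_pos hu, if_pos hu,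
      if_pos hu, br_congr hu.1 (key x) (fun _ _ _ => rfl),
      br_congr hu.1 (fun _ _ _ => rfl) (key y), mul_left_comm, br_wdeg _ _ hu.1]
    ring
  · simp [wv_degW, wv_bW, tw, hu]

/-- The word-space element of the quartic vector field `h P`. -/
def pX (N : ℕ) (ρ : ℕ → ℝ) (h : ℝ) : wordSpace d :=
  mkW (tw N ρ (pw h)) (measW_pw h).tw (norm_tw_le (C := |2 * h|) (abs_nonneg _) fun u _ => by
    rw [pw]
    split_ifs
    · rw [norm_neg]; simp
    · simp)

/-- The word-space element of the linear vector field with frequencies `lam`. -/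
def aX (N : ℕ) (ρ : ℕ → ℝ) (lam : V d → ℝ) (hlam : Measurable lam) {L : ℝ}
    (hL : ∀ ξ, |lam ξ| ≤ L) : wordSpace d :=
  mkW (tw N ρ (aw lam)) (measW_aw hlam).tw
    (norm_tw_le (C := L) ((abs_nonneg _).trans (hL 0)) fun u _ => by
      match u with
      | [] => simpa [aw] using (abs_nonneg _).trans (hL 0)
      | [x] => simpa [aw] using hL x
      | x :: y :: t => simpa [aw] using (abs_nonneg _).trans (hL 0))

lemma wv_pX (N : ℕ) (ρ : ℕ → ℝ) (h : ℝ) (u : List (V d)) :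
    wv (pX N ρ h) u = tw N ρ (pw h) u := rfl

lemma wv_aX (N : ℕ) (ρ : ℕ → ℝ) (lam : V d → ℝ) (hlam : Measurable lam) {L : ℝ}
    (hL : ∀ ξ, |lam ξ| ≤ L) (u : List (V d)) :
    wv (aX N ρ lam hlam hL) u = tw N ρ (aw lam) u := rfl

lemma degW_pX {N : ℕ} (ρ : ℕ → ℝ) (h : ℝ) : degW N (pX N ρ h : wordSpace d) = pX N ρ h := by
  refine wv_ext fun u => ?_
  rw [wv_degW, wv_pX, tw]
  split_ifs with hu
  · by_cases h3 : u.length = 3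
    · have : wdeg u = 1 := by simp [wdeg, h3]
      simp [this]
    · simp [pw, h3]
  · rfl

lemma degW_aX {N : ℕ} (ρ : ℕ → ℝ) (lam : V d → ℝ) (hlam : Measurable lam) {L : ℝ}
    (hL : ∀ ξ, |lam ξ| ≤ L) : degW N (aX N ρ lam hlam hL) = 0 := by
  refine wv_ext fun u => ?_
  rw [wv_degW, wv_aX, tw, wv_zero]
  split_ifs with hu
  · match u with
    | [] => simp [aw]
    | [x] => simp [wdeg]
    | x :: y :: t => simp [aw]
  · rfl

lemma wv_bW_pX {N : ℕ} {ρ : ℕ → ℝ} (hρ : ∀ l, ρ l ≠ 0) (h : ℝ) (b : wordSpace d)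
    (u : List (V d)) :
    wv (bW N ρ (pX N ρ h) b) u = tw N ρ (br (pw h) (tw N ρ⁻¹ (wv b))) u := by
  rw [wv_bW, tw, tw]
  split_ifs with hu
  · rw [br_congr hu.1 (fun q hq hqu => ?_) (fun _ _ _ => rfl)]
    exact tw_inv_tw hρ _ (hu.of_le hq hqu)
  · rfl

lemma wv_bW_aX {N : ℕ} {ρ : ℕ → ℝ} (hρ : ∀ l, ρ l ≠ 0) (lam : V d → ℝ) (hlam : Measurable lam)
    {L : ℝ} (hL : ∀ ξ, |lam ξ| ≤ L) (b : wordSpace d) (u : List (V d)) :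
    wv (bW N ρ (aX N ρ lam hlam hL) b) u =
      if InRange N u then -(Complex.I * wFreq lam u) * wv b u else 0 := by
  rw [wv_bW, tw]
  split_ifs with hu
  · rw [br_congr (c' := aw lam) hu.1 (fun q hq hqu => ?_) (fun _ _ _ => rfl), br_aw lam _ hu.1,
      tw, if_pos hu, Pi.inv_apply, Complex.ofReal_inv]
    swap
    · exact tw_inv_tw hρ _ (hu.of_le hq hqu)
    have : (ρ (wdeg u) : ℂ) ≠ 0 := Complex.ofReal_ne_zero.2 (hρ _)
    field_simp
  · rfl

lemma abs_altFreq_le {lam : V d → ℝ} {L : ℝ} (hL : ∀ ξ, |lam ξ| ≤ L) (u : List (V d)) :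
    |altFreq lam u| ≤ u.length * L := by
  induction u with
  | nil => simp [altFreq]
  | cons x t ih =>
    rw [altFreq, List.length_cons]
    refine (abs_sub _ _).trans ?_
    push_cast
    linarith [hL x]

lemma abs_wFreq_le {lam : V d → ℝ} {L : ℝ} (hL : ∀ ξ, |lam ξ| ≤ L) (u : List (V d)) :
    |wFreq lam u| ≤ (u.length + 1) * L := by
  rw [wFreq]
  refine (abs_sub _ _).trans ?_
  linarith [hL (alt u), abs_altFreq_le hL u]

lemma norm_bW_aX_le {N : ℕ} {ρ : ℕ → ℝ} (hρ : ∀ l, ρ l ≠ 0) (lam : V d → ℝ)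
    (hlam : Measurable lam) {L : ℝ} (hL : ∀ ξ, |lam ξ| ≤ L) :
    ‖bW N ρ (aX N ρ lam hlam hL)‖ ≤ (2 * N + 2) * L := by
  have hL0 : 0 ≤ L := (abs_nonneg _).trans (hL 0)
  refine ContinuousLinearMap.opNorm_le_bound _ (by positivity) fun b => ?_
  refine norm_le_of_wv (by positivity) fun u => ?_
  rw [wv_bW_aX hρ]
  split_ifs with hu
  · rw [norm_mul, norm_neg, norm_mul, Complex.norm_I, one_mul, Complex.norm_real, Real.norm_eq_abs]
    refine mul_le_mul ((abs_wFreq_le hL u).trans ?_) (norm_wv_le b u) (norm_nonneg _)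
      (by positivity)
    have : u.length + 1 ≤ 2 * N + 2 := by have := hu.2; omega
    have : (u.length : ℝ) + 1 ≤ 2 * N + 2 := by exact_mod_cast this
    gcongr
  · rw [norm_zero]; positivity

lemma norm_bW_pX_le {N : ℕ} {ρ : ℕ → ℝ} (hρ : ∀ l, 0 < ρ l) {h : ℝ} (hh : 0 ≤ h) {ε : ℝ}
    (hε : 0 ≤ ε) (hr : ∀ l, ρ (l + 1) * (4 * h * (l + 2)) ≤ ε * ρ l) :
    ‖bW N ρ (pX N ρ h : wordSpace d)‖ ≤ ε := by
  refine ContinuousLinearMap.opNorm_le_bound _ hε fun b => ?_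
  refine norm_le_of_wv (by positivity) fun u => ?_
  rw [wv_bW_pX (fun l => (hρ l).ne'), tw]
  split_ifs with hu
  · rw [norm_mul, Complex.norm_real, Real.norm_of_nonneg (hρ _).le]
    rcases Nat.eq_zero_or_pos (wdeg u) with h0 | h0
    · rw [br_pw_of_length_one h _ (by rw [hu.length_eq, h0])]
      simp; positivity
    · obtain ⟨l, hl⟩ : ∃ l, wdeg u = l + 1 := ⟨wdeg u - 1, by omega⟩
      have hul : u.length = 2 * l + 3 := by rw [hu.length_eq, hl]; ring
      have hb : ∀ q : List (V d), q.length + 2 = u.length →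
          ‖tw N ρ⁻¹ (wv b) q‖ ≤ (ρ l)⁻¹ * ‖b‖ := by
        intro q hq
        have hql : wdeg q = l := by unfold wdeg; omega
        rw [tw]
        split_ifs
        · rw [hql, norm_mul, Complex.norm_real, Pi.inv_apply,
            Real.norm_of_nonneg (inv_nonneg.2 (hρ l).le)]
          exact mul_le_mul_of_nonneg_left (norm_wv_le b q) (inv_nonneg.2 (hρ l).le)
        · rw [norm_zero]; exact mul_nonneg (inv_nonneg.2 (hρ l).le) (norm_nonneg b)
      have h1 := norm_br_pw_le hh hu.1 hb (mul_nonneg (inv_nonneg.2 (hρ l).le) (norm_nonneg b))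
      rw [hl]
      calc ρ (l + 1) * ‖br (pw h) (tw N ρ⁻¹ (wv b)) u‖
          ≤ ρ (l + 1) * ((u.length + 1) * (2 * h * ((ρ l)⁻¹ * ‖b‖))) :=
            mul_le_mul_of_nonneg_left h1 (hρ _).le
        _ = (ρ (l + 1) * (4 * h * (l + 2))) * ((ρ l)⁻¹ * ‖b‖) := by
            rw [hul]; push_cast; ring
        _ ≤ (ε * ρ l) * ((ρ l)⁻¹ * ‖b‖) :=
            mul_le_mul_of_nonneg_right (hr l)
              (mul_nonneg (inv_nonneg.2 (hρ l).le) (norm_nonneg b))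
        _ = ε * ‖b‖ := by
            have := (hρ l).ne'
            field_simp
  · rw [norm_zero]; positivity

end TruncatedBracket

section ModifiedField

variable {d : ℕ}

/-- The common kernel of a family of continuous functionals. -/
def kerFam {X ι : Type*} [NormedAddCommGroup X] [NormedSpace ℝ X] (L : ι → X →L[ℝ] ℂ) :
    Submodule ℝ X where
  carrier := {x | ∀ i, L i x = 0}
  add_mem' := fun hx hy i => by rw [map_add, hx i, hy i, add_zero]
  zero_mem' := fun i => map_zero _
  smul_mem' := fun c x hx i => by rw [map_smul, hx i, smul_zero]

lemma mem_kerFam {X ι : Type*} [NormedAddCommGroup X] [NormedSpace ℝ X] {L : ι → X →L[ℝ] ℂ}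
    {x : X} : x ∈ kerFam L ↔ ∀ i, L i x = 0 := Iff.rfl

lemma isClosed_kerFam {X ι : Type*} [NormedAddCommGroup X] [NormedSpace ℝ X]
    (L : ι → X →L[ℝ] ℂ) : IsClosed (kerFam L : Set X) := by
  have : (kerFam L : Set X) = ⋂ i, {x | L i x = 0} := by ext; simp [mem_kerFam]
  rw [this]
  exact isClosed_iInter fun i => isClosed_eq (L i).continuous continuous_const

/-- Elements of the word space that vanish off the words of degree between `1` and `N`. -/
def posDeg (N : ℕ) : Submodule ℝ (wordSpace d) :=
  kerFam fun u : {u : List (V d) // ¬(InRange N u ∧ 1 ≤ wdeg u)} => evW u.1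

lemma mem_posDeg {N : ℕ} {f : wordSpace d} :
    f ∈ posDeg N ↔ ∀ u, ¬(InRange N u ∧ 1 ≤ wdeg u) → wv f u = 0 := by
  simp [posDeg, mem_kerFam]

/-- Hamiltonian elements of the word space. -/
def cycSub (d : ℕ) : Submodule ℝ (wordSpace d) :=
  kerFam fun u : {u : List (V d) // Odd u.length} =>
    (Complex.conjCLE : ℂ →L[ℝ] ℂ).comp (evW (alt u.1 :: u.1.dropLast)) + evW u.1

lemma mem_cycSub {f : wordSpace d} : f ∈ cycSub d ↔ Cyc (wv f) := by
  simp only [cycSub, mem_kerFam, Cyc, rot, Subtype.forall, add_apply,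
    ContinuousLinearMap.comp_apply, evW_apply]
  refine forall₂_congr fun u hu => ?_
  rw [neg_eq_iff_add_eq_zero]
  rfl

lemma Cyc.tw {N : ℕ} {ρ : ℕ → ℝ} {f : Wd d} (hf : Cyc f) : Cyc (tw N ρ f) := by
  intro u hu
  have hl := length_rot hu
  have hr : InRange N (alt u :: u.dropLast) ↔ InRange N u := by simp only [InRange, hl]
  have hw : wdeg (alt u :: u.dropLast) = wdeg u := by simp only [wdeg, hl]
  have h1 := hf u hu
  rw [rot] at h1
  rw [rot, NLSSplitting.tw, NLSSplitting.tw, hw]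
  by_cases h : InRange N u
  · rw [if_pos (hr.2 h), if_pos h, map_mul, Complex.conj_ofReal, ← h1]
    ring
  · rw [if_neg (fun h' => h (hr.1 h')), if_neg h, map_zero, neg_zero]

lemma bW_pX_mem_cycSub {N : ℕ} {ρ : ℕ → ℝ} (hρ : ∀ l, ρ l ≠ 0) (h : ℝ) :
    ∀ b ∈ cycSub d, bW N ρ (pX N ρ h) b ∈ cycSub d := by
  intro b hb
  rw [mem_cycSub] at hb ⊢
  rw [show wv (bW N ρ (pX N ρ h) b) = _ from funext fun u => wv_bW_pX hρ h b u]
  exact (Cyc.br_pw hb.tw).tw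

lemma bW_aX_mem_cycSub {N : ℕ} {ρ : ℕ → ℝ} (hρ : ∀ l, ρ l ≠ 0) (lam : V d → ℝ)
    (hlam : Measurable lam) {L : ℝ} (hL : ∀ ξ, |lam ξ| ≤ L) :
    ∀ b ∈ cycSub d, bW N ρ (aX N ρ lam hlam hL) b ∈ cycSub d := by
  intro b hb
  rw [mem_cycSub] at hb ⊢
  have : wv (bW N ρ (aX N ρ lam hlam hL) b) = tw N (fun _ => 1) (br (aw lam) (wv b)) := by
    funext u
    rw [wv_bW_aX hρ, tw]
    split_ifs with hu
    · rw [br_aw lam _ hu.1, Complex.ofReal_one, one_mul]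
    · rfl
  rw [this]
  exact (Cyc.br_aw hb).tw

lemma bW_pX_apply_of_posDeg {N : ℕ} {ρ : ℕ → ℝ} (hρ : ∀ l, ρ l ≠ 0) (h : ℝ) {b : wordSpace d}
    (hb : b ∈ posDeg N) {u : List (V d)} (hu : ¬(InRange N u ∧ 2 ≤ wdeg u)) :
    wv (bW N ρ (pX N ρ h) b) u = 0 := by
  rw [wv_bW_pX hρ, tw]
  split_ifs with hr
  · have hl := hr.length_eq
    have hw : wdeg u ≤ 1 := by by_contra hc; exact hu ⟨hr, by omega⟩
    rcases Nat.lt_or_ge u.length 3 with h3 | h3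
    · rw [br_pw_of_length_one h _ (by omega), mul_zero]
    · have hz : ∀ q : List (V d), q.length + 2 = u.length → tw N ρ⁻¹ (wv b) q = 0 := by
        intro q hq
        rw [tw]
        split_ifs
        · rw [mem_posDeg.1 hb q (fun hc => by have := hc.2; unfold wdeg at this; omega), mul_zero]
        · rfl
      rw [br_pw h _ hr.1 h3, Finset.sum_eq_zero, Finset.sum_eq_zero, add_zero, mul_zero]
      · intro i hi
        rw [clTerm, hz, cj_apply_zero, mul_zero]
        simp only [List.length_take, List.length_drop]
        have := Finset.mem_range.1 hi
        omega
      · intro j hj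
        rw [trTerm, hz, mul_zero]
        exact length_trip (by have := Finset.mem_range.1 hj; omega)
  · rfl

lemma bW_pX_mem_posDeg {N : ℕ} {ρ : ℕ → ℝ} (hρ : ∀ l, ρ l ≠ 0) (h : ℝ) :
    ∀ b ∈ posDeg N, bW N ρ (pX N ρ h) b ∈ posDeg (d := d) N := fun _ hb =>
  mem_posDeg.2 fun _ hu => bW_pX_apply_of_posDeg hρ h hb fun hc => hu ⟨hc.1, by omega⟩

lemma bW_aX_mem_posDeg {N : ℕ} {ρ : ℕ → ℝ} (hρ : ∀ l, ρ l ≠ 0) (lam : V d → ℝ)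
    (hlam : Measurable lam) {L : ℝ} (hL : ∀ ξ, |lam ξ| ≤ L) :
    ∀ b ∈ posDeg N, bW N ρ (aX N ρ lam hlam hL) b ∈ posDeg N := fun b hb =>
  mem_posDeg.2 fun u hu => by
    rw [wv_bW_aX hρ]
    split_ifs
    · rw [mem_posDeg.1 hb u hu, mul_zero]
    · rfl

lemma wv_pX_eq {N : ℕ} (ρ : ℕ → ℝ) (h : ℝ) (u : List (V d)) :
    wv (pX N ρ h) u = if InRange N u ∧ wdeg u = 1 then -(2 * Complex.I * h) * ρ 1 else 0 := by
  rw [wv_pX, tw, pw]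
  by_cases hr : InRange N u
  · have hl := hr.length_eq
    by_cases hw : wdeg u = 1
    · rw [if_pos hr, if_pos (by omega), if_pos ⟨hr, hw⟩, hw, mul_comm]
    · rw [if_pos hr, if_neg (by omega), if_neg (fun hc => hw hc.2), mul_zero]
  · rw [if_neg hr, if_neg (fun hc => hr hc.1)]

lemma pX_mem_posDeg {N : ℕ} (ρ : ℕ → ℝ) (h : ℝ) : (pX N ρ h : wordSpace d) ∈ posDeg N :=
  mem_posDeg.2 fun u hu => by
    rw [wv_pX_eq, if_neg fun hc => hu ⟨hc.1, hc.2.ge⟩]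

lemma pX_mem_cycSub {N : ℕ} (ρ : ℕ → ℝ) (h : ℝ) : (pX N ρ h : wordSpace d) ∈ cycSub d :=
  mem_cycSub.2 (cyc_pw h).tw

lemma aX_mem_cycSub {N : ℕ} {ρ : ℕ → ℝ} (lam : V d → ℝ)
    (hlam : Measurable lam) {L : ℝ} (hL : ∀ ξ, |lam ξ| ≤ L) :
    aX N ρ lam hlam hL ∈ cycSub d :=
  mem_cycSub.2 (cyc_aw lam).tw

lemma norm_pX_le {N : ℕ} {ρ : ℕ → ℝ} {h : ℝ} (hh : 0 ≤ h) (hρ : 0 ≤ ρ 1) :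
    ‖(pX N ρ h : wordSpace d)‖ ≤ 2 * h * ρ 1 :=
  norm_le_of_wv (by positivity) fun u => by
    rw [wv_pX_eq]
    split_ifs
    · simp [abs_of_nonneg hh, abs_of_nonneg hρ]
    · rw [norm_zero]; positivity

lemma integral_exp_mul_multiplier {θ : ℝ} (hθ : |θ| ≤ 1 / 4) :
    (∫ s in (0 : ℝ)..1, Complex.exp (s * (Complex.I * θ))) * multiplier θ = 1 := by
  rw [multiplier]
  split_ifs with h0
  · simp [h0]
  · have hc : Complex.I * θ ≠ 0 := mul_ne_zero Complex.I_ne_zero (Complex.ofReal_ne_zero.2 h0)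
    have h1 : Complex.exp (Complex.I * θ) - 1 ≠ 0 := by
      rw [sub_ne_zero]
      intro he
      obtain ⟨n, hn⟩ := Complex.exp_eq_one_iff.1 he
      have h2 : (θ : ℂ) = n * (2 * Real.pi) := by
        have := Complex.I_ne_zero
        apply mul_left_cancel₀ this
        rw [hn]; ring
      have h3 : θ = n * (2 * Real.pi) := by exact_mod_cast h2
      have hn0 : n ≠ 0 := by rintro rfl; simp at h3; exact h0 h3
      have hn1 : (1 : ℝ) ≤ |(n : ℝ)| := by exact_mod_cast Int.one_le_abs hn0
      have := Real.pi_gt_three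
      rw [h3, abs_mul, abs_of_pos (by positivity : (0 : ℝ) < 2 * Real.pi)] at hθ
      nlinarith
    have h2 : (fun s : ℝ => Complex.exp (s * (Complex.I * θ))) =
        fun s : ℝ => Complex.exp ((Complex.I * θ) * s) := by
      funext s; rw [mul_comm]
    rw [h2, integral_exp_mul_complex hc]
    simp only [Complex.ofReal_one, mul_one, Complex.ofReal_zero, mul_zero, Complex.exp_zero]
    field_simp
    exact div_self (Complex.ofReal_ne_zero.2 h0)

/-- Existence of a modified vector field that is invariant under the splitting step, up to
truncation. -/
theorem exists_modified_field {N : ℕ} (hN : 1 ≤ N) {ρ : ℕ → ℝ} (hρ : ∀ l, 0 < ρ l) {h : ℝ}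
    (hh : 0 ≤ h) (hr : ∀ l : ℕ, ρ (l + 1) * (4 * h * (l + 2)) ≤ 1 / 50 * ρ l) (lam : V d → ℝ)
    (hlam : Measurable lam) {L : ℝ} (hL : ∀ ξ, |lam ξ| ≤ L) (hNL : (2 * N + 2) * L ≤ 1 / 50) :
    ∃ Z : wordSpace d,
      NormedSpace.exp (bW N ρ (aX N ρ lam hlam hL)) (NormedSpace.exp (bW N ρ (pX N ρ h)) Z) = Z ∧
      (∀ u, ¬InRange N u → wv Z u = 0) ∧ Cyc (wv Z) ∧
      (∀ x, wv Z [x] = ρ 0 * -(Complex.I * lam x)) ∧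
      (∀ u, u.length = 3 →
        wv Z u = -(2 * Complex.I * h) * ρ 1 * multiplier (wFreq lam u)) ∧
      ∀ u, u.length ≠ 1 → ‖wv Z u‖ ≤ 2 * (2 * h * ρ 1) := by
  have hρ' : ∀ l, ρ l ≠ 0 := fun l => (hρ l).ne'
  set a := aX N ρ lam hlam hL with ha
  set p : wordSpace d := pX N ρ h with hp
  obtain ⟨D, Y, hY, hS, hZ⟩ := lie_interpolation (β := bW (d := d) N ρ) (bW_anti N ρ)
    (bW_jacobi hρ') (E := degW N) degW_bW (a := a) (p := p) (degW_aX ρ lam hlam hL) (degW_pX ρ h)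
    ((norm_bW_aX_le hρ' lam hlam hL).trans hNL) (norm_bW_pX_le hρ hh (by norm_num) hr)
  obtain ⟨hY0, hl⟩ := hS (posDeg N) (isClosed_kerFam _) (bW_aX_mem_posDeg hρ' lam hlam hL)
    (bW_pX_mem_posDeg hρ' h) (pX_mem_posDeg ρ h)
  have hYc := (hS (cycSub d) (isClosed_kerFam _) (bW_aX_mem_cycSub hρ' lam hlam hL)
    (bW_pX_mem_cycSub hρ' h) (pX_mem_cycSub ρ h)).1
  have hYb : ∀ u, ‖wv Y u‖ ≤ 2 * (2 * h * ρ 1) := fun u =>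
    (norm_wv_le Y u).trans (hY.trans (by have := norm_pX_le (d := d) (N := N) hh (hρ 1).le; gcongr))
  set Z₁ : wordSpace d := mkW (tw N (fun l => (l : ℝ)⁻¹) (wv Y)) (measW_wv Y).tw
    (norm_tw_le (norm_nonneg Y) fun u _ => norm_wv_le Y u) with hZ₁
  have hZ₁v : ∀ u, wv Z₁ u = tw N (fun l => (l : ℝ)⁻¹) (wv Y) u := fun u => rfl
  have hZ₁0 : Z₁ ∈ posDeg N := mem_posDeg.2 fun u hu => by
    rw [hZ₁v, tw]
    split_ifs
    · rw [mem_posDeg.1 hY0 u hu, mul_zero]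
    · rfl
  have hEZ₁ : degW N Z₁ = Y := wv_ext fun u => by
    rw [wv_degW, hZ₁v, tw]
    by_cases hu : InRange N u ∧ 1 ≤ wdeg u
    · have : ((wdeg u : ℝ) : ℂ) ≠ 0 := by
        have : wdeg u ≠ 0 := by omega
        exact_mod_cast this
      rw [if_pos hu.1, if_pos hu.1, Complex.ofReal_inv, ← mul_assoc, mul_inv_cancel₀ this, one_mul]
    · rw [mem_posDeg.1 hY0 u hu]
      split_ifs <;> simp
  have hEZ : degW N (Z₁ + a) = Y := by
    rw [map_add, hEZ₁, degW_aX, add_zero]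
  have h3 : ∀ u : List (V d), u.length = 3 → |wFreq lam u| ≤ 1 / 4 ∧
      evW u (D p) = -(Complex.I * wFreq lam u) * evW u p ∧
      evW u p = (∫ s in (0 : ℝ)..1, Complex.exp (s * (Complex.I * wFreq lam u))) * evW u Y := by
    intro u hu
    have hru : InRange N u := ⟨by rw [hu]; decide, by omega⟩
    have hL0 : 0 ≤ L := (abs_nonneg _).trans (hL 0)
    have hb : |wFreq lam u| ≤ 1 / 4 := by
      refine (abs_wFreq_le hL u).trans (le_trans ?_ (hNL.trans (by norm_num)))
      have : (1 : ℝ) ≤ N := by exact_mod_cast hN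
      rw [hu]; push_cast; nlinarith
    refine ⟨hb, hl (evW u) _ hb (fun x _ => ?_) fun x hx => ?_⟩
    · rw [evW_apply, evW_apply, ha, wv_bW_aX hρ', if_pos hru]
    · rw [evW_apply, hp, bW_pX_apply_of_posDeg hρ' h hx]
      rintro ⟨-, h2⟩
      unfold wdeg at h2; omega
  obtain ⟨hEW, hUZ⟩ := hZ (Z₁ + a) hEZ
  have hW : D p + bW N ρ p (Z₁ + a) = 0 := wv_ext fun u => by
    have h1 : wv (degW N (D p + bW N ρ p (Z₁ + a))) u = wv (D p + bW N ρ p (Z₁ + a)) u := by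
      rw [hEW]
    rw [wv_degW] at h1
    rw [wv_zero]
    split_ifs at h1 with hru
    · by_cases hw : wdeg u = 1
      · have hu3 : u.length = 3 := by rw [hru.length_eq, hw]
        have h2 := (h3 u hu3).2.1
        rw [evW_apply, evW_apply] at h2
        have h4 : wv (bW N ρ p Z₁) u = 0 :=
          bW_pX_apply_of_posDeg hρ' h hZ₁0 (by rintro ⟨-, h2⟩; omega)
        have h5 : wv (bW N ρ p a) u = Complex.I * wFreq lam u * wv p u := by
          rw [bW_anti, wv_neg, ha, wv_bW_aX hρ', if_pos hru]; ring
        rw [wv_add, map_add, wv_add, h2, h4, h5]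
        ring
      · have : (((wdeg u : ℝ) : ℂ) - 1) * wv (D p + bW N ρ p (Z₁ + a)) u = 0 := by
          rw [sub_mul, h1]; ring
        rcases mul_eq_zero.1 this with h2 | h2
        · exfalso; apply hw
          rw [sub_eq_zero] at h2
          exact_mod_cast h2
        · exact h2
    · exact h1.symm
  rw [hW, map_zero, map_zero] at hUZ
  have hstep : ∀ u, ¬(InRange N u ∧ 1 ≤ wdeg u) → ∀ x : wordSpace d,
      wv (NormedSpace.exp (bW N ρ a) (NormedSpace.exp (bW N ρ p) x)) u = wv x u := by
    intro u hu x
    have e1 := exp_apply_eigen (S := ⊤) (T := bW N ρ a) (l := evW u) (μ := 0)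
      (fun _ _ => trivial) (fun x _ => by
        rw [evW_apply, ha, wv_bW_aX hρ', zero_mul]
        split_ifs with hr
        · have : u.length = 1 := by
            have := hr.length_eq
            have : ¬ 1 ≤ wdeg u := fun hc => hu ⟨hr, hc⟩
            omega
          obtain ⟨y, rfl⟩ := List.length_eq_one_iff.1 this
          simp [wFreq, altFreq, alt]
        · rfl) (NormedSpace.exp (bW N ρ p) x) trivial
    have e2 := exp_apply_eigen (S := ⊤) (T := bW N ρ p) (l := evW u) (μ := 0)
      (fun _ _ => trivial) (fun x _ => by
        rw [evW_apply, hp, wv_bW_pX hρ', zero_mul, tw]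
        split_ifs with hr
        · have : u.length = 1 := by
            have := hr.length_eq
            have : ¬ 1 ≤ wdeg u := fun hc => hu ⟨hr, hc⟩
            omega
          rw [br_pw_of_length_one h _ this, mul_zero]
        · rfl) x trivial
    rw [Complex.exp_zero, one_mul, evW_apply, evW_apply] at e1 e2
    rw [e1, e2]
  have hav : ∀ u : List (V d), u.length ≠ 1 → wv a u = 0 := by
    intro u hu
    rw [ha, wv_aX, tw]
    match u with
    | [] => simp [aw]
    | [x] => simp at hu
    | x :: y :: t => simp [aw]
  refine ⟨Z₁ + a, wv_ext fun u => ?_, fun u hu => ?_, ?_, fun x => ?_, fun u hu => ?_,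
    fun u hu => ?_⟩
  · by_cases hu : InRange N u ∧ 1 ≤ wdeg u
    · have h1 : wv (degW N (NormedSpace.exp (bW N ρ a) (NormedSpace.exp (bW N ρ p) (Z₁ + a)) -
          (Z₁ + a))) u = 0 := by rw [hUZ, wv_zero]
      rw [wv_degW, if_pos hu.1, wv_sub] at h1
      rcases mul_eq_zero.1 h1 with h2 | h2
      · have : wdeg u ≠ 0 := by omega
        exact absurd (by exact_mod_cast h2) this
      · exact sub_eq_zero.1 h2
    · exact hstep u hu _
  · rw [wv_add, hZ₁v, tw, if_neg hu, ha, wv_aX, tw, if_neg hu, add_zero]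
  · have h1 : Cyc (wv Z₁) := (mem_cycSub.1 hYc).tw
    exact mem_cycSub.1 ((cycSub d).add_mem (mem_cycSub.2 h1) (aX_mem_cycSub lam hlam hL))
  · have hr1 : InRange N [x] := ⟨by simp, by simp⟩
    have : wv Z₁ [x] = 0 := mem_posDeg.1 hZ₁0 _ (by rintro ⟨-, hc⟩; simp [wdeg] at hc)
    rw [wv_add, this, zero_add, ha, wv_aX, tw, if_pos hr1]
    simp [wdeg, aw]
  · have hru : InRange N u := ⟨by rw [hu]; decide, by omega⟩
    have hw : wdeg u = 1 := by simp [wdeg, hu]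
    obtain ⟨hb, -, hi⟩ := h3 u hu
    rw [wv_add, hav u (by omega), add_zero, hZ₁v, tw, if_pos hru, hw, Nat.cast_one, inv_one,
      Complex.ofReal_one, one_mul]
    rw [evW_apply, evW_apply, hp, wv_pX_eq, if_pos ⟨hru, hw⟩] at hi
    have := integral_exp_mul_multiplier hb
    rw [hi]
    linear_combination (-wv Y u) * this
  · rw [wv_add, hav u hu, add_zero, hZ₁v, tw]
    split_ifs with hr
    · refine le_trans ?_ (hYb u)
      rw [norm_mul, Complex.norm_real]
      refine mul_le_of_le_one_left (norm_nonneg _) ?_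
      rw [Real.norm_of_nonneg (by positivity)]
      exact Nat.cast_inv_le_one _
    · rw [norm_zero]; have := hρ 1; positivity

end ModifiedField

section ZeroMomentumPoints

variable {d : ℕ}

/-- The zero-momentum configuration that closes a word of odd length. -/
def pt {m : ℕ} (ξ : Fin m → V d) : Fin (m + 1) → V d :=
  Fin.snoc (α := fun _ => V d) ξ (alt (List.ofFn ξ))

@[simp] lemma pt_castSucc {m : ℕ} (ξ : Fin m → V d) (i : Fin m) : pt ξ i.castSucc = ξ i := by
  simp [pt]

@[simp] lemma pt_last {m : ℕ} (ξ : Fin m → V d) : pt ξ (Fin.last m) = alt (List.ofFn ξ) := by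
  simp [pt]

lemma measurable_alt_ofFn (m : ℕ) : Measurable fun ξ : Fin m → V d => alt (List.ofFn ξ) :=
  measW_alt m

lemma measurable_pt {m : ℕ} (i : Fin (m + 1)) : Measurable fun ξ : Fin m → V d => pt ξ i := by
  refine Fin.lastCases ?_ (fun j => ?_) i
  · simpa using measurable_alt_ofFn m
  · simpa using measurable_pi_apply j

lemma measurePreserving_cons (n : ℕ) : MeasurePreserving
    (fun p : V d × (Fin n → V d) => (Fin.cons p.1 p.2 : Fin (n + 1) → V d)) := by
  have := (volume_preserving_piFinSuccAbove (fun _ : Fin (n + 1) => V d) 0).symm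
  convert this using 1
  funext p
  simp [MeasurableEquiv.piFinSuccAbove, Fin.insertNthEquiv]

lemma measurableEmbedding_cons (n : ℕ) : MeasurableEmbedding
    (fun p : V d × (Fin n → V d) => (Fin.cons p.1 p.2 : Fin (n + 1) → V d)) := by
  have := (MeasurableEquiv.piFinSuccAbove (fun _ : Fin (n + 1) => V d) 0).symm.measurableEmbedding
  convert this using 1
  funext p
  simp [MeasurableEquiv.piFinSuccAbove, Fin.insertNthEquiv]

lemma measurePreserving_snoc (n : ℕ) : MeasurePreserving
    (fun p : V d × (Fin n → V d) => (Fin.snoc p.2 p.1 : Fin (n + 1) → V d)) := by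
  have := (volume_preserving_piFinSuccAbove (fun _ : Fin (n + 1) => V d) (Fin.last n)).symm
  convert this using 1
  funext p
  simp only [MeasurableEquiv.piFinSuccAbove, MeasurableEquiv.symm_mk, MeasurableEquiv.coe_mk,
    Equiv.symm_symm, Fin.insertNthEquiv, Equiv.coe_fn_mk, Fin.insertNth_last']

lemma measurePreserving_shear {n : ℕ} (s : V d → V d) (hs : MeasurePreserving s)
    (g : (Fin n → V d) → V d) (hg : Measurable g) : MeasurePreserving
    (fun p : V d × (Fin n → V d) => (s p.1 + g p.2, p.2)) := by
  have h1 : MeasurePreserving (fun p : (Fin n → V d) × V d => (id p.1, g p.1 + s p.2)) := by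
    refine (MeasurePreserving.id volume).skew_product (g := fun w x => g w + s x) ?_ ?_
    · exact (hg.comp measurable_fst).add (hs.measurable.comp measurable_snd)
    · exact Filter.Eventually.of_forall fun w =>
        ((measurePreserving_add_left volume (g w)).comp hs).map_eq
  have h2 := (Measure.measurePreserving_swap.comp h1).comp
    (Measure.measurePreserving_swap (μ := (volume : Measure (V d)))
      (ν := (volume : Measure (Fin n → V d))))
  rw [Measure.volume_eq_prod]
  convert h2 using 1
  funext p
  simp [add_comm]

/-- Rotation of a zero-momentum configuration. -/
def rotPt {n : ℕ} (ξ : Fin (n + 1) → V d) : Fin (n + 1) → V d :=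
  Fin.cons (alt (List.ofFn ξ)) (Fin.init ξ)

lemma ofFn_rotPt {n : ℕ} (ξ : Fin (n + 1) → V d) :
    List.ofFn (rotPt ξ) = alt (List.ofFn ξ) :: (List.ofFn ξ).dropLast := by
  rw [rotPt, List.ofFn_succ]
  congr 1
  rw [List.ofFn_succ_last (f := ξ), List.dropLast_concat]
  simp only [Fin.cons_succ]
  rfl

lemma measurePreserving_rotPt {n : ℕ} (hn : Even n) :
    MeasurePreserving (rotPt : (Fin (n + 1) → V d) → Fin (n + 1) → V d) := by
  have h1 := (measurePreserving_cons (d := d) n).comp ((measurePreserving_shear id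
    (MeasurePreserving.id volume) _ (measurable_alt_ofFn n)).comp
    (volume_preserving_piFinSuccAbove (fun _ : Fin (n + 1) => V d) (Fin.last n)))
  convert h1 using 1
  · funext ξ
    have : alt (List.ofFn ξ) = ξ (Fin.last n) + alt (List.ofFn (Fin.init ξ)) := by
      rw [List.ofFn_succ_last, alt_append, if_pos (by simpa using hn), add_comm]
      simp [alt]
      rfl
    simp only [rotPt, this, Function.comp_apply, MeasurableEquiv.piFinSuccAbove,
      Fin.insertNthEquiv, MeasurableEquiv.coe_mk, Equiv.coe_fn_symm_mk, id]
    have h2 : (Fin.last n).removeNth ξ = Fin.init ξ := by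
      funext i
      simp [Fin.removeNth, Fin.init]
    rw [h2]

lemma alt_ofFn_rotPt {n : ℕ} (hn : Even n) (ξ : Fin (n + 1) → V d) :
    alt (List.ofFn (rotPt ξ)) = ξ (Fin.last n) := by
  rw [ofFn_rotPt]
  exact alt_rot (by simpa using Even.add_one hn) List.ofFn_succ_last

lemma measurableEmbedding_rotPt {n : ℕ} (hn : Even n) :
    MeasurableEmbedding (rotPt : (Fin (n + 1) → V d) → Fin (n + 1) → V d) := by
  have hl : Function.LeftInverse
      (fun ζ : Fin (n + 1) → V d => (Fin.snoc (Fin.tail ζ) (alt (List.ofFn ζ)) : Fin (n + 1) → V d))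
      rotPt := by
    intro ξ
    simp only [alt_ofFn_rotPt hn]
    rw [rotPt, Fin.tail_cons, Fin.snoc_init_self]
  refine MeasurableEmbedding.of_measurable_inverse (measurePreserving_rotPt hn).measurable ?_ ?_ hl
  · have : Set.range (rotPt : (Fin (n + 1) → V d) → Fin (n + 1) → V d) = Set.univ := by
      refine Set.eq_univ_of_forall fun ζ => ⟨Fin.snoc (Fin.tail ζ) (alt (List.ofFn ζ)), ?_⟩
      have h1 : alt (List.ofFn (Fin.snoc (Fin.tail ζ) (alt (List.ofFn ζ)) : Fin (n + 1) → V d)) =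
          ζ 0 := by
        rw [List.ofFn_succ_last, alt_append, if_pos (by simpa using hn)]
        simp only [Fin.snoc_castSucc, Fin.snoc_last, alt, sub_zero]
        rw [List.ofFn_succ (f := ζ), alt]
        simp [Fin.tail]
      rw [rotPt, h1, Fin.init_snoc, Fin.cons_self_tail]
    rw [this]
    exact MeasurableSet.univ
  · refine measurable_pi_iff.2 fun i => ?_
    refine Fin.lastCases ?_ (fun j => ?_) i
    · simpa using measurable_alt_ofFn (n + 1)
    · simpa [Fin.tail] using measurable_pi_apply j.succ

lemma quasiMeasurePreserving_pt {n : ℕ} (hn : Even n) (i : Fin (n + 2)) :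
    Measure.QuasiMeasurePreserving fun ξ : Fin (n + 1) → V d => pt ξ i := by
  refine Fin.lastCases ?_ (fun j => ?_) i
  · simp only [pt_last]
    have h := (Measure.quasiMeasurePreserving_eval (fun _ : Fin (n + 1) => (volume : Measure (V d)))
      0).comp (measurePreserving_rotPt (d := d) hn).quasiMeasurePreserving
    exact h
  · simp only [pt_castSucc]
    exact Measure.quasiMeasurePreserving_eval (fun _ : Fin (n + 1) => (volume : Measure (V d))) j

end ZeroMomentumPoints

section Bounds

variable {d : ℕ}

lemma lintegral_pi_prod {n : ℕ} (a : Fin n → V d → ℝ≥0∞) (ha : ∀ i, Measurable (a i)) :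
    ∫⁻ ξ : Fin n → V d, ∏ i, a i (ξ i) = ∏ i, ∫⁻ x, a i x := by
  induction n with
  | zero =>
    simp only [Finset.univ_eq_empty, Finset.prod_empty, lintegral_const, one_mul]
    rw [volume_pi, Measure.pi_univ]
    simp
  | succ n ih =>
    rw [← (measurePreserving_cons n).lintegral_comp_emb (measurableEmbedding_cons n),
      Fin.prod_univ_succ, ← ih (fun i => a i.succ) fun i => ha _]
    simp only [Fin.prod_univ_succ, Fin.cons_zero, Fin.cons_succ]
    rw [Measure.volume_eq_prod]
    exact lintegral_prod_mul (μ := volume) (ν := volume) (g := fun w : Fin n → V d => ∏ i, a i.succ (w i)) (ha 0).aemeasurable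
      (Finset.measurable_prod _ fun i _ =>
        (ha i.succ).comp (measurable_pi_apply i)).aemeasurable

/-- The `L²` norm, as an extended nonnegative number. -/
def en2 (a : V d → ℝ≥0∞) : ℝ≥0∞ := (∫⁻ x, a x ^ (2 : ℝ)) ^ (1 / 2 : ℝ)

lemma lintegral_mul_sub_le (a b : V d → ℝ≥0∞) (ha : Measurable a) (hb : Measurable b) (y : V d) :
    ∫⁻ x, a x * b (x - y) ≤ en2 a * en2 b := by
  have h := ENNReal.lintegral_mul_le_Lp_mul_Lq volume Real.HolderConjugate.two_two ha.aemeasurable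
    (hb.comp (measurable_id.sub_const y)).aemeasurable
  refine h.trans (le_of_eq ?_)
  have : ∫⁻ x, (b ∘ fun x => id x - y) x ^ (2 : ℝ) = ∫⁻ x, b x ^ (2 : ℝ) :=
    lintegral_sub_right_eq_self (fun x => b x ^ (2 : ℝ)) y
  rw [this]
  rfl

lemma lintegral_pt_le {n : ℕ} (a : Fin (n + 2) → V d → ℝ≥0∞) (ha : ∀ i, Measurable (a i)) :
    ∫⁻ ξ : Fin (n + 1) → V d, ∏ i, a i (pt ξ i) ≤
      en2 (a 0) * en2 (a (Fin.last _)) * ∏ i : Fin n, ∫⁻ x, a i.succ.castSucc x := by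
  rw [← lintegral_pi_prod (fun i : Fin n => a i.succ.castSucc) fun i => ha _]
  rw [← (measurePreserving_cons n).lintegral_comp_emb (measurableEmbedding_cons n)]
  have hm : Measurable fun p : V d × (Fin n → V d) =>
      ∏ i, a i (pt (Fin.cons p.1 p.2 : Fin (n + 1) → V d) i) :=
    Finset.measurable_prod _ fun i _ => (ha i).comp
      ((measurable_pt i).comp (measurePreserving_cons n).measurable)
  rw [Measure.volume_eq_prod, lintegral_prod_symm _ hm.aemeasurable]
  rw [← lintegral_const_mul _ (Finset.measurable_prod _ fun i _ =>
    (ha i.succ.castSucc).comp (measurable_pi_apply i))]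
  refine lintegral_mono fun w => ?_
  have e : ∀ x : V d, ∏ i, a i (pt (Fin.cons x w : Fin (n + 1) → V d) i) =
      (a 0 x * a (Fin.last _) (x - alt (List.ofFn w))) * ∏ i : Fin n, a i.succ.castSucc (w i) := by
    intro x
    rw [Fin.prod_univ_castSucc, Fin.prod_univ_succ]
    simp only [pt_castSucc, pt_last, Fin.cons_zero, Fin.cons_succ,
      List.ofFn_succ, alt]
    rw [show (0 : Fin (n + 2)) = Fin.castSucc 0 from rfl]
    ring
  simp only [e]
  rw [lintegral_mul_const _ (f := fun x => a 0 x * a (Fin.last _) (x - alt (List.ofFn w)))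
    ((ha 0).mul ((ha _).comp (measurable_id.sub_const _)))]
  gcongr
  exact lintegral_mul_sub_le _ _ (ha _) (ha _) _

end Bounds

section Forms

variable {d : ℕ}

/-- The integrand of a polynomial with coefficient `f`. -/
def tens {m : ℕ} (f : Wd d) (g : Fin (m + 1) → V d → ℂ) (ξ : Fin m → V d) : ℂ :=
  f (List.ofFn ξ) * ∏ i : Fin (m + 1), cj i (g i (pt ξ i))

/-- The multilinear form with coefficient `f`. -/
def form {m : ℕ} (f : Wd d) (g : Fin (m + 1) → V d → ℂ) : ℂ :=
  Complex.I * ∫ ξ : Fin m → V d, tens f g ξ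

lemma measurable_tens {m : ℕ} {f : Wd d} (hf : MeasW f) {g : Fin (m + 1) → V d → ℂ}
    (hg : ∀ i, Measurable (g i)) : Measurable (tens f g) :=
  (hf m).mul (Finset.measurable_prod _ fun i _ =>
    (measurable_cj i).comp ((hg i).comp (measurable_pt i)))

lemma lintegral_tens_le {n : ℕ} {f : Wd d} {C : ℝ≥0∞}
    (hC : ∀ ξ : Fin (n + 1) → V d, ‖f (List.ofFn ξ)‖ₑ ≤ C) {g : Fin (n + 2) → V d → ℂ}
    (hg : ∀ i, Measurable (g i)) :
    ∫⁻ ξ : Fin (n + 1) → V d, ‖tens f g ξ‖ₑ ≤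
      C * (en2 (fun x => ‖g 0 x‖ₑ) * en2 (fun x => ‖g (Fin.last _) x‖ₑ) *
        ∏ i : Fin n, ∫⁻ x, ‖g i.succ.castSucc x‖ₑ) := by
  have hm : ∀ i, Measurable fun x => ‖g i x‖ₑ := fun i => (hg i).enorm
  calc ∫⁻ ξ : Fin (n + 1) → V d, ‖tens f g ξ‖ₑ
      ≤ ∫⁻ ξ : Fin (n + 1) → V d, C * ∏ i, ‖g i (pt ξ i)‖ₑ := by
        refine lintegral_mono fun ξ => ?_
        rw [tens, enorm_mul]
        refine mul_le_mul' (hC ξ) (le_of_eq ?_)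
        simp only [enorm_eq_nnnorm]
        rw [nnnorm_prod, ENNReal.ofNNReal_finsetProd]
        refine Finset.prod_congr rfl fun i _ => ?_
        congr 1
        exact NNReal.eq (norm_cj _ _)
    _ = C * ∫⁻ ξ : Fin (n + 1) → V d, ∏ i, ‖g i (pt ξ i)‖ₑ :=
        lintegral_const_mul _ (Finset.measurable_prod _ fun i _ => (hm i).comp (measurable_pt i))
    _ ≤ _ := mul_le_mul_right (lintegral_pt_le (fun i x => ‖g i x‖ₑ) hm) C

/-- Rotation of the slots. -/
def rotSlots {α : Type*} {n : ℕ} (g : Fin (n + 1) → α) : Fin (n + 1) → α :=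
  Fin.cons (g (Fin.last n)) (Fin.init g)

lemma tens_rot {n : ℕ} (hn : Even n) (f : Wd d) (g : Fin (n + 2) → V d → ℂ)
    (ξ : Fin (n + 1) → V d) :
    tens (rot f) g ξ = -(starRingEnd ℂ) (tens f (rotSlots g) (rotPt ξ)) := by
  have hodd : ¬Even (n + 1) := Nat.not_even_iff_odd.2 hn.add_one
  have h0 : pt (rotPt ξ) 0 = alt (List.ofFn ξ) := by
    have : pt (rotPt ξ) 0 = rotPt ξ 0 := pt_castSucc (rotPt ξ) 0
    rw [this, rotPt, Fin.cons_zero]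
  have hs : ∀ i : Fin (n + 1), pt (rotPt ξ) i.succ = ξ i := by
    intro i
    refine Fin.lastCases ?_ (fun j => ?_) i
    · rw [Fin.succ_last, pt_last, alt_ofFn_rotPt hn]
    · rw [Fin.succ_castSucc, pt_castSucc, rotPt, Fin.cons_succ]
      rfl
  rw [tens, tens, map_mul, rot, ofFn_rotPt, neg_mul]
  congr 2
  rw [Fin.prod_univ_castSucc, Fin.prod_univ_succ (fun i : Fin (n + 2) =>
    cj i (rotSlots g i (pt (rotPt ξ) i))), map_mul, map_prod, mul_comm]
  congr 1
  · rw [rotSlots, Fin.cons_zero, h0, pt_last]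
    simp only [Fin.val_last, Fin.val_zero, cj_zero]
    rw [cj, if_neg hodd]
  · refine Finset.prod_congr rfl fun i _ => ?_
    rw [rotSlots, Fin.cons_succ, hs, pt_castSucc, Fin.val_succ, cj_succ, Complex.conj_conj]
    rfl

lemma form_rot {n : ℕ} (hn : Even n) (f : Wd d) (g : Fin (n + 2) → V d → ℂ) :
    form (m := n + 1) (rot f) g = (starRingEnd ℂ) (form (m := n + 1) f (rotSlots g)) := by
  have : ∀ ξ : Fin (n + 1) → V d, tens (rot f) g ξ =
      -(starRingEnd ℂ) (tens f (rotSlots g) (rotPt ξ)) := tens_rot hn f g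
  rw [form, form]
  simp only [this]
  rw [integral_neg, _root_.integral_conj, (measurePreserving_rotPt hn).integral_comp
    (measurableEmbedding_rotPt hn) (tens f (rotSlots g)), map_mul, Complex.conj_I]
  ring

lemma form_congr {m : ℕ} {f f' : Wd d} (h : ∀ u, u.length = m → f u = f' u)
    (g : Fin (m + 1) → V d → ℂ) : form f g = form f' g := by
  simp only [form, tens, h _ List.length_ofFn]

lemma Cyc.form {n : ℕ} (hn : Even n) {f : Wd d} (hf : Cyc f) (g : Fin (n + 2) → V d → ℂ) :
    form (m := n + 1) f g = (starRingEnd ℂ) (form (m := n + 1) f (rotSlots g)) := by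
  rw [← form_rot hn]
  exact form_congr (fun u hu => (hf u (by rw [hu]; exact hn.add_one)).symm) g

lemma form_congr_ae {n : ℕ} (hn : Even n) (f : Wd d) {g g' : Fin (n + 2) → V d → ℂ}
    (h : ∀ i, g i =ᵐ[volume] g' i) : form (m := n + 1) f g = form (m := n + 1) f g' := by
  rw [form, form]
  congr 1
  refine integral_congr_ae ?_
  have h1 : ∀ᵐ ξ : Fin (n + 1) → V d, ∀ i, g i (pt ξ i) = g' i (pt ξ i) :=
    Filter.eventually_all.2 fun i => (quasiMeasurePreserving_pt hn i).ae (h i)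
  filter_upwards [h1] with ξ hξ
  simp only [tens, hξ]

lemma prod_cj_exp (lam : V d → ℝ) (m k : ℕ) (ξ : Fin m → V d) :
    ∏ i : Fin m, cj (i + k) (Complex.exp (-Complex.I * lam (ξ i))) =
      cj k (Complex.exp (-Complex.I * altFreq lam (List.ofFn ξ))) := by
  have hconj : ∀ r : ℝ, (starRingEnd ℂ) (Complex.exp (-Complex.I * r)) =
      Complex.exp (-Complex.I * (-r : ℝ)) := by
    intro r
    rw [← Complex.exp_conj, map_mul, map_neg, Complex.conj_I, Complex.conj_ofReal]
    congr 1; push_cast; ring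
  induction m generalizing k with
  | zero => simp [altFreq, cj]
  | succ n ih =>
    rw [Fin.prod_univ_succ, List.ofFn_succ, altFreq]
    have h1 : ∀ i : Fin n, cj ((i.succ : ℕ) + k) (Complex.exp (-Complex.I * lam (ξ i.succ))) =
        cj (i + (k + 1)) (Complex.exp (-Complex.I * lam (ξ i.succ))) := by
      intro i; rw [Fin.val_succ]; congr 1; ring
    simp only [h1]
    rw [ih (k + 1) fun i => ξ i.succ, Fin.val_zero, zero_add, Nat.add_comm k 1, ← cj_cj 1 k]
    have h2 : ∀ k z, cj 1 (cj k z) = cj k (cj 1 z) := by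
      intro k z; rw [cj_cj, cj_cj, add_comm]
    rw [h2, ← cj_mul]
    congr 1
    rw [show cj 1 = starRingEnd ℂ from funext fun z => by simp [cj], hconj, ← Complex.exp_add]
    congr 1; push_cast; ring

lemma tens_linear {m : ℕ} (hm : Odd m) (lam : V d → ℝ) (f : Wd d) (g : Fin (m + 1) → V d → ℂ) :
    tens f (fun i x => Complex.exp (-Complex.I * lam x) * g i x) =
      tens (fun u => Complex.exp (-(Complex.I * wFreq lam u)) * f u) g := by
  funext ξ
  rw [tens, tens]
  simp only [cj_mul]
  rw [Finset.prod_mul_distrib]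
  have h1 : ∏ i : Fin (m + 1), cj i (Complex.exp (-Complex.I * lam (pt ξ i))) =
      Complex.exp (-(Complex.I * wFreq lam (List.ofFn ξ))) := by
    rw [Fin.prod_univ_castSucc]
    simp only [pt_castSucc, pt_last, Fin.val_castSucc, Fin.val_last]
    have := prod_cj_exp lam m 0 ξ
    simp only [add_zero, cj_zero] at this
    rw [this, cj, if_neg (Nat.not_even_iff_odd.2 hm), ← Complex.exp_conj, ← Complex.exp_add, wFreq]
    congr 1
    simp only [map_mul, map_neg, Complex.conj_I, Complex.conj_ofReal]
    push_cast; ring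
  rw [h1]; ring

lemma form_linear {m : ℕ} (hm : Odd m) (lam : V d → ℝ) (f : Wd d) (g : Fin (m + 1) → V d → ℂ) :
    form f (fun i x => Complex.exp (-Complex.I * lam x) * g i x) =
      form (fun u => Complex.exp (-(Complex.I * wFreq lam u)) * f u) g := by
  rw [form, form, tens_linear hm]

end Forms

section LastSlot

variable {d : ℕ}

lemma measurePreserving_snoc_snoc (m : ℕ) : MeasurePreserving
    (fun p : (Fin m → V d) × (V d × V d) =>
      (Fin.snoc (Fin.snoc p.1 p.2.1 : Fin (m + 1) → V d) p.2.2 : Fin (m + 2) → V d)) := by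
  have h1 := (Measure.measurePreserving_swap (μ := (volume : Measure (Fin m → V d)))
    (ν := (volume : Measure (V d × V d))))
  have h2 := (Measure.measurePreserving_swap (μ := (volume : Measure (V d)))
    (ν := (volume : Measure (V d)))).prod (MeasurePreserving.id (volume : Measure (Fin m → V d)))
  have h3 := measurePreserving_prodAssoc (volume : Measure (V d)) (volume : Measure (V d))
    (volume : Measure (Fin m → V d))
  have h4 := (MeasurePreserving.id (volume : Measure (V d))).prod (measurePreserving_snoc (d := d) m)
  have h5 := (measurePreserving_snoc (d := d) (m + 1)).comp (h4.comp (h3.comp (h2.comp h1)))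
  exact h5

lemma integral_triple (φ : V d → ℂ) (hφ : Measurable φ) (a : V d) :
    ∫ p : V d × V d, (starRingEnd ℂ) (φ p.1) * φ p.2 * (starRingEnd ℂ) (φ (a - p.1 + p.2)) =
      (2 * Complex.I)⁻¹ * (starRingEnd ℂ) (quarticField φ a) := by
  have hs : MeasurePreserving (fun p : V d × V d => (p.1, (a - p.1) + p.2)) := by
    refine (MeasurePreserving.id (volume : Measure (V d))).skew_product
      (g := fun x y => a - x + y) ?_ ?_
    · exact (measurable_const.sub measurable_fst).add measurable_snd
    · exact Filter.Eventually.of_forall fun x => (measurePreserving_add_left volume (a - x)).map_eq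
  have hF : Measurable fun p : V d × V d => φ p.1 * φ p.2 * conjF φ (p.1 + p.2 - a) :=
    ((hφ.comp measurable_fst).mul (hφ.comp measurable_snd)).mul
      (Complex.continuous_conj.measurable.comp
        (hφ.comp ((measurable_fst.add measurable_snd).sub_const a)))
  have h1 : ∫ p : V d × V d, φ p.1 * φ p.2 * conjF φ (p.1 + p.2 - a) =
      ∫ p : V d × V d, φ p.1 * φ (a - p.1 + p.2) * conjF φ p.2 := by
    have h2 := integral_map hs.measurable.aemeasurable
      (hs.map_eq.symm ▸ hF.aestronglyMeasurable :
        AEStronglyMeasurable (fun p : V d × V d => φ p.1 * φ p.2 * conjF φ (p.1 + p.2 - a))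
          (Measure.map (fun p : V d × V d => (p.1, (a - p.1) + p.2)) volume))
    rw [hs.map_eq] at h2
    rw [h2]
    refine integral_congr_ae (Filter.Eventually.of_forall fun p => ?_)
    have : p.1 + (a - p.1 + p.2) - a = p.2 := by abel
    simp only [this]
  rw [quarticField, h1, map_mul, ← _root_.integral_conj]
  have hI : (2 * Complex.I) ≠ 0 := by simp
  rw [show (starRingEnd ℂ) (-2 * Complex.I) = 2 * Complex.I by
    rw [map_mul, map_neg, Complex.conj_I, Complex.conj_ofNat]; ring, ← mul_assoc,
    inv_mul_cancel₀ hI, one_mul]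
  refine integral_congr_ae (Filter.Eventually.of_forall fun p => ?_)
  simp only [conjF, map_mul, Complex.conj_conj]
  ring

lemma tens_clTerm {m : ℕ} (hm : Odd m) (h : ℝ) (b : Wd d) (φ : V d → ℂ) (w : Fin m → V d)
    (x y : V d) :
    tens (clTerm h 0 b) (fun _ : Fin (m + 3) => φ)
        (Fin.snoc (Fin.snoc w x : Fin (m + 1) → V d) y : Fin (m + 2) → V d) =
      (2 * Complex.I * h * b (List.ofFn w) * ∏ i : Fin m, cj i (φ (w i))) *
        ((starRingEnd ℂ) (φ x) * φ y * (starRingEnd ℂ) (φ (alt (List.ofFn w) - x + y))) := by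
  have hodd := Nat.not_even_iff_odd.2 hm
  have e1 : List.ofFn (Fin.snoc (Fin.snoc w x : Fin (m + 1) → V d) y : Fin (m + 2) → V d) =
      List.ofFn w ++ [x, y] := by
    rw [List.ofFn_succ_last, List.ofFn_succ_last]
    simp
  have e2 : alt (List.ofFn w ++ [x, y]) = alt (List.ofFn w) - x + y := by
    rw [alt_append, if_neg (by simpa using hodd)]
    simp only [alt]; abel
  rw [tens, e1, clTerm, Fin.prod_univ_castSucc, Fin.prod_univ_castSucc, Fin.prod_univ_castSucc]
  simp only [pt_castSucc, pt_last, Fin.snoc_castSucc, Fin.snoc_last, e1, e2, Fin.val_castSucc,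
    Fin.val_last, List.drop_zero, cj_zero]
  have e3 : (List.ofFn w ++ [x, y]).take ((List.ofFn w ++ [x, y]).length - 2) = List.ofFn w := by
    simp
  have c1 : ∀ z, cj m z = (starRingEnd ℂ) z := fun z => by rw [cj, if_neg hodd]
  rw [e3, cj_succ (m + 1), cj_succ m, cj_succ m, c1, c1, c1, Complex.conj_conj, Complex.conj_conj]
  ring

/-- The last slot of a form, filled with the vector field of `h P`. -/
lemma form_clTerm {n : ℕ} (hn : Even n) (h : ℝ) {b : Wd d} (φ : V d → ℂ) (hφ : Measurable φ)
    (hint : Integrable (tens (m := n + 3) (clTerm h 0 b) fun _ => φ)) :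
    form (m := n + 3) (clTerm h 0 b) (fun _ => φ) =
      form (m := n + 1) b
        (fun i => if i = Fin.last (n + 1) then fun x => h * quarticField φ x else φ) := by
  have hm : Odd (n + 1) := hn.add_one
  have hmp := measurePreserving_snoc_snoc (d := d) (n + 1)
  have hint' : Integrable (fun p : (Fin (n + 1) → V d) × (V d × V d) =>
      tens (m := n + 3) (clTerm h 0 b) (fun _ => φ)
        (Fin.snoc (Fin.snoc p.1 p.2.1 : Fin (n + 2) → V d) p.2.2 : Fin (n + 3) → V d)) :=
    hmp.integrable_comp_of_integrable hint
  have h2 := integral_map hmp.measurable.aemeasurable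
    (hmp.map_eq.symm ▸ hint.aestronglyMeasurable :
      AEStronglyMeasurable (tens (m := n + 3) (clTerm h 0 b) fun _ => φ)
        (Measure.map (fun p : (Fin (n + 1) → V d) × (V d × V d) =>
          (Fin.snoc (Fin.snoc p.1 p.2.1 : Fin (n + 2) → V d) p.2.2 : Fin (n + 3) → V d)) volume))
  rw [hmp.map_eq] at h2
  rw [form, form, h2, Measure.volume_eq_prod, integral_prod _ hint']
  congr 1
  refine integral_congr_ae (Filter.Eventually.of_forall fun w => ?_)
  simp only [tens_clTerm hm]
  rw [integral_const_mul, integral_triple φ hφ, tens, Fin.prod_univ_castSucc (fun i =>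
    cj i ((if i = Fin.last (n + 1) then fun x => (h : ℂ) * quarticField φ x else φ) (pt w i)))]
  simp only [pt_castSucc, pt_last, Fin.val_castSucc, Fin.val_last, if_true,
    Fin.castSucc_ne_last, if_false]
  rw [cj_mul, cj, cj, if_neg (Nat.not_even_iff_odd.2 hm), if_neg (Nat.not_even_iff_odd.2 hm),
    Complex.conj_ofReal]
  field_simp

end LastSlot

section Multilinear

variable {d : ℕ}

/-- Pairs of a function in `L¹` and a function in `L²`. -/
abbrev X (d : ℕ) : Type := L1 d × Lp ℂ 2 (volume : Measure (V d))

/-- The component of a pair that is used in a slot. -/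
def slotFn {m : ℕ} (i : Fin (m + 1)) (x : X d) : V d → ℂ :=
  if i = 0 ∨ i = Fin.last m then ⇑x.2 else ⇑x.1

lemma measurable_slotFn {m : ℕ} (i : Fin (m + 1)) (x : X d) : Measurable (slotFn i x) := by
  unfold slotFn
  split_ifs
  · exact (Lp.stronglyMeasurable x.2).measurable
  · exact (Lp.stronglyMeasurable x.1).measurable

lemma slotFn_add {m : ℕ} (i : Fin (m + 1)) (x y : X d) :
    slotFn i (x + y) =ᵐ[volume] fun ξ => slotFn i x ξ + slotFn i y ξ := by
  unfold slotFn
  split_ifs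
  · exact Lp.coeFn_add x.2 y.2
  · exact Lp.coeFn_add x.1 y.1

lemma slotFn_smul {m : ℕ} (i : Fin (m + 1)) (c : ℝ) (x : X d) :
    slotFn i (c • x) =ᵐ[volume] fun ξ => c • slotFn i x ξ := by
  unfold slotFn
  split_ifs
  · exact Lp.coeFn_smul c x.2
  · exact Lp.coeFn_smul c x.1

lemma en2_enorm (f : Lp ℂ 2 (volume : Measure (V d))) : en2 (fun x => ‖f x‖ₑ) = ‖f‖ₑ := by
  rw [Lp.enorm_def, eLpNorm_eq_lintegral_rpow_enorm_toReal (by norm_num) (by norm_num)]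
  simp [en2]

lemma lintegral_enorm_L1 (f : L1 d) : ∫⁻ x, ‖f x‖ₑ = ‖f‖ₑ := by
  rw [Lp.enorm_def, eLpNorm_one_eq_lintegral_enorm]

lemma lintegral_tens_slots_le {n : ℕ} {f : Wd d} {C : ℝ} (hC : ∀ u, u.length = n + 1 → ‖f u‖ ≤ C)
    (x : Fin (n + 2) → X d) :
    ∫⁻ ξ : Fin (n + 1) → V d, ‖tens f (fun i => slotFn i (x i)) ξ‖ₑ ≤
      ENNReal.ofReal (C * (‖(x 0).2‖ * ‖(x (Fin.last _)).2‖ *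
        ∏ i : Fin n, ‖(x i.succ.castSucc).1‖)) := by
  have hC0 : 0 ≤ C := (norm_nonneg _).trans (hC (List.replicate (n + 1) 0) (by simp))
  refine (lintegral_tens_le (C := ENNReal.ofReal C) (fun ξ => ?_)
    fun i => measurable_slotFn i (x i)).trans (le_of_eq ?_)
  · rw [← ofReal_norm]
    exact ENNReal.ofReal_le_ofReal (hC _ List.length_ofFn)
  · have h1 : ∀ i : Fin n, ∫⁻ y, ‖slotFn i.succ.castSucc (x i.succ.castSucc) y‖ₑ =
        ENNReal.ofReal ‖(x i.succ.castSucc).1‖ := by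
      intro i
      rw [ofReal_norm, ← lintegral_enorm_L1]
      have : ¬(i.succ.castSucc = 0 ∨ i.succ.castSucc = Fin.last (n + 1)) := by
        rintro (h | h)
        · have := congrArg Fin.val h; simp at this
        · exact Fin.castSucc_ne_last _ h
      simp only [slotFn, if_neg this]
    have h2 : en2 (fun y => ‖slotFn (0 : Fin (n + 2)) (x 0) y‖ₑ) = ENNReal.ofReal ‖(x 0).2‖ := by
      rw [ofReal_norm, ← en2_enorm]; simp [slotFn]
    have h3 : en2 (fun y => ‖slotFn (Fin.last (n + 1)) (x (Fin.last _)) y‖ₑ) =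
        ENNReal.ofReal ‖(x (Fin.last _)).2‖ := by
      rw [ofReal_norm, ← en2_enorm]; simp [slotFn]
    rw [h2, h3, Finset.prod_congr rfl fun i _ => h1 i, ENNReal.ofReal_mul hC0,
      ENNReal.ofReal_mul (by positivity), ENNReal.ofReal_mul (by positivity),
      ENNReal.ofReal_prod_of_nonneg fun i _ => norm_nonneg _]

lemma integrable_tens_slots {n : ℕ} {f : Wd d} (hf : MeasW f) {C : ℝ}
    (hC : ∀ u, u.length = n + 1 → ‖f u‖ ≤ C) (x : Fin (n + 2) → X d) :
    Integrable (tens (m := n + 1) f (fun i => slotFn i (x i))) :=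
  ⟨(measurable_tens hf fun i => measurable_slotFn i (x i)).aestronglyMeasurable,
    (lintegral_tens_slots_le hC x).trans_lt ENNReal.ofReal_lt_top⟩

lemma norm_form_le {n : ℕ} {f : Wd d} {C : ℝ} (hC : ∀ u, u.length = n + 1 → ‖f u‖ ≤ C)
    (x : Fin (n + 2) → X d) :
    ‖form (m := n + 1) f (fun i => slotFn i (x i))‖ ≤
      C * (‖(x 0).2‖ * ‖(x (Fin.last _)).2‖ * ∏ i : Fin n, ‖(x i.succ.castSucc).1‖) := by
  have hC0 : 0 ≤ C := (norm_nonneg _).trans (hC (List.replicate (n + 1) 0) (by simp))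
  rw [form, norm_mul, Complex.norm_I, one_mul]
  refine (norm_integral_le_lintegral_norm _).trans ?_
  refine ENNReal.toReal_le_of_le_ofReal (by positivity) ?_
  simp only [ofReal_norm]
  exact lintegral_tens_slots_le hC x

lemma norm_form_le_prod {n : ℕ} {f : Wd d} {C : ℝ} (hC : ∀ u, u.length = n + 1 → ‖f u‖ ≤ C)
    (x : Fin (n + 2) → X d) :
    ‖form (m := n + 1) f (fun i => slotFn i (x i))‖ ≤ C * ∏ i, ‖x i‖ := by
  have hC0 : 0 ≤ C := (norm_nonneg _).trans (hC (List.replicate (n + 1) 0) (by simp))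
  refine (norm_form_le hC x).trans (mul_le_mul_of_nonneg_left ?_ hC0)
  rw [Fin.prod_univ_castSucc, Fin.prod_univ_succ]
  have h1 : ‖(x 0).2‖ ≤ ‖x (Fin.castSucc 0)‖ := norm_snd_le (x 0)
  have h2 : ‖(x (Fin.last _)).2‖ ≤ ‖x (Fin.last _)‖ := norm_snd_le _
  have h3 : ∏ i : Fin n, ‖(x i.succ.castSucc).1‖ ≤ ∏ i : Fin n, ‖x i.succ.castSucc‖ :=
    Finset.prod_le_prod (fun _ _ => norm_nonneg _) fun i _ => norm_fst_le _
  calc ‖(x 0).2‖ * ‖(x (Fin.last _)).2‖ * ∏ i : Fin n, ‖(x i.succ.castSucc).1‖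
      ≤ ‖x (Fin.castSucc 0)‖ * ‖x (Fin.last _)‖ * ∏ i : Fin n, ‖x i.succ.castSucc‖ := by gcongr
    _ = _ := by ring

lemma form_add {n : ℕ} {f f' : Wd d} (hf : MeasW f) (hf' : MeasW f') {C C' : ℝ}
    (hC : ∀ u, u.length = n + 1 → ‖f u‖ ≤ C) (hC' : ∀ u, u.length = n + 1 → ‖f' u‖ ≤ C')
    (x : Fin (n + 2) → X d) :
    form (m := n + 1) (fun u => f u + f' u) (fun i => slotFn i (x i)) =
      form (m := n + 1) f (fun i => slotFn i (x i)) +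
        form (m := n + 1) f' (fun i => slotFn i (x i)) := by
  rw [form, form, form, ← mul_add, ← integral_add (integrable_tens_slots hf hC x)
    (integrable_tens_slots hf' hC' x)]
  simp only [tens, add_mul]

lemma form_mul_left {m : ℕ} (c : ℂ) (f : Wd d) (g : Fin (m + 1) → V d → ℂ) :
    form (fun u => c * f u) g = c * form f g := by
  rw [form, form]
  simp only [tens, mul_assoc]
  rw [integral_const_mul]; ring

/-- The polynomials of degree `2 l + 2`, as multilinear functions of the state. -/
def QL (l : ℕ) (x : Fin (2 * l + 2) → X d) : wordSpace d →L[ℝ] ℂ :=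
  LinearMap.mkContinuous
    { toFun := fun b => form (m := 2 * l + 1) (wv b) (fun i => slotFn i (x i))
      map_add' := fun b b' => (form_congr (fun u _ => wv_add b b' u) _).trans
        (form_add (measW_wv b) (measW_wv b') (fun u _ => norm_wv_le b u)
          (fun u _ => norm_wv_le b' u) x)
      map_smul' := fun c b => by
        rw [RingHom.id_apply, Complex.real_smul, ← form_mul_left]
        exact form_congr (fun u _ => wv_smul c b u) _ }
    (∏ i, ‖x i‖) fun b =>
      (norm_form_le_prod (fun u _ => norm_wv_le b u) x).trans (le_of_eq (mul_comm _ _))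

lemma QL_apply (l : ℕ) (x : Fin (2 * l + 2) → X d) (b : wordSpace d) :
    QL l x b = form (m := 2 * l + 1) (wv b) (fun i => slotFn i (x i)) := rfl

lemma tens_update {n : ℕ} (f : Wd d) (x : Fin (n + 2) → X d) (i : Fin (n + 2)) (w : X d)
    (ξ : Fin (n + 1) → V d) :
    tens f (fun j => slotFn j (Function.update x i w j)) ξ = f (List.ofFn ξ) *
      MultilinearMap.mkPiAlgebra ℝ (Fin (n + 2)) ℂ
        (Function.update (fun j : Fin (n + 2) => cj j (slotFn j (x j) (pt ξ j))) i
          (cj i (slotFn i w (pt ξ i)))) := by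
  rw [tens, MultilinearMap.mkPiAlgebra_apply]
  congr 1
  refine Finset.prod_congr rfl fun j _ => ?_
  by_cases h : j = i
  · subst h; simp
  · simp [h]

/-- `QL` as a continuous multilinear map. -/
def QM (l : ℕ) :
    ContinuousMultilinearMap ℝ (fun _ : Fin (2 * l + 2) => X d) (wordSpace d →L[ℝ] ℂ) :=
  MultilinearMap.mkContinuous
    { toFun := QL l
      map_update_add' := by
        intro inst x i y z
        obtain rfl := Subsingleton.elim inst (instDecidableEqFin _)
        ext b
        rw [add_apply, QL_apply, QL_apply, QL_apply, form, form, form, ← mul_add, ← integral_add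
          (integrable_tens_slots (measW_wv b) (fun u _ => norm_wv_le b u) _)
          (integrable_tens_slots (measW_wv b) (fun u _ => norm_wv_le b u) _)]
        congr 1
        refine integral_congr_ae ?_
        filter_upwards [(quasiMeasurePreserving_pt (even_two_mul l) i).ae (slotFn_add i y z)]
          with ξ hξ
        rw [tens_update, tens_update, tens_update, hξ, cj_add, MultilinearMap.map_update_add,
          mul_add]
      map_update_smul' := by
        intro inst x i c y
        obtain rfl := Subsingleton.elim inst (instDecidableEqFin _)
        ext b
        rw [smul_apply, QL_apply, QL_apply, form, form, ← mul_smul_comm, ← integral_smul]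
        congr 1
        refine integral_congr_ae ?_
        filter_upwards [(quasiMeasurePreserving_pt (even_two_mul l) i).ae (slotFn_smul i c y)]
          with ξ hξ
        rw [tens_update, tens_update, hξ, Complex.real_smul, cj_ofReal_mul, ← Complex.real_smul,
          MultilinearMap.map_update_smul, mul_smul_comm] }
    1 fun x => by
      rw [one_mul]
      refine ContinuousLinearMap.opNorm_le_bound _ (by positivity) fun b => ?_
      exact (norm_form_le_prod (fun u _ => norm_wv_le b u) x).trans (le_of_eq (mul_comm _ _))

lemma QM_apply (l : ℕ) (x : Fin (2 * l + 2) → X d) (b : wordSpace d) :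
    QM l x b = form (m := 2 * l + 1) (wv b) (fun i => slotFn i (x i)) := rfl

/-- Equality almost everywhere of the two components. -/
def Cons (x : X d) : Prop := (x.2 : V d → ℂ) =ᵐ[volume] (x.1 : V d → ℂ)

lemma Cons.slotFn {m : ℕ} (i : Fin (m + 1)) {x : X d} (hx : Cons x) :
    slotFn i x =ᵐ[volume] (x.1 : V d → ℂ) := by
  unfold NLSSplitting.slotFn
  split_ifs
  · exact hx
  · rfl

lemma form_slots_const {n : ℕ} (hn : Even n) (f : Wd d) {x : X d} (hx : Cons x) :
    form (m := n + 1) f (fun i => slotFn i x) = form (m := n + 1) f (fun _ => ⇑x.1) :=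
  form_congr_ae hn f fun i => hx.slotFn i

end Multilinear

section Derivative

variable {d : ℕ}

/-- The function `v` in one slot, the function `φ` in all others. -/
def oneSlot {n : ℕ} (φ v : V d → ℂ) (i : Fin (n + 1)) : Fin (n + 1) → V d → ℂ :=
  fun j => if j = i then v else φ

lemma rotSlots_oneSlot {n : ℕ} (φ v : V d → ℂ) (i : Fin n) :
    rotSlots (oneSlot φ v i.castSucc) = oneSlot φ v i.succ := by
  funext j
  refine Fin.cases ?_ (fun k => ?_) j
  · rw [rotSlots, Fin.cons_zero, oneSlot, oneSlot, if_neg (Fin.castSucc_ne_last i).symm,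
      if_neg (Fin.succ_ne_zero i).symm]
  · rw [rotSlots, Fin.cons_succ]
    simp only [Fin.init, oneSlot, Fin.castSucc_inj, Fin.succ_inj]

lemma re_form_oneSlot {n : ℕ} (hn : Even n) {f : Wd d} (hf : Cyc f) (φ v : V d → ℂ)
    (i : Fin (n + 2)) : (form (m := n + 1) f (oneSlot φ v i)).re =
      (form (m := n + 1) f (oneSlot φ v (Fin.last _))).re := by
  induction i using Fin.reverseInduction with
  | last => rfl
  | cast i ih => rw [← ih, hf.form hn, rotSlots_oneSlot, Complex.conj_re]

lemma im_form_const {n : ℕ} (hn : Even n) {f : Wd d} (hf : Cyc f) (φ : V d → ℂ) :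
    (form (m := n + 1) f (fun _ => φ)).im = 0 := by
  have h : rotSlots (fun _ : Fin (n + 2) => φ) = fun _ => φ := by
    funext j
    refine Fin.cases ?_ (fun k => ?_) j <;> simp [rotSlots, Fin.init]
  have := congrArg Complex.im (hf.form hn (fun _ => φ))
  rw [h, Complex.conj_im] at this
  linarith

lemma sum_update_re {l : ℕ} {b : wordSpace d} (hb : Cyc (wv b)) {x v : X d} (hx : Cons x)
    (hv : Cons v) :
    ∑ i, (QM l (Function.update (fun _ => x) i v) b).re =
      (2 * l + 2) * (form (m := 2 * l + 1) (wv b) (oneSlot x.1 v.1 (Fin.last _))).re := by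
  have h1 : ∀ i, (QM l (Function.update (fun _ => x) i v) b).re =
      (form (m := 2 * l + 1) (wv b) (oneSlot x.1 v.1 (Fin.last _))).re := by
    intro i
    rw [← re_form_oneSlot (even_two_mul l) hb _ _ i, QM_apply]
    congr 1
    refine form_congr_ae (even_two_mul l) _ fun j => ?_
    by_cases h : j = i
    · subst h
      rw [Function.update_self, oneSlot, if_pos rfl]
      exact hv.slotFn j
    · rw [Function.update_of_ne h, oneSlot, if_neg h]
      exact hx.slotFn j
  rw [Finset.sum_congr rfl fun i _ => h1 i, Finset.sum_const, Finset.card_univ, Fintype.card_fin,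
    nsmul_eq_mul]
  push_cast; ring

end Derivative

section BracketForms

variable {d : ℕ}

lemma mList_trip (n j : ℕ) : ∃ k, MList k fun ξ : Fin n → V d => trip j (List.ofFn ξ) := by
  have h := mList_ofFn (d := d) n
  exact ⟨_, (h.take j).append (MList.cons (measW_alt.comp ((h.drop j).take 3)) ((h.drop j).drop 3))⟩

lemma MeasW.trTerm {b : Wd d} (hb : MeasW b) (h : ℝ) (j : ℕ) : MeasW (trTerm h j b) := fun n => by
  obtain ⟨k, hk⟩ := mList_trip (d := d) n j
  exact (hb.comp hk).const_mul _

lemma MeasW.clTerm {b : Wd d} (hb : MeasW b) (h : ℝ) (i : ℕ) : MeasW (clTerm h i b) := fun n => by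
  refine Measurable.const_mul ((measurable_cj i).comp ?_) _
  simp only [List.length_ofFn]
  exact hb.comp (((mList_ofFn (d := d) n).drop i).take (n - 2))

lemma norm_trTerm_le {h C : ℝ} {b : Wd d} {n : ℕ} (hb : ∀ q, q.length = n + 1 → ‖b q‖ ≤ C) {j : ℕ}
    (hj : j < n + 1) {u : List (V d)} (hu : u.length = n + 3) :
    ‖trTerm h j b u‖ ≤ 2 * |h| * C := by
  have hl := length_trip (j := j) (u := u) (by omega)
  rw [trTerm, norm_mul, norm_cj, norm_neg]
  have := hb (trip j u) (by omega)
  simp only [norm_mul, Complex.norm_I, Complex.norm_real, Real.norm_eq_abs, Complex.norm_ofNat,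
    mul_one]
  gcongr

lemma norm_clTerm_le {h C : ℝ} {b : Wd d} {n : ℕ} (hb : ∀ q, q.length = n + 1 → ‖b q‖ ≤ C) {i : ℕ}
    (hi : i < 3) {u : List (V d)} (hu : u.length = n + 3) :
    ‖clTerm h i b u‖ ≤ 2 * |h| * C := by
  rw [clTerm, norm_mul, norm_cj]
  have := hb ((u.drop i).take (u.length - 2)) (by
    rw [List.length_take, List.length_drop]; omega)
  simp only [norm_mul, Complex.norm_I, Complex.norm_real, Real.norm_eq_abs, Complex.norm_ofNat,
    mul_one]
  gcongr

lemma re_form_of_rot {n : ℕ} (hn : Even n) {f f' : Wd d} (φ : V d → ℂ)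
    (h : ∀ u, u.length = n + 1 → rot f u = f' u) :
    (form (m := n + 1) f' (fun _ => φ)).re = (form (m := n + 1) f (fun _ => φ)).re := by
  have h1 : rotSlots (fun _ : Fin (n + 2) => φ) = fun _ => φ := by
    funext j
    refine Fin.cases ?_ (fun k => ?_) j <;> simp [rotSlots, Fin.init]
  rw [← form_congr h, form_rot hn, h1, Complex.conj_re]

lemma form_sum {n : ℕ} {ι : Type*} (s : Finset ι) {f : ι → Wd d} (hf : ∀ i ∈ s, MeasW (f i)) {C : ℝ}
    (hC : ∀ i ∈ s, ∀ u, u.length = n + 1 → ‖f i u‖ ≤ C) (x : Fin (n + 2) → X d) :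
    form (m := n + 1) (fun u => ∑ i ∈ s, f i u) (fun i => slotFn i (x i)) =
      ∑ i ∈ s, form (m := n + 1) (f i) (fun i => slotFn i (x i)) := by
  simp only [form]
  rw [← Finset.mul_sum, ← integral_finsetSum _ fun i hi =>
    integrable_tens_slots (hf i hi) (hC i hi) x]
  simp only [tens, Finset.sum_mul]

/-- The form of a bracket with `h P` in terms of the vector field of `h P` in the last slot. -/
lemma re_form_br_pw {n : ℕ} (hn : Even n) (h : ℝ) {b : Wd d} (hm : MeasW b) (hb : Cyc b) {C : ℝ}
    (hC : ∀ q, q.length = n + 1 → ‖b q‖ ≤ C) {x : X d} (hx : Cons x) :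
    (form (m := n + 3) (br (pw h) b) (fun i => slotFn i x)).re =
      (n + 4) * (h * (form (m := n + 1) b
        (oneSlot x.1 (quarticField x.1) (Fin.last _))).re) := by
  have hn2 : Even (n + 2) := hn.add even_two
  have hodd : ∀ u : List (V d), u.length = n + 3 → Odd u.length := fun u hu => by
    rw [hu]; exact hn2.add_one
  set φ : V d → ℂ := ⇑x.1 with hφ
  have e1 : form (m := n + 3) (br (pw h) b) (fun i => slotFn i x) =
      ∑ j ∈ Finset.range (n + 1), form (m := n + 3) (trTerm h j b) (fun i => slotFn i x) +
        ∑ i ∈ Finset.range 3, form (m := n + 3) (clTerm h i b) (fun i => slotFn i x) := by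
    have a1 : ∀ j ∈ Finset.range (n + 1), ∀ u : List (V d), u.length = n + 2 + 1 →
        ‖trTerm h j b u‖ ≤ 2 * |h| * C := fun j hj u hu =>
      norm_trTerm_le hC (Finset.mem_range.1 hj) hu
    have a2 : ∀ i ∈ Finset.range 3, ∀ u : List (V d), u.length = n + 2 + 1 →
        ‖clTerm h i b u‖ ≤ 2 * |h| * C := fun j hj u hu =>
      norm_clTerm_le hC (Finset.mem_range.1 hj) hu
    rw [← form_sum (n := n + 2) _ (fun j _ => hm.trTerm h j) a1 (fun _ => x),
      ← form_sum (n := n + 2) _ (fun j _ => hm.clTerm h j) a2 (fun _ => x),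
      ← form_add (n := n + 2) (C := ∑ j ∈ Finset.range (n + 1), 2 * |h| * C)
        (C' := ∑ j ∈ Finset.range 3, 2 * |h| * C)]
    · exact form_congr (fun u hu => by rw [br_pw h b (hodd u hu) (by omega), hu]; rfl) _
    · exact fun k => Finset.measurable_sum _ fun j _ => hm.trTerm h j k
    · exact fun k => Finset.measurable_sum _ fun j _ => hm.clTerm h j k
    · exact fun u hu => norm_sum_le_of_le _ fun j hj => a1 j hj u hu
    · exact fun u hu => norm_sum_le_of_le _ fun j hj => a2 j hj u hu
  have e2 : ∀ f : Wd d, form (m := n + 3) f (fun i => slotFn i x) =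
      form (m := n + 3) f (fun _ => φ) := fun f => form_slots_const hn2 f hx
  set c : ℝ := (form (m := n + 3) (clTerm h 0 b) (fun _ => φ)).re with hc
  have t0 : (form (m := n + 3) (trTerm h n b) (fun _ => φ)).re = c :=
    re_form_of_rot hn2 φ fun u hu => by
      rw [rot_clTerm_zero hb (hodd u hu) (by omega), hu]; rfl
  have t1 : ∀ j, j ≤ n → (form (m := n + 3) (trTerm h (n - j) b) (fun _ => φ)).re = c := by
    intro j hj
    induction j with
    | zero => exact t0
    | succ j ih =>
      rw [← ih (by omega)]
      refine re_form_of_rot hn2 φ fun u hu => ?_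
      rw [show n - j = (n - (j + 1)) + 1 by omega]
      exact rot_trTerm_succ hb (hodd u hu) (by omega)
  have t2 : (form (m := n + 3) (clTerm h 2 b) (fun _ => φ)).re = c := by
    rw [← t1 n le_rfl, Nat.sub_self]
    exact re_form_of_rot hn2 φ fun u hu => rot_trTerm_zero hb (hodd u hu) (by omega)
  have t3 : (form (m := n + 3) (clTerm h 1 b) (fun _ => φ)).re = c := by
    rw [← t2]
    exact re_form_of_rot hn2 φ fun u hu => rot_clTerm_two (by omega)
  have hint : Integrable (tens (m := n + 3) (clTerm h 0 b) fun _ => φ) := by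
    refine (integrable_tens_slots (n := n + 2) (hm.clTerm h 0)
      (fun u hu => norm_clTerm_le hC (by norm_num) hu) (fun _ => x)).congr ?_
    have h1 : ∀ᵐ ξ : Fin (n + 2 + 1) → V d, ∀ i : Fin (n + 2 + 2), slotFn i x (pt ξ i) =
        φ (pt ξ i) :=
      Filter.eventually_all.2 fun i => (quasiMeasurePreserving_pt hn2 i).ae (hx.slotFn i)
    filter_upwards [h1] with ξ hξ
    simp only [tens, hξ]
  have e3 := form_clTerm hn h φ (Lp.stronglyMeasurable x.1).measurable hint
  have e4 : form (m := n + 1) b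
      (fun i => if i = Fin.last (n + 1) then fun x => h * quarticField φ x else φ) =
      h * form (m := n + 1) b (oneSlot φ (quarticField φ) (Fin.last _)) := by
    rw [form, form, mul_left_comm, ← integral_const_mul (h : ℂ)]
    congr 1
    refine integral_congr_ae (Filter.Eventually.of_forall fun ξ => ?_)
    simp only [tens]
    rw [Fin.prod_univ_castSucc, Fin.prod_univ_castSucc (fun i : Fin (n + 2) =>
      cj i (oneSlot φ (quarticField φ) (Fin.last (n + 1)) i (pt ξ i)))]
    simp only [oneSlot, if_true, Fin.castSucc_ne_last, if_false, cj_ofReal_mul]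
    ring
  have e5 : c = h * (form (m := n + 1) b (oneSlot φ (quarticField φ) (Fin.last _))).re := by
    rw [hc, e3, e4, Complex.re_ofReal_mul]
  rw [e1, Complex.add_re, Complex.re_sum, Complex.re_sum, ← e5]
  simp only [e2]
  rw [Finset.sum_congr rfl (g := fun _ => c), Finset.sum_const, Finset.card_range, nsmul_eq_mul]
  · simp only [Finset.sum_range_succ, Finset.sum_range_zero, ← hc, t2, t3]
    push_cast; ring
  · intro j hj
    have := Finset.mem_range.1 hj
    rw [← t1 (n - j) (by omega)]
    congr 4; omega

end BracketForms

section Correlation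

variable {d : ℕ}

lemma lintegral_corr (a b : V d → ℝ≥0∞) (ha : Measurable a) (hb : Measurable b) :
    ∫⁻ ξ, ∫⁻ y, a y * b (ξ + y) = (∫⁻ y, a y) * ∫⁻ y, b y := by
  rw [lintegral_lintegral_swap]
  · rw [← lintegral_mul_const _ ha]
    refine lintegral_congr fun y => ?_
    rw [lintegral_const_mul (a y) (f := fun x => b (x + y)) (hb.comp (measurable_id.add_const y)),
      lintegral_add_right_eq_self b y]
  · exact ((ha.comp measurable_snd).mul (hb.comp (measurable_fst.add measurable_snd))).aemeasurable

lemma lintegral_corr_sq_le (a b : V d → ℝ≥0∞) (ha : Measurable a) (hb : Measurable b) :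
    ∫⁻ ξ, (∫⁻ y, a y * b (ξ + y)) ^ (2 : ℝ) ≤ (∫⁻ y, a y) ^ (2 : ℝ) * ∫⁻ y, b y ^ (2 : ℝ) := by
  have hb2 : Measurable fun y => b y ^ (2 : ℝ) := hb.pow_const 2
  have key : ∀ ξ, (∫⁻ y, a y * b (ξ + y)) ^ (2 : ℝ) ≤
      (∫⁻ y, a y) * ∫⁻ y, a y * b (ξ + y) ^ (2 : ℝ) := by
    intro ξ
    have hbξ : Measurable fun y => b (ξ + y) := hb.comp (measurable_const.add measurable_id)
    have h := ENNReal.lintegral_mul_le_Lp_mul_Lq volume Real.HolderConjugate.two_two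
      (f := fun y => a y ^ (1 / 2 : ℝ)) (g := fun y => a y ^ (1 / 2 : ℝ) * b (ξ + y))
      (ha.pow_const _).aemeasurable ((ha.pow_const _).mul hbξ).aemeasurable
    have e1 : ∀ y, a y ^ (1 / 2 : ℝ) * a y ^ (1 / 2 : ℝ) = a y := by
      intro y
      rw [← ENNReal.rpow_add_of_nonneg _ _ (by norm_num) (by norm_num)]
      norm_num
    have e2 : ∀ y, (a y ^ (1 / 2 : ℝ)) ^ (2 : ℝ) = a y := by
      intro y; rw [← ENNReal.rpow_mul]; norm_num
    simp only [Pi.mul_apply, ← mul_assoc, e1,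
      ENNReal.mul_rpow_of_nonneg _ _ (by norm_num : (0 : ℝ) ≤ 2), e2] at h
    calc (∫⁻ y, a y * b (ξ + y)) ^ (2 : ℝ) ≤ ((∫⁻ y, a y) ^ (1 / 2 : ℝ) *
          (∫⁻ y, a y * b (ξ + y) ^ (2 : ℝ)) ^ (1 / 2 : ℝ)) ^ (2 : ℝ) :=
          ENNReal.rpow_le_rpow h (by norm_num)
      _ = _ := by
          rw [ENNReal.mul_rpow_of_nonneg _ _ (by norm_num : (0 : ℝ) ≤ 2), ← ENNReal.rpow_mul,
            ← ENNReal.rpow_mul]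
          norm_num
  have hm : Measurable fun ξ => ∫⁻ y, a y * b (ξ + y) ^ (2 : ℝ) :=
    Measurable.lintegral_prod_right' (f := fun p : V d × V d => a p.2 * b (p.1 + p.2) ^ (2 : ℝ))
      ((ha.comp measurable_snd).mul (hb2.comp (measurable_fst.add measurable_snd)))
  calc ∫⁻ ξ, (∫⁻ y, a y * b (ξ + y)) ^ (2 : ℝ)
      ≤ ∫⁻ ξ, (∫⁻ y, a y) * ∫⁻ y, a y * b (ξ + y) ^ (2 : ℝ) := lintegral_mono key
    _ = (∫⁻ y, a y) * ((∫⁻ y, a y) * ∫⁻ y, b y ^ (2 : ℝ)) := by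
        rw [lintegral_const_mul _ hm, lintegral_corr a (fun y => b y ^ (2 : ℝ)) ha hb2]
    _ = _ := by
        rw [← mul_assoc, ENNReal.rpow_two, sq]

lemma eLpNorm_corr_le {p : ℝ≥0∞} (hp : p = 1 ∨ p = 2) (a b : V d → ℝ≥0∞) (ha : Measurable a)
    (hb : Measurable b) :
    eLpNorm (fun ξ => ∫⁻ y, a y * b (ξ + y)) p volume ≤ (∫⁻ y, a y) * eLpNorm b p volume := by
  rcases hp with rfl | rfl
  · rw [eLpNorm_one_eq_lintegral_enorm, eLpNorm_one_eq_lintegral_enorm]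
    exact (lintegral_corr a b ha hb).le
  · rw [eLpNorm_eq_lintegral_rpow_enorm_toReal (by norm_num) (by norm_num),
      eLpNorm_eq_lintegral_rpow_enorm_toReal (by norm_num) (by norm_num)]
    simp only [ENNReal.toReal_ofNat, enorm_eq_self]
    refine (ENNReal.rpow_le_rpow (lintegral_corr_sq_le a b ha hb) (by norm_num)).trans (le_of_eq ?_)
    rw [ENNReal.mul_rpow_of_nonneg _ _ (by norm_num), ← ENNReal.rpow_mul]
    norm_num

/-- The correlation of two functions. -/
def corr (k f : V d → ℂ) (ξ : V d) : ℂ := ∫ y, k y * f (ξ + y)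

lemma corr_congr {k k' f f' : V d → ℂ} (hk : k =ᵐ[volume] k') (hf : f =ᵐ[volume] f') (ξ : V d) :
    corr k f ξ = corr k' f' ξ := by
  refine integral_congr_ae ?_
  filter_upwards [hk, (measurePreserving_add_left volume ξ).quasiMeasurePreserving.ae hf]
    with y h1 h2
  simp only [h1, h2]

lemma enorm_corr_le (k f : V d → ℂ) (ξ : V d) :
    ‖corr k f ξ‖ₑ ≤ ∫⁻ y, ‖k y‖ₑ * ‖f (ξ + y)‖ₑ := by
  refine (enorm_integral_le_lintegral_enorm _).trans (le_of_eq ?_)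
  simp only [enorm_mul]

lemma stronglyMeasurable_corr {k f : V d → ℂ} (hk : Measurable k) (hf : Measurable f) :
    StronglyMeasurable (corr k f) :=
  StronglyMeasurable.integral_prod_right'
    (f := fun p : V d × V d => k p.2 * f (p.1 + p.2))
    ((hk.comp measurable_snd).mul (hf.comp (measurable_fst.add measurable_snd))).stronglyMeasurable

variable {p : ℝ≥0∞} [hp1 : Fact (1 ≤ p)]

lemma memLp_corr (hp : p = 1 ∨ p = 2) (k : L1 d) (f : Lp ℂ p (volume : Measure (V d))) :
    MemLp (corr k f) p volume ∧ eLpNorm (corr k f) p volume ≤ ‖k‖ₑ * ‖f‖ₑ := by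
  have hk := (Lp.stronglyMeasurable k).measurable
  have hf := (Lp.stronglyMeasurable f).measurable
  have h1 : eLpNorm (corr k f) p volume ≤ ‖k‖ₑ * ‖f‖ₑ := by
    refine (eLpNorm_mono_enorm fun ξ => (?_ : _ ≤ ‖∫⁻ y, ‖k y‖ₑ * ‖f (ξ + y)‖ₑ‖ₑ)).trans
      ((eLpNorm_corr_le hp _ _ hk.enorm hf.enorm).trans (le_of_eq ?_))
    · exact enorm_corr_le _ _ ξ
    · rw [lintegral_enorm_L1, Lp.enorm_def f, eLpNorm_enorm]
  exact ⟨⟨(stronglyMeasurable_corr hk hf).aestronglyMeasurable,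
    h1.trans_lt (ENNReal.mul_lt_top enorm_lt_top enorm_lt_top)⟩, h1⟩

lemma ae_lt_top_of_eLpNorm {g : V d → ℝ≥0∞} (hp : p = 1 ∨ p = 2) (hg : Measurable g)
    (h : eLpNorm g p volume < ⊤) : ∀ᵐ ξ, g ξ < ⊤ := by
  rcases hp with rfl | rfl
  · rw [eLpNorm_one_eq_lintegral_enorm] at h
    exact ae_lt_top hg h.ne
  · rw [eLpNorm_eq_lintegral_rpow_enorm_toReal (by norm_num) (by norm_num)] at h
    simp only [ENNReal.toReal_ofNat, enorm_eq_self] at h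
    have h2 : ∫⁻ x, g x ^ (2 : ℝ) ≠ ⊤ := by
      intro hc
      rw [hc] at h
      norm_num at h
    filter_upwards [ae_lt_top (hg.pow_const 2) h2] with ξ hξ
    by_contra hc
    rw [not_lt, top_le_iff] at hc
    rw [hc] at hξ
    norm_num at hξ

lemma ae_integrable_corr (hp : p = 1 ∨ p = 2) (k : L1 d) (f : Lp ℂ p (volume : Measure (V d))) :
    ∀ᵐ ξ, Integrable fun y => k y * f (ξ + y) := by
  have hk := (Lp.stronglyMeasurable k).measurable
  have hf := (Lp.stronglyMeasurable f).measurable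
  have hm : Measurable fun ξ => ∫⁻ y, ‖k y‖ₑ * ‖f (ξ + y)‖ₑ :=
    Measurable.lintegral_prod_right' (f := fun p : V d × V d => ‖k p.2‖ₑ * ‖f (p.1 + p.2)‖ₑ)
      ((hk.enorm.comp measurable_snd).mul (hf.enorm.comp (measurable_fst.add measurable_snd)))
  have h1 := ae_lt_top_of_eLpNorm hp hm
    ((eLpNorm_corr_le hp (fun y => ‖k y‖ₑ) (fun y => ‖f y‖ₑ) hk.enorm hf.enorm).trans_lt (by
      rw [lintegral_enorm_L1, eLpNorm_enorm, ← Lp.enorm_def f]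
      exact ENNReal.mul_lt_top enorm_lt_top enorm_lt_top))
  filter_upwards [h1] with ξ hξ
  refine ⟨(hk.mul (hf.comp (measurable_const.add measurable_id))).aestronglyMeasurable, ?_⟩
  rw [hasFiniteIntegral_iff_enorm]
  simpa only [enorm_mul] using hξ

/-- Correlation as a bilinear map. -/
def corrL (hp : p = 1 ∨ p = 2) :
    L1 d →L[ℝ] Lp ℂ p (volume : Measure (V d)) →L[ℝ] Lp ℂ p (volume : Measure (V d)) :=
  LinearMap.mkContinuous₂
    (LinearMap.mk₂ ℝ (fun k f => (memLp_corr hp k f).1.toLp)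
      (fun k k' f => by
        rw [← MemLp.toLp_add]
        refine MemLp.toLp_congr _ _ ?_
        filter_upwards [ae_integrable_corr hp k f, ae_integrable_corr hp k' f] with ξ h1 h2
        rw [corr_congr (Lp.coeFn_add k k') (Filter.EventuallyEq.refl _ f), Pi.add_apply, corr,
          corr, corr, ← integral_add h1 h2]
        simp only [Pi.add_apply, add_mul])
      (fun c k f => by
        rw [← MemLp.toLp_const_smul]
        refine MemLp.toLp_congr _ _ (Filter.Eventually.of_forall fun ξ => ?_)
        rw [corr_congr (Lp.coeFn_smul c k) (Filter.EventuallyEq.refl _ f), Pi.smul_apply, corr,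
          corr, ← integral_smul]
        simp only [Pi.smul_apply, smul_mul_assoc])
      (fun k f f' => by
        rw [← MemLp.toLp_add]
        refine MemLp.toLp_congr _ _ ?_
        filter_upwards [ae_integrable_corr hp k f, ae_integrable_corr hp k f'] with ξ h1 h2
        rw [corr_congr (Filter.EventuallyEq.refl _ k) (Lp.coeFn_add f f'), Pi.add_apply, corr,
          corr, corr, ← integral_add h1 h2]
        simp only [Pi.add_apply, mul_add])
      (fun c k f => by
        rw [← MemLp.toLp_const_smul]
        refine MemLp.toLp_congr _ _ (Filter.Eventually.of_forall fun ξ => ?_)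
        rw [corr_congr (Filter.EventuallyEq.refl _ k) (Lp.coeFn_smul c f), Pi.smul_apply, corr,
          corr, ← integral_smul]
        simp only [Pi.smul_apply, mul_smul_comm]))
    1
    (fun k f => by
      rw [one_mul, LinearMap.mk₂_apply, Lp.norm_toLp]
      refine ENNReal.toReal_le_of_le_ofReal (by positivity) ((memLp_corr hp k f).2.trans ?_)
      rw [ENNReal.ofReal_mul (norm_nonneg _), ofReal_norm, ofReal_norm])

lemma coeFn_corrL (hp : p = 1 ∨ p = 2) (k : L1 d) (f : Lp ℂ p (volume : Measure (V d))) :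
    corrL hp k f =ᵐ[volume] corr k f := MemLp.coeFn_toLp (memLp_corr hp k f).1

lemma norm_corrL_le (hp : p = 1 ∨ p = 2) (k : L1 d) (f : Lp ℂ p (volume : Measure (V d))) :
    ‖corrL hp k f‖ ≤ ‖k‖ * ‖f‖ := by
  have h := (corrL (d := d) hp).le_opNorm₂ k f
  have h1 : ‖corrL (d := d) hp‖ ≤ 1 := LinearMap.mkContinuous₂_norm_le _ zero_le_one _
  refine h.trans ?_
  rw [mul_assoc]
  exact mul_le_of_le_one_left (by positivity) h1

end Correlation

section Density

variable {d : ℕ}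

/-- Conjugation on `L¹`. -/
def conjL (d : ℕ) : L1 d →L[ℝ] L1 d := (Complex.conjCLE : ℂ →L[ℝ] ℂ).compLpL 1 volume

lemma coeFn_conjL (f : L1 d) : conjL d f =ᵐ[volume] conjF f :=
  ContinuousLinearMap.coeFn_compLpL _ f

lemma norm_conjL (f : L1 d) : ‖conjL d f‖ = ‖f‖ := by
  refine le_antisymm (Lp.norm_le_norm_of_ae_le ?_) (Lp.norm_le_norm_of_ae_le ?_) <;>
  filter_upwards [coeFn_conjL f] with ξ h <;> rw [h, conjF, RCLike.norm_conj]

/-- Multiplication by `-2 i`. -/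
def mulL (d : ℕ) (p : ℝ≥0∞) [Fact (1 ≤ p)] :
    Lp ℂ p (volume : Measure (V d)) →L[ℝ] Lp ℂ p (volume : Measure (V d)) :=
  (ContinuousLinearMap.mul ℝ ℂ (-2 * Complex.I)).compLpL p volume

variable {p : ℝ≥0∞} [hp1 : Fact (1 ≤ p)]

lemma coeFn_mulL (f : Lp ℂ p (volume : Measure (V d))) :
    mulL d p f =ᵐ[volume] fun ξ => -2 * Complex.I * f ξ :=
  ContinuousLinearMap.coeFn_compLpL _ f

lemma norm_mulL_le (f : Lp ℂ p (volume : Measure (V d))) : ‖mulL d p f‖ ≤ 2 * ‖f‖ := by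
  refine Lp.norm_le_mul_norm_of_ae_le_mul ?_
  filter_upwards [coeFn_mulL f] with ξ h
  rw [h]; simp

/-- The density `∫ f(x) f̄(x + y) dx`. -/
def dens (f : L1 d) : L1 d := conjL d (corrL (Or.inl rfl) (conjL d f) f)

lemma norm_dens_le (f : L1 d) : ‖dens f‖ ≤ ‖f‖ ^ 2 := by
  rw [dens, norm_conjL]
  refine (norm_corrL_le _ _ _).trans (le_of_eq ?_)
  rw [norm_conjL, sq]

lemma coeFn_dens (f : L1 d) : dens f =ᵐ[volume] conjF (corr (conjF f) f) := by
  filter_upwards [coeFn_conjL (corrL (Or.inl rfl) (conjL d f) f),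
    coeFn_corrL (Or.inl rfl) (conjL d f) f] with ξ h1 h2
  rw [dens, h1, conjF, conjF, h2, corr_congr (coeFn_conjL f) (Filter.EventuallyEq.refl _ f)]

/-- The generator of the linear evolution with density `k`. -/
def genL (hp : p = 1 ∨ p = 2) (k : L1 d) :
    Lp ℂ p (volume : Measure (V d)) →L[ℝ] Lp ℂ p (volume : Measure (V d)) :=
  (mulL d p).comp (corrL hp k)

lemma coeFn_genL (hp : p = 1 ∨ p = 2) (k : L1 d) (f : Lp ℂ p (volume : Measure (V d))) :
    genL hp k f =ᵐ[volume] fun ξ => -2 * Complex.I * corr k f ξ := by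
  filter_upwards [coeFn_mulL (corrL hp k f), coeFn_corrL hp k f] with ξ h1 h2
  rw [genL, ContinuousLinearMap.comp_apply, h1, h2]

lemma norm_genL_le (hp : p = 1 ∨ p = 2) (k : L1 d) (f : Lp ℂ p (volume : Measure (V d))) :
    ‖genL hp k f‖ ≤ 2 * ‖k‖ * ‖f‖ := by
  refine (norm_mulL_le _).trans ?_
  rw [mul_assoc]
  exact mul_le_mul_of_nonneg_left (norm_corrL_le hp k f) (by norm_num)

lemma ae_integrable_cubic (f : L1 d) : ∀ᵐ ξ : V d, Integrable fun p : V d × V d =>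
    f p.2 * conjF f (p.1 + p.2) * f (ξ + p.1) := by
  have hf := (Lp.stronglyMeasurable f).measurable
  set A : V d → ℝ≥0∞ := fun y => ∫⁻ x, ‖f x‖ₑ * ‖f (y + x)‖ₑ with hA
  have hAm : Measurable A :=
    Measurable.lintegral_prod_right' (f := fun p : V d × V d => ‖f p.2‖ₑ * ‖f (p.1 + p.2)‖ₑ)
      ((hf.enorm.comp measurable_snd).mul (hf.enorm.comp (measurable_fst.add measurable_snd)))
  have hm : Measurable fun ξ => ∫⁻ y, A y * ‖f (ξ + y)‖ₑ :=
    Measurable.lintegral_prod_right' (f := fun p : V d × V d => A p.2 * ‖f (p.1 + p.2)‖ₑ)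
      ((hAm.comp measurable_snd).mul (hf.enorm.comp (measurable_fst.add measurable_snd)))
  have h1 : ∫⁻ ξ, ∫⁻ y, A y * ‖f (ξ + y)‖ₑ ≠ ⊤ := by
    rw [lintegral_corr A _ hAm hf.enorm, hA, lintegral_corr _ _ hf.enorm hf.enorm,
      lintegral_enorm_L1]
    exact ENNReal.mul_ne_top (ENNReal.mul_ne_top enorm_ne_top enorm_ne_top) enorm_ne_top
  filter_upwards [ae_lt_top hm h1] with ξ hξ
  have hF : Measurable fun p : V d × V d => f p.2 * conjF f (p.1 + p.2) * f (ξ + p.1) :=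
    ((hf.comp measurable_snd).mul (Complex.continuous_conj.measurable.comp
      (hf.comp (measurable_fst.add measurable_snd)))).mul
      (hf.comp (measurable_const.add measurable_fst))
  refine ⟨hF.aestronglyMeasurable, ?_⟩
  rw [hasFiniteIntegral_iff_enorm, Measure.volume_eq_prod, lintegral_prod _ hF.enorm.aemeasurable]
  refine lt_of_le_of_lt (le_of_eq (lintegral_congr fun y => ?_)) hξ
  rw [hA]
  simp only [enorm_mul]
  rw [lintegral_mul_const (f := fun x => ‖f x‖ₑ * ‖conjF f (y + x)‖ₑ)]
  · simp only [conjF, RCLike.enorm_conj]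
  · exact hf.enorm.mul (Complex.continuous_conj.measurable.comp
      (hf.comp (measurable_const.add measurable_id))).enorm

lemma measurePreserving_swap_add (ξ : V d) :
    MeasurePreserving (fun p : V d × V d => (p.2, ξ + p.1)) :=
  ((MeasurePreserving.id (volume : Measure (V d))).prod (measurePreserving_add_left volume ξ)).comp
    Measure.measurePreserving_swap

lemma quarticField_eq (f : L1 d) :
    ∀ᵐ ξ : V d, quarticField f ξ = -2 * Complex.I * corr (dens f) f ξ := by
  have hf := (Lp.stronglyMeasurable f).measurable
  filter_upwards [ae_integrable_cubic f] with ξ hξ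
  rw [quarticField]
  congr 1
  have hs : MeasurePreserving (fun p : V d × V d => (p.2, ξ + p.1)) :=
    (measurePreserving_swap_add ξ)
  rw [corr_congr (coeFn_dens f) (Filter.EventuallyEq.refl _ f)]
  have hG : Measurable fun p : V d × V d => f p.1 * f p.2 * conjF f (p.1 + p.2 - ξ) :=
    ((hf.comp measurable_fst).mul (hf.comp measurable_snd)).mul
      (Complex.continuous_conj.measurable.comp
        (hf.comp ((measurable_fst.add measurable_snd).sub_const ξ)))
  have h2 := integral_map hs.measurable.aemeasurable
    (hs.map_eq.symm ▸ hG.aestronglyMeasurable :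
      AEStronglyMeasurable (fun p : V d × V d => f p.1 * f p.2 * conjF f (p.1 + p.2 - ξ))
        (Measure.map (fun p : V d × V d => (p.2, ξ + p.1)) volume))
  rw [hs.map_eq] at h2
  rw [h2]
  calc ∫ p : V d × V d, f p.2 * f (ξ + p.1) * conjF f (p.2 + (ξ + p.1) - ξ)
      = ∫ p : V d × V d, f p.2 * conjF f (p.1 + p.2) * f (ξ + p.1) := by
        refine integral_congr_ae (Filter.Eventually.of_forall fun p => ?_)
        have : p.2 + (ξ + p.1) - ξ = p.1 + p.2 := by abel
        simp only [this]; ring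
    _ = ∫ y, ∫ x, f x * conjF f (y + x) * f (ξ + y) := integral_prod _ hξ
    _ = corr (conjF (corr (conjF f) f)) f ξ := by
        refine integral_congr_ae (Filter.Eventually.of_forall fun y => ?_)
        simp only []
        rw [integral_mul_const, conjF, corr, ← _root_.integral_conj]
        congr 2
        funext x
        simp [conjF]

end Density

section Conservation

variable {d : ℕ}

lemma dens_neg (f : L1 d) : ∀ᵐ z : V d, dens f (-z) = (starRingEnd ℂ) (dens f z) := by
  have h1 := coeFn_dens f
  have h2 := (Measure.measurePreserving_neg (volume : Measure (V d))).quasiMeasurePreserving.ae h1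
  filter_upwards [h1, h2] with z e1 e2
  rw [e2, e1, conjF, conjF, corr, corr, Complex.conj_conj, ← _root_.integral_conj,
    ← integral_add_right_eq_self (fun x => (starRingEnd ℂ) (conjF f x * f (-z + x))) z]
  refine integral_congr_ae (Filter.Eventually.of_forall fun x => ?_)
  have e3 : -z + (x + z) = x := by abel
  simp only [e3, conjF, map_mul, Complex.conj_conj]
  rw [add_comm x z]
  ring

lemma ae_integrable_double (k f : L1 d) : ∀ᵐ y : V d, Integrable fun p : V d × V d =>
    conjF f p.2 * k p.1 * f (y + p.2 + p.1) := by
  have hf := (Lp.stronglyMeasurable f).measurable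
  have hk := (Lp.stronglyMeasurable k).measurable
  set B : V d → ℝ≥0∞ := fun w => ∫⁻ z, ‖k z‖ₑ * ‖f (w + z)‖ₑ with hB
  have hBm : Measurable B :=
    Measurable.lintegral_prod_right' (f := fun p : V d × V d => ‖k p.2‖ₑ * ‖f (p.1 + p.2)‖ₑ)
      ((hk.enorm.comp measurable_snd).mul (hf.enorm.comp (measurable_fst.add measurable_snd)))
  have hm : Measurable fun y => ∫⁻ x, ‖f x‖ₑ * B (y + x) :=
    Measurable.lintegral_prod_right' (f := fun p : V d × V d => ‖f p.2‖ₑ * B (p.1 + p.2))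
      ((hf.enorm.comp measurable_snd).mul (hBm.comp (measurable_fst.add measurable_snd)))
  have h1 : ∫⁻ y, ∫⁻ x, ‖f x‖ₑ * B (y + x) ≠ ⊤ := by
    rw [lintegral_corr _ B hf.enorm hBm, hB, lintegral_corr _ _ hk.enorm hf.enorm,
      lintegral_enorm_L1, lintegral_enorm_L1]
    exact ENNReal.mul_ne_top enorm_ne_top (ENNReal.mul_ne_top enorm_ne_top enorm_ne_top)
  filter_upwards [ae_lt_top hm h1] with y hy
  have hF : Measurable fun p : V d × V d => conjF f p.2 * k p.1 * f (y + p.2 + p.1) :=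
    ((Complex.continuous_conj.measurable.comp (hf.comp measurable_snd)).mul
      (hk.comp measurable_fst)).mul
      (hf.comp ((measurable_const.add measurable_snd).add measurable_fst))
  refine ⟨hF.aestronglyMeasurable, ?_⟩
  rw [hasFiniteIntegral_iff_enorm, Measure.volume_eq_prod,
    lintegral_prod_symm _ hF.enorm.aemeasurable]
  refine lt_of_le_of_lt (le_of_eq (lintegral_congr fun x => ?_)) hy
  rw [hB, ← lintegral_const_mul]
  · simp only [enorm_mul, conjF, RCLike.enorm_conj, mul_assoc]
  · exact hk.enorm.mul (hf.comp (measurable_const.add measurable_id)).enorm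

lemma measurePreserving_neg_shear :
    MeasurePreserving (fun p : V d × V d => (-p.1, p.1 + p.2)) :=
  (Measure.measurePreserving_neg (volume : Measure (V d))).skew_product
    (g := fun z x => z + x) (measurable_fst.add measurable_snd)
    (Filter.Eventually.of_forall fun z => (measurePreserving_add_left volume z).map_eq)

lemma corrL_conj_dens (f : L1 d) :
    corrL (Or.inl rfl) (conjL d (corrL (Or.inl rfl) (dens f) f)) f =
      corrL (Or.inl rfl) (conjL d f) (corrL (Or.inl rfl) (dens f) f) := by
  have hf := (Lp.stronglyMeasurable f).measurable
  have hk := (Lp.stronglyMeasurable (dens f)).measurable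
  have h0 := coeFn_corrL (Or.inl rfl) (dens f) f
  refine Lp.ext ?_
  filter_upwards [ae_integrable_double (dens f) f, coeFn_corrL (Or.inl rfl)
    (conjL d (corrL (Or.inl rfl) (dens f) f)) f, coeFn_corrL (Or.inl rfl) (conjL d f)
    (corrL (Or.inl rfl) (dens f) f)] with y hy e1 e2
  have h1 : conjL d (corrL (Or.inl rfl) (dens f) f) =ᵐ[volume] conjF (corr (dens f) f) := by
    filter_upwards [coeFn_conjL (corrL (Or.inl rfl) (dens f) f), h0] with ξ a b
    rw [a, conjF, conjF, b]
  rw [e1, e2, corr_congr h1 (Filter.EventuallyEq.refl _ f), corr_congr (coeFn_conjL f) h0]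
  have hs := measurePreserving_neg_shear (d := d)
  have h2 := integral_map hs.measurable.aemeasurable
    (hs.map_eq.symm ▸ hy.aestronglyMeasurable :
      AEStronglyMeasurable (fun p : V d × V d => conjF f p.2 * dens f p.1 * f (y + p.2 + p.1))
        (Measure.map (fun p : V d × V d => (-p.1, p.1 + p.2)) volume))
  rw [hs.map_eq] at h2
  have hy2 : Integrable fun p : V d × V d => conjF (dens f) p.1 * conjF f (p.1 + p.2) *
      f (y + p.2) := by
    refine (hs.integrable_comp_of_integrable hy).congr ?_
    have := (Measure.quasiMeasurePreserving_fst (μ := (volume : Measure (V d)))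
      (ν := (volume : Measure (V d)))).ae (dens_neg f)
    filter_upwards [this] with p hp
    have e : y + (p.1 + p.2) + -p.1 = y + p.2 := by abel
    simp only [Function.comp_apply, hp, e, conjF]
    ring
  have e3 : ∫ p : V d × V d, conjF f p.2 * dens f p.1 * f (y + p.2 + p.1) =
      ∫ p : V d × V d, conjF (dens f) p.1 * conjF f (p.1 + p.2) * f (y + p.2) := by
    rw [h2]
    refine integral_congr_ae ?_
    have := (Measure.quasiMeasurePreserving_fst (μ := (volume : Measure (V d)))
      (ν := (volume : Measure (V d)))).ae (dens_neg f)
    filter_upwards [this] with p hp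
    have e : y + (p.1 + p.2) + -p.1 = y + p.2 := by abel
    simp only [hp, e, conjF]
    ring
  have e4 := integral_prod_symm _ hy
  have e5 := integral_prod_symm _ hy2
  rw [← Measure.volume_eq_prod] at e4 e5
  have e6 : corr (conjF f) (corr (dens f) f) y =
      ∫ x, ∫ z, conjF f x * dens f z * f (y + x + z) := by
    refine integral_congr_ae (Filter.Eventually.of_forall fun x => ?_)
    simp only [mul_assoc]
    rw [integral_const_mul]
    rfl
  have e7 : corr (conjF (corr (dens f) f)) f y =
      ∫ x, ∫ z, conjF (dens f) z * conjF f (z + x) * f (y + x) := by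
    refine integral_congr_ae (Filter.Eventually.of_forall fun x => ?_)
    simp only []
    rw [integral_mul_const, conjF, corr, ← _root_.integral_conj]
    congr 2
    funext z
    simp [conjF, add_comm]
  rw [e6, e7, ← e4, ← e5, e3]

lemma conjL_mulL (f : L1 d) : conjL d (mulL d 1 f) = -mulL d 1 (conjL d f) := by
  have hq : ∀ᵐ ξ : V d, conjL d (mulL d 1 f) ξ = (starRingEnd ℂ) (-2 * Complex.I * f ξ) := by
    filter_upwards [coeFn_conjL (mulL d 1 f), coeFn_mulL f] with ξ a b
    rw [a, conjF, b]
  refine Lp.ext ?_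
  filter_upwards [hq, coeFn_mulL (conjL d f), coeFn_conjL f, Lp.coeFn_neg (mulL d 1 (conjL d f))]
    with ξ a b c e
  rw [a, e, Pi.neg_apply, b, c, conjF, map_mul, map_mul, map_neg, Complex.conj_I,
    Complex.conj_ofNat]
  ring

lemma corrL_mulL_left (k f : L1 d) :
    corrL (Or.inl rfl) (mulL d 1 k) f = mulL d 1 (corrL (Or.inl rfl) k f) := by
  refine Lp.ext ?_
  filter_upwards [coeFn_corrL (Or.inl rfl) (mulL d 1 k) f, coeFn_mulL (corrL (Or.inl rfl) k f),
    coeFn_corrL (Or.inl rfl) k f] with ξ a b c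
  rw [a, b, c, corr_congr (coeFn_mulL k) (Filter.EventuallyEq.refl _ f), corr, corr,
    ← integral_const_mul]
  simp only [mul_assoc]

lemma corrL_mulL_right (k f : L1 d) :
    corrL (Or.inl rfl) k (mulL d 1 f) = mulL d 1 (corrL (Or.inl rfl) k f) := by
  refine Lp.ext ?_
  filter_upwards [coeFn_corrL (Or.inl rfl) k (mulL d 1 f), coeFn_mulL (corrL (Or.inl rfl) k f),
    coeFn_corrL (Or.inl rfl) k f] with ξ a b c
  rw [a, b, c, corr_congr (Filter.EventuallyEq.refl _ k) (coeFn_mulL f), corr, corr,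
    ← integral_const_mul]
  simp only [mul_left_comm]

/-- The density is constant along the flow of `P`. -/
lemma deriv_dens_eq_zero (f : L1 d) :
    corrL (Or.inl rfl) (conjL d (genL (Or.inl rfl) (dens f) f)) f +
      corrL (Or.inl rfl) (conjL d f) (genL (Or.inl rfl) (dens f) f) = 0 := by
  rw [genL, ContinuousLinearMap.comp_apply, conjL_mulL, map_neg, neg_apply, corrL_mulL_left,
    corrL_mulL_right, corrL_conj_dens, neg_add_cancel]

end Conservation

section Flow

variable {d : ℕ}

lemma cons_closed : IsClosed {x : X d | Cons x} := by
  refine IsSeqClosed.isClosed fun F x hF hx => ?_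
  have h1 := tendstoInMeasure_of_tendsto_Lp ((continuous_fst.tendsto x).comp hx)
  have h2 := tendstoInMeasure_of_tendsto_Lp ((continuous_snd.tendsto x).comp hx)
  refine tendstoInMeasure_ae_unique h2 (h1.congr_left fun n => ?_)
  exact Filter.EventuallyEq.symm (show (F n).2 =ᵐ[volume] (F n).1 from hF n)

/-- The pairs whose components agree. -/
def consSub (d : ℕ) : Submodule ℝ (X d) where
  carrier := {x | Cons x}
  add_mem' := fun {x y} hx hy => by
    have h1 : x.2 =ᵐ[volume] x.1 := hx
    have h2 : y.2 =ᵐ[volume] y.1 := hy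
    exact (Lp.coeFn_add x.2 y.2).trans ((h1.add h2).trans (Lp.coeFn_add x.1 y.1).symm)
  zero_mem' := (Lp.coeFn_zero ℂ 2 volume).trans (Lp.coeFn_zero ℂ 1 volume).symm
  smul_mem' := fun c x hx => by
    have h1 : x.2 =ᵐ[volume] x.1 := hx
    exact (Lp.coeFn_smul c x.2).trans ((h1.const_smul c).trans (Lp.coeFn_smul c x.1).symm)

/-- The generator on pairs. -/
def genX (k : L1 d) : X d →L[ℝ] X d :=
  (genL (Or.inl rfl) k).prodMap (genL (Or.inr rfl) k)

lemma genX_mem (k : L1 d) : ∀ x ∈ consSub d, genX k x ∈ consSub d := by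
  intro x hx
  have h1 : x.2 =ᵐ[volume] x.1 := hx
  show genL (Or.inr rfl) k x.2 =ᵐ[volume] genL (Or.inl rfl) k x.1
  filter_upwards [coeFn_genL (Or.inr rfl) k x.2, coeFn_genL (Or.inl rfl) k x.1] with ξ a b
  rw [a, b, corr_congr (Filter.EventuallyEq.refl _ k) h1]

lemma hasDerivWithinAt_Ici {E : Type*} [NormedAddCommGroup E] [NormedSpace ℝ E] {f : ℝ → E} {f' : E}
    {a b t : ℝ} (ht : t ∈ Set.Ico a b) (h : HasDerivWithinAt f f' (Set.Icc a b) t) :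
    HasDerivWithinAt f f' (Set.Ici t) t :=
  h.mono_of_mem_nhdsWithin (Icc_mem_nhdsGE_of_mem ht)

/-- The flow of `P` preserves `L²` and is differentiable there. -/
theorem exists_flow {h : ℝ} (hh : 0 ≤ h) {χ χ' : L1 d} (hs : NonlinearStep h χ χ') {x₀ : X d}
    (hc : Cons x₀) (hx₀ : x₀.1 = χ) : ∃ Γ w : ℝ → X d, Γ 0 = x₀ ∧ (Γ h).1 = χ' ∧
      ∀ t ∈ Set.Icc 0 h, HasDerivWithinAt Γ (w t) (Set.Icc 0 h) t ∧ Cons (Γ t) ∧ Cons (w t) ∧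
        ((w t).1 =ᵐ[volume] quarticField (Γ t).1) ∧
        ‖(Γ t).1‖ ≤ ‖χ‖ * Real.exp (2 * ‖χ‖ ^ 2 * h) ∧
        ‖(Γ t).2‖ ≤ ‖x₀.2‖ * Real.exp (2 * ‖χ‖ ^ 2 * h) ∧
        ‖(w t).2‖ ≤ 2 * ‖χ‖ ^ 2 * ‖(Γ t).2‖ := by
  obtain ⟨γ, v, hγ0, hγh, hγ⟩ := hs
  have hv : ∀ t ∈ Set.Icc 0 h, v t = genL (Or.inl rfl) (dens (γ t)) (γ t) := by
    intro t ht
    refine Lp.ext ?_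
    filter_upwards [(hγ t ht).2, quarticField_eq (γ t),
      coeFn_genL (Or.inl rfl) (dens (γ t)) (γ t)] with ξ a b c
    rw [a, b, c]
  have hcont : ContinuousOn γ (Set.Icc 0 h) := fun t ht => (hγ t ht).1.continuousWithinAt
  have hk : ∀ t ∈ Set.Icc 0 h, dens (γ t) = dens χ := by
    have hder : ∀ t ∈ Set.Icc 0 h, HasDerivWithinAt
        (fun t => corrL (Or.inl rfl) (conjL d (γ t)) (γ t)) 0 (Set.Icc 0 h) t := by
      intro t ht
      have h1 := (hγ t ht).1
      have h2 := (corrL (d := d) (Or.inl rfl)).hasFDerivAt.comp_hasDerivWithinAt t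
        ((conjL d).hasFDerivAt.comp_hasDerivWithinAt t h1)
      have h3 := h2.clm_apply h1
      rw [hv t ht] at h3
      exact h3.congr_deriv (deriv_dens_eq_zero (γ t))
    have := constant_of_has_deriv_right_zero (fun t ht => (hder t ht).continuousWithinAt)
      fun t ht => hasDerivWithinAt_Ici ht (hder t (Set.Ico_subset_Icc_self ht))
    intro t ht
    rw [dens, this t ht, hγ0]
    rfl
  set A := genX (dens χ) with hA
  set Γ : ℝ → X d := fun t => NormedSpace.exp (t • A) x₀ with hΓ
  have hΓd : ∀ t, HasDerivAt Γ (A (Γ t)) t := by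
    intro t
    have := (hasDerivAt_exp_smul A t).clm_apply (hasDerivAt_const t x₀)
    simpa using this
  have hΓc : ∀ t, Cons (Γ t) := fun t =>
    exp_apply_mem (S := consSub d) cons_closed (T := t • A)
      (fun x hx => (consSub d).smul_mem t (genX_mem _ x hx)) x₀ hc
  have hΓ0 : Γ 0 = x₀ := by simp [hΓ]
  have hd1 : ∀ t, HasDerivAt (fun t => (Γ t).1) (genL (Or.inl rfl) (dens χ) (Γ t).1) t := fun t =>
    (ContinuousLinearMap.fst ℝ (L1 d) (Lp ℂ 2 (volume : Measure (V d)))).hasFDerivAt.comp_hasDerivAt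
      t (hΓd t)
  have hd2 : ∀ t, HasDerivAt (fun t => (Γ t).2) (genL (Or.inr rfl) (dens χ) (Γ t).2) t := fun t =>
    (ContinuousLinearMap.snd ℝ (L1 d) (Lp ℂ 2 (volume : Measure (V d)))).hasFDerivAt.comp_hasDerivAt
      t (hΓd t)
  have hb : ∀ {p : ℝ≥0∞} [Fact (1 ≤ p)] (hp : p = 1 ∨ p = 2)
      (f : Lp ℂ p (volume : Measure (V d))), ‖genL hp (dens χ) f‖ ≤ 2 * ‖χ‖ ^ 2 * ‖f‖ := by
    intro p _ hp f
    refine (norm_genL_le hp _ f).trans ?_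
    have := norm_dens_le χ
    gcongr
  have heq : Set.EqOn γ (fun t => (Γ t).1) (Set.Icc 0 h) := by
    refine ODE_solution_unique (v := fun _ f => genL (Or.inl rfl) (dens χ) f)
      (K := ‖genL (p := 1) (Or.inl rfl) (dens χ)‖₊)
      (fun t => (genL (Or.inl rfl) (dens χ)).lipschitz) hcont ?_
      (fun t _ => (hd1 t).continuousAt.continuousWithinAt)
      (fun t _ => (hd1 t).hasDerivWithinAt) ?_
    · intro t ht
      have ht' := Set.Ico_subset_Icc_self ht
      have := hasDerivWithinAt_Ici ht (hγ t ht').1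
      rwa [hv t ht', hk t ht'] at this
    · rw [hγ0]; simp only [hΓ0, hx₀]
  have hgr : ∀ {p : ℝ≥0∞} [Fact (1 ≤ p)] (hp : p = 1 ∨ p = 2)
      (f : ℝ → Lp ℂ p (volume : Measure (V d)))
      (_ : ∀ t, HasDerivAt f (genL hp (dens χ) (f t)) t), ∀ t ∈ Set.Icc 0 h,
      ‖f t‖ ≤ ‖f 0‖ * Real.exp (2 * ‖χ‖ ^ 2 * h) := by
    intro p _ hp f hf t ht
    have := norm_le_gronwallBound_of_norm_deriv_right_le (a := 0) (b := h) (δ := ‖f 0‖)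
      (K := 2 * ‖χ‖ ^ 2) (ε := 0) (fun t _ => (hf t).continuousAt.continuousWithinAt)
      (fun t _ => (hf t).hasDerivWithinAt) le_rfl
      (fun t _ => by rw [add_zero]; exact hb hp (f t)) t ht
    rw [gronwallBound_ε0] at this
    refine this.trans ?_
    have := ht.2
    rw [sub_zero]
    gcongr
  refine ⟨Γ, fun t => A (Γ t), hΓ0, ?_, fun t ht => ⟨(hΓd t).hasDerivWithinAt, hΓc t,
    genX_mem _ _ (hΓc t), ?_, ?_, ?_, hb (Or.inr rfl) (Γ t).2⟩⟩
  · rw [← hγh]; exact (heq (Set.right_mem_Icc.2 hh)).symm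
  · have e1 : (A (Γ t)).1 = v t := by
      rw [hv t ht, hk t ht, heq ht]; rfl
    have e2 : (Γ t).1 = γ t := (heq ht).symm
    rw [e1, e2]
    exact (hγ t ht).2
  · have := hgr (Or.inl rfl) _ hd1 t ht
    simpa [hΓ0, hx₀] using this
  · have := hgr (Or.inr rfl) _ hd2 t ht
    simpa [hΓ0] using this

end Flow

section StepInvariant

variable {d : ℕ}

/-- The polynomial with vector field coefficients `G`, up to the factor `h`. -/
def hamF (N : ℕ) (ρ : ℕ → ℝ) (G : wordSpace d) (x : X d) : ℝ :=
  ∑ l ∈ Finset.range (N + 1), ((l + 1) * ρ l)⁻¹ * (QM l (fun _ => x) G).re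

lemma QM_linear {N l : ℕ} (hl : l ≤ N) {ρ : ℕ → ℝ} (hρ : ∀ l, ρ l ≠ 0) (lam : V d → ℝ)
    (hlam : Measurable lam) {L : ℝ} (hL : ∀ ξ, |lam ξ| ≤ L) (G : wordSpace d) {x x' : X d}
    (h1 : x'.1 =ᵐ[volume] fun ξ => Complex.exp (-Complex.I * lam ξ) * x.1 ξ)
    (h2 : x'.2 =ᵐ[volume] fun ξ => Complex.exp (-Complex.I * lam ξ) * x.2 ξ) :
    QM l (fun _ => x') G =
      QM l (fun _ => x) (NormedSpace.exp (bW N ρ (aX N ρ lam hlam hL)) G) := by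
  rw [QM_apply, QM_apply]
  have e1 : ∀ i : Fin (2 * l + 1 + 1), slotFn i x' =ᵐ[volume]
      fun ξ => Complex.exp (-Complex.I * lam ξ) * slotFn i x ξ := by
    intro i
    unfold slotFn
    split_ifs
    · exact h2
    · exact h1
  rw [form_congr_ae (even_two_mul l) _ e1, form_linear (even_two_mul l).add_one]
  refine form_congr (fun u hu => ?_) _
  have hru : InRange N u := ⟨by rw [hu]; exact (even_two_mul l).add_one, by omega⟩
  have := exp_apply_eigen (S := ⊤) (T := bW N ρ (aX N ρ lam hlam hL)) (l := evW u)
    (μ := -(Complex.I * wFreq lam u)) (fun _ _ => trivial) (fun x _ => by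
      rw [evW_apply, evW_apply, wv_bW_aX hρ, if_pos hru]) G trivial
  exact this.symm

lemma hamF_linear {N : ℕ} {ρ : ℕ → ℝ} (hρ : ∀ l, ρ l ≠ 0) (lam : V d → ℝ)
    (hlam : Measurable lam) {L : ℝ} (hL : ∀ ξ, |lam ξ| ≤ L) (G : wordSpace d) {x x' : X d}
    (h1 : x'.1 =ᵐ[volume] fun ξ => Complex.exp (-Complex.I * lam ξ) * x.1 ξ)
    (h2 : x'.2 =ᵐ[volume] fun ξ => Complex.exp (-Complex.I * lam ξ) * x.2 ξ) :
    hamF N ρ G x' = hamF N ρ (NormedSpace.exp (bW N ρ (aX N ρ lam hlam hL)) G) x :=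
  Finset.sum_congr rfl fun l hl => by
    rw [QM_linear (Nat.lt_succ_iff.1 (Finset.mem_range.1 hl)) hρ lam hlam hL G h1 h2]

/-- The real part of the form with the vector field in the last slot. -/
def lastForm (l : ℕ) (G : wordSpace d) (x w : X d) : ℝ :=
  (form (m := 2 * l + 1) (wv G) (oneSlot x.1 w.1 (Fin.last _))).re

lemma abs_lastForm_le (l : ℕ) (G : wordSpace d) {x w : X d} (hx : Cons x) (hw : Cons w) :
    |lastForm l G x w| ≤ ‖G‖ * (‖x.2‖ * ‖w.2‖ * ‖x.1‖ ^ (2 * l)) := by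
  have h1 : form (m := 2 * l + 1) (wv G) (oneSlot x.1 w.1 (Fin.last _)) =
      form (m := 2 * l + 1) (wv G) (fun i => slotFn i (if i = Fin.last _ then w else x)) := by
    refine form_congr_ae (even_two_mul l) _ fun i => ?_
    by_cases h : i = Fin.last (2 * l + 1)
    · rw [oneSlot, if_pos h, if_pos h]; exact (hw.slotFn i).symm
    · rw [oneSlot, if_neg h, if_neg h]; exact (hx.slotFn i).symm
  rw [lastForm, h1]
  refine (Complex.abs_re_le_norm _).trans
    ((norm_form_le (fun u _ => norm_wv_le G u) _).trans (le_of_eq ?_))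
  have h0 : (0 : Fin (2 * l + 1 + 1)) ≠ Fin.last (2 * l + 1) := (Fin.last_pos).ne
  simp [h0, Fin.castSucc_ne_last]

lemma re_QM_bW {N l : ℕ} (hl : l + 1 ≤ N) {ρ : ℕ → ℝ} (hρ : ∀ l, ρ l ≠ 0) (h : ℝ)
    {G : wordSpace d} (hG : Cyc (wv G)) {x w : X d} (hx : Cons x)
    (hw : w.1 =ᵐ[volume] quarticField x.1) :
    (QM (l + 1) (fun _ => x) (bW N ρ (pX N ρ h) G)).re =
      ρ (l + 1) * ((2 * l + 4) * (h * ((ρ l)⁻¹ * lastForm l G x w))) := by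
  have e1 : QM (l + 1) (fun _ => x) (bW N ρ (pX N ρ h) G) =
      ρ (l + 1) * form (m := 2 * l + 3) (br (pw h) (tw N ρ⁻¹ (wv G))) (fun i => slotFn i x) := by
    rw [QM_apply, ← form_mul_left]
    refine form_congr (fun u hu => ?_) _
    have hu' : u.length = 2 * l + 3 := hu
    have hru : InRange N u := ⟨by rw [hu]; exact (even_two_mul (l + 1)).add_one, by omega⟩
    rw [wv_bW_pX hρ, tw, if_pos hru, show wdeg u = l + 1 by unfold wdeg; omega]
  have e2 := re_form_br_pw (even_two_mul l) h (b := tw N ρ⁻¹ (wv G)) (measW_wv G).tw hG.tw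
    (C := wB N ρ⁻¹ * ‖G‖) (fun q _ => norm_tw_le (norm_nonneg G) (fun u _ => norm_wv_le G u) q) hx
  have e3 : form (m := 2 * l + 1) (tw N ρ⁻¹ (wv G))
      (oneSlot x.1 (quarticField x.1) (Fin.last _)) =
      ((ρ l)⁻¹ : ℝ) * form (m := 2 * l + 1) (wv G) (oneSlot x.1 w.1 (Fin.last _)) := by
    rw [← form_mul_left]
    have h1 : form (m := 2 * l + 1) (tw N ρ⁻¹ (wv G))
        (oneSlot x.1 (quarticField x.1) (Fin.last _)) =
        form (m := 2 * l + 1) (tw N ρ⁻¹ (wv G)) (oneSlot x.1 w.1 (Fin.last _)) := by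
      refine form_congr_ae (even_two_mul l) _ fun i => ?_
      unfold oneSlot
      split_ifs
      · exact hw.symm
      · rfl
    rw [h1]
    refine form_congr (fun u hu => ?_) _
    have hru : InRange N u := ⟨by rw [hu]; exact (even_two_mul l).add_one, by omega⟩
    rw [tw, if_pos hru, show wdeg u = l by unfold wdeg; omega]
    rfl
  rw [e1, Complex.re_ofReal_mul]
  congr 1
  rw [lastForm, ← Complex.re_ofReal_mul, ← e3]
  push_cast at e2
  exact e2

lemma re_QM_zero_bW {N : ℕ} {ρ : ℕ → ℝ} (hρ : ∀ l, ρ l ≠ 0) (h : ℝ) (G : wordSpace d) (x : X d) :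
    (QM 0 (fun _ => x) (bW N ρ (pX N ρ h) G)).re = 0 := by
  have : QM 0 (fun _ => x) (bW N ρ (pX N ρ h) G) =
      form (m := 2 * 0 + 1) (fun _ => 0 * (1 : ℂ)) (fun i => slotFn i x) := by
    rw [QM_apply]
    refine form_congr (fun u hu => ?_) _
    rw [wv_bW_pX hρ, tw, zero_mul]
    split_ifs
    · rw [br_pw_of_length_one h _ (by omega), mul_zero]
    · rfl
  rw [this, form_mul_left, zero_mul, Complex.zero_re]

lemma hasDerivWithinAt_QM {l : ℕ} {Γ : ℝ → X d} {w : X d} {G : ℝ → wordSpace d} {G' : wordSpace d}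
    {s : Set ℝ} {t : ℝ} (hΓ : HasDerivWithinAt Γ w s t) (hG : HasDerivWithinAt G G' s t)
    (hcyc : Cyc (wv (G t))) (hx : Cons (Γ t)) (hw : Cons w) :
    HasDerivWithinAt (fun t => (QM l (fun _ => Γ t) (G t)).re)
      ((2 * l + 2) * lastForm l (G t) (Γ t) w + (QM l (fun _ => Γ t) G').re) s t := by
  have h1 : HasDerivWithinAt (fun t => (fun _ : Fin (2 * l + 2) => Γ t)) (fun _ => w) s t :=
    hasDerivWithinAt_pi.2 fun _ => hΓ
  have h2 := ((QM l).hasFDerivAt (fun _ : Fin (2 * l + 2) => Γ t)).comp_hasDerivWithinAt t h1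
  have h3 := h2.clm_apply hG
  have h4 := Complex.reCLM.hasFDerivAt.comp_hasDerivWithinAt t h3
  refine h4.congr_deriv ?_
  rw [ContinuousMultilinearMap.linearDeriv_apply, Complex.reCLM_apply, Complex.add_re,
    sum_apply, Complex.re_sum, sum_update_re hcyc hx hw]
  rfl

lemma hasDerivWithinAt_hamF {N : ℕ} {ρ : ℕ → ℝ} (hρ : ∀ l, ρ l ≠ 0) {h : ℝ} (hh : h ≠ 0)
    {Γ : ℝ → X d} {w : X d} {G : ℝ → wordSpace d} {s : Set ℝ} {t : ℝ}
    (hΓ : HasDerivWithinAt Γ w s t)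
    (hG : HasDerivWithinAt G (-(h⁻¹ • bW N ρ (pX N ρ h) (G t))) s t)
    (hcyc : Cyc (wv (G t))) (hx : Cons (Γ t)) (hw : Cons w)
    (hq : w.1 =ᵐ[volume] quarticField (Γ t).1) :
    HasDerivWithinAt (fun t => hamF N ρ (G t) (Γ t)) (2 * (ρ N)⁻¹ * lastForm N (G t) (Γ t) w)
      s t := by
  have h1 := HasDerivWithinAt.fun_sum (u := Finset.range (N + 1)) fun l _ =>
    (hasDerivWithinAt_QM (l := l) hΓ hG hcyc hx hw).const_mul ((l + 1) * ρ l)⁻¹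
  refine h1.congr_deriv ?_
  have e1 : ∀ l : ℕ, (QM l (fun _ => Γ t) (-(h⁻¹ • bW N ρ (pX N ρ h) (G t)))).re =
      -(h⁻¹ * (QM l (fun _ => Γ t) (bW N ρ (pX N ρ h) (G t))).re) := by
    intro l
    rw [map_neg, map_smul, Complex.neg_re, Complex.real_smul, Complex.re_ofReal_mul]
  simp only [e1, mul_add]
  rw [Finset.sum_add_distrib, Finset.sum_range_succ, Finset.sum_range_succ'
    (fun l : ℕ => (((l : ℝ) + 1) * ρ l)⁻¹ *
      -(h⁻¹ * (QM l (fun _ => Γ t) (bW N ρ (pX N ρ h) (G t))).re)), re_QM_zero_bW hρ]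
  have e2 : ∀ l ∈ Finset.range N, (((l + 1 : ℕ) : ℝ) + 1)  * ρ (l + 1) ≠ 0 := fun l _ =>
    mul_ne_zero (by positivity) (hρ _)
  have e3 : ∑ l ∈ Finset.range N, ((((l + 1 : ℕ) : ℝ) + 1) * ρ (l + 1))⁻¹ *
      -(h⁻¹ * (QM (l + 1) (fun _ => Γ t) (bW N ρ (pX N ρ h) (G t))).re) =
      -∑ l ∈ Finset.range N, (((l : ℝ) + 1) * ρ l)⁻¹ *
        ((2 * l + 2) * lastForm l (G t) (Γ t) w) := by
    rw [← Finset.sum_neg_distrib]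
    refine Finset.sum_congr rfl fun l hl => ?_
    rw [re_QM_bW (Finset.mem_range.1 hl) hρ h hcyc hx hq]
    have a1 := hρ l
    have a2 := hρ (l + 1)
    have a3 : (l : ℝ) + 1 ≠ 0 := by positivity
    have a4 : (((l + 1 : ℕ) : ℝ) + 1) ≠ 0 := by positivity
    push_cast at a4 ⊢
    field_simp
    ring
  rw [e3]
  have a1 := hρ N
  have a3 : (N : ℝ) + 1 ≠ 0 := by positivity
  field_simp
  ring

/-- The change of the modified energy in one step is a truncation error. -/
theorem abs_hamF_step_le {N : ℕ} {ρ : ℕ → ℝ} (hρ : ∀ l, 0 < ρ l) {h : ℝ} (hh : 0 < h)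
    (hr : ∀ l : ℕ, ρ (l + 1) * (4 * h * (l + 2)) ≤ 1 / 50 * ρ l) (lam : V d → ℝ)
    (hlam : Measurable lam) {L : ℝ} (hL : ∀ ξ, |lam ξ| ≤ L) {Z : wordSpace d}
    (hZ : NormedSpace.exp (bW N ρ (aX N ρ lam hlam hL))
      (NormedSpace.exp (bW N ρ (pX N ρ h)) Z) = Z) (hc : Cyc (wv Z)) {x x' : X d}
    (h1 : x'.1 =ᵐ[volume] fun ξ => Complex.exp (-Complex.I * lam ξ) * x.1 ξ)
    (h2 : x'.2 =ᵐ[volume] fun ξ => Complex.exp (-Complex.I * lam ξ) * x.2 ξ)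
    {Γ w : ℝ → X d} (hΓ0 : Γ 0 = x') {M m : ℝ}
    (hΓ : ∀ t ∈ Set.Icc 0 h, HasDerivWithinAt Γ (w t) (Set.Icc 0 h) t ∧ Cons (Γ t) ∧ Cons (w t) ∧
        ((w t).1 =ᵐ[volume] quarticField (Γ t).1) ∧ ‖(Γ t).1‖ ≤ M ∧ ‖(Γ t).2‖ ≤ m ∧
        ‖(w t).2‖ ≤ 2 * M ^ 2 * ‖(Γ t).2‖) :
    |hamF N ρ Z (Γ h) - hamF N ρ Z x| ≤
      h * (8 * (ρ N)⁻¹ * ‖Z‖ * M ^ (2 * N + 2) * m ^ 2) := by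
  set B := bW N ρ (pX N ρ h : wordSpace d) with hB
  have hBn : ‖B‖ ≤ 1 / 50 := norm_bW_pX_le hρ hh.le (by norm_num) hr
  have hρ' : ∀ l, ρ l ≠ 0 := fun l => (hρ l).ne'
  set G : ℝ → wordSpace d := fun t => NormedSpace.exp ((1 - t / h) • B) Z with hG
  have hGd : ∀ t, HasDerivAt G (-(h⁻¹ • B (G t))) t := by
    intro t
    have a1 : HasDerivAt (fun t : ℝ => 1 - t / h) (-h⁻¹) t := by
      have := ((hasDerivAt_id t).div_const h).const_sub 1
      simpa [div_eq_mul_inv] using this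
    have a2 := (hasDerivAt_exp_smul B (1 - t / h)).scomp t a1
    have a3 := a2.clm_apply (hasDerivAt_const t Z)
    refine a3.congr_deriv ?_
    simp [hG]
  have hGc : ∀ t, Cyc (wv (G t)) := fun t => mem_cycSub.1 <|
    exp_apply_mem (S := cycSub d) (isClosed_kerFam _) (T := (1 - t / h) • B)
      (fun x hx => (cycSub d).smul_mem _ (bW_pX_mem_cycSub hρ' h x hx)) Z (mem_cycSub.2 hc)
  have hGn : ∀ t ∈ Set.Icc 0 h, ‖G t‖ ≤ 2 * ‖Z‖ := by
    intro t ht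
    have hs0 : 0 ≤ 1 - t / h := by
      rw [sub_nonneg, div_le_one hh]; exact ht.2
    have hs1 : 1 - t / h ≤ 1 := by
      have := div_nonneg ht.1 hh.le; linarith
    have a1 : ‖(1 - t / h) • B‖ ≤ 1 / 50 := by
      rw [norm_smul, Real.norm_of_nonneg hs0]
      calc (1 - t / h) * ‖B‖ ≤ 1 * ‖B‖ := by gcongr
        _ ≤ 1 / 50 := by rw [one_mul]; exact hBn
    have a2 := norm_exp_sub_one_le ((1 - t / h) • B)
    have a3 : Real.exp ‖(1 - t / h) • B‖ ≤ 2 := by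
      have := Real.exp_le_exp.2 a1
      have h2 : Real.exp (1 / 50) ≤ 2 := by
        have := Real.exp_bound_div_one_sub_of_interval (x := 1 / 50) (by norm_num) (by norm_num)
        norm_num at this ⊢
        linarith
      linarith
    have a4 : ‖NormedSpace.exp ((1 - t / h) • B)‖ ≤ 2 := by
      calc ‖NormedSpace.exp ((1 - t / h) • B)‖
          = ‖(NormedSpace.exp ((1 - t / h) • B) - 1) + 1‖ := by rw [sub_add_cancel]
        _ ≤ (Real.exp ‖(1 - t / h) • B‖ - 1) + 1 :=
            (norm_add_le _ _).trans (add_le_add a2 ContinuousLinearMap.norm_id_le)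
        _ ≤ 2 := by linarith
    exact (ContinuousLinearMap.le_opNorm _ _).trans (by gcongr)
  have hder := fun t (ht : t ∈ Set.Icc 0 h) => hasDerivWithinAt_hamF (N := N) hρ' hh.ne'
    (hΓ t ht).1 (hGd t).hasDerivWithinAt (hGc t) (hΓ t ht).2.1 (hΓ t ht).2.2.1 (hΓ t ht).2.2.2.1
  have hM : 0 ≤ M := (norm_nonneg _).trans (hΓ 0 ⟨le_rfl, hh.le⟩).2.2.2.2.1
  have hm : 0 ≤ m := (norm_nonneg _).trans (hΓ 0 ⟨le_rfl, hh.le⟩).2.2.2.2.2.1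
  have hbound : ∀ t ∈ Set.Ico 0 h, ‖2 * (ρ N)⁻¹ * lastForm N (G t) (Γ t) (w t)‖ ≤
      8 * (ρ N)⁻¹ * ‖Z‖ * M ^ (2 * N + 2) * m ^ 2 := by
    intro t ht
    have ht' := Set.Ico_subset_Icc_self ht
    obtain ⟨-, b1, b2, -, b3, b4, b5⟩ := hΓ t ht'
    have c1 := abs_lastForm_le N (G t) b1 b2
    have hρN : 0 < (ρ N)⁻¹ := inv_pos.2 (hρ N)
    rw [norm_mul, Real.norm_eq_abs, Real.norm_eq_abs, abs_of_pos (by positivity)]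
    have c2 : ‖(w t).2‖ ≤ 2 * M ^ 2 * m := b5.trans (by gcongr)
    calc 2 * (ρ N)⁻¹ * |lastForm N (G t) (Γ t) (w t)|
        ≤ 2 * (ρ N)⁻¹ * ((2 * ‖Z‖) * (m * (2 * M ^ 2 * m) * M ^ (2 * N))) := by
          have := hGn t ht'
          refine mul_le_mul_of_nonneg_left (c1.trans ?_) (by positivity)
          gcongr
      _ = _ := by ring
  have := norm_image_sub_le_of_norm_deriv_le_segment' hder hbound h ⟨hh.le, le_rfl⟩
  rw [Real.norm_eq_abs] at this
  have hGh : G h = Z := by simp [hG, hh.ne']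
  have hG0 : G 0 = NormedSpace.exp B Z := by simp [hG]
  rw [hGh, hG0, hΓ0, hamF_linear hρ' lam hlam hL _ h1 h2, hZ, sub_zero, mul_comm] at this
  exact this

end StepInvariant

section PolynomialHamiltonian

variable {d : ℕ}

/-- Alternating signs. -/
def altSign (m : ℕ) : Fin m → ℤˣ := fun i => (-1) ^ (i : ℕ)

lemma momentum_altSign {m : ℕ} (ξ : Fin m → V d) :
    momentum (altSign m) ξ = alt (List.ofFn ξ) := by
  induction m with
  | zero => simp [momentum, alt]
  | succ n ih =>
    rw [momentum, Fin.sum_univ_succ, List.ofFn_succ, alt, ← ih fun i => ξ i.succ, momentum,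
      sub_eq_add_neg, ← Finset.sum_neg_distrib]
    congr 1
    · simp [altSign]
    · refine Finset.sum_congr rfl fun i _ => ?_
      simp [altSign, pow_succ, Units.neg_smul]

lemma zeroMomentum_altSign {m : ℕ} (hm : Odd m) (ξ : Fin m → V d) :
    zeroMomentum (altSign (m + 1)) ξ = pt ξ := by
  have h1 : momentum (fun i => altSign (m + 1) i.castSucc) ξ = alt (List.ofFn ξ) :=
    momentum_altSign ξ
  have h2 : altSign (m + 1) (Fin.last m) = -1 := by
    simp [altSign, hm.neg_one_pow]
  rw [zeroMomentum, h1, h2, Units.neg_smul, one_smul, neg_neg]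
  rfl

lemma coord_altSign (m : ℕ) (φ : V d → ℂ) (i : Fin m) (ξ : V d) :
    coord φ (conjF φ) (altSign m i) ξ = cj i (φ ξ) := by
  rw [coord, cj, altSign]
  by_cases h : Even (i : ℕ)
  · simp [h]
  · have : ((-1 : ℤˣ) ^ (i : ℕ)) ≠ 1 := by
      rw [(Nat.not_even_iff_odd.1 h).neg_one_pow]; decide
    rw [if_neg this, if_neg h]
    rfl

/-- The coefficients of the polynomial Hamiltonian of a vector field. -/
def hamCoeff (κ : ℕ → ℂ) (f : Wd d) (m : ℕ) (δ : Fin (m + 1) → ℤˣ) (ξ : Fin (m + 1) → V d) : ℂ :=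
  if Odd m ∧ δ = altSign (m + 1) then
    κ m * (Complex.I * f (List.ofFn fun i : Fin m => ξ i.castSucc)) else 0

lemma measurable_hamCoeff (κ : ℕ → ℂ) {f : Wd d} (hf : MeasW f) (m : ℕ)
    (δ : Fin (m + 1) → ℤˣ) : Measurable (hamCoeff κ f m δ) := by
  unfold hamCoeff
  split_ifs
  · exact (((hf m).comp (measurable_pi_lambda _ fun i =>
      measurable_pi_apply i.castSucc)).const_mul _).const_mul _
  · exact measurable_const

lemma sum_Ico_odd (g : ℕ → ℂ) (hg : ∀ m, ¬Odd m → g m = 0) (N : ℕ) :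
    ∑ m ∈ Finset.Ico 1 (2 * N + 2), g m = ∑ l ∈ Finset.range (N + 1), g (2 * l + 1) := by
  induction N with
  | zero => simp
  | succ n ih =>
    rw [Finset.sum_range_succ, ← ih, show 2 * (n + 1) + 2 = 2 * n + 2 + 1 + 1 by ring,
      Finset.sum_Ico_succ_top (by omega), Finset.sum_Ico_succ_top (by omega),
      hg (2 * n + 2) (by rw [Nat.not_odd_iff_even]; exact ⟨n + 1, by ring⟩), add_zero]
    rfl

lemma polyEval_hamCoeff (N : ℕ) (κ : ℕ → ℂ) (f : Wd d) (φ : V d → ℂ) :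
    polyEval (2 * N + 2) (hamCoeff κ f) φ (conjF φ) =
      ∑ l ∈ Finset.range (N + 1), κ (2 * l + 1) * form (m := 2 * l + 1) f (fun _ => φ) := by
  have h0 : ∀ m (δ : Fin (m + 1) → ℤˣ), ¬(Odd m ∧ δ = altSign (m + 1)) →
      ∫ ξ : Fin m → V d, hamCoeff κ f m δ (zeroMomentum δ ξ) *
        ∏ i, coord φ (conjF φ) (δ i) (zeroMomentum δ ξ i) = 0 := by
    intro m δ h
    simp [hamCoeff, h]
  rw [polyEval, sum_Ico_odd]
  · refine Finset.sum_congr rfl fun l _ => ?_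
    have hm : Odd (2 * l + 1) := (even_two_mul l).add_one
    rw [Finset.sum_eq_single_of_mem (altSign (2 * l + 1 + 1)) (Finset.mem_univ _)
      fun δ _ hδ => h0 _ _ fun h => hδ h.2]
    rw [form, ← mul_assoc, ← integral_const_mul]
    refine integral_congr_ae (Filter.Eventually.of_forall fun ξ => ?_)
    simp only [zeroMomentum_altSign hm, coord_altSign, hamCoeff, hm, true_and, if_true, tens,
      pt_castSucc]
    ring
  · intro m hm
    exact Finset.sum_eq_zero fun δ _ => h0 _ _ fun h => hm h.1

lemma memLp_two_of_sqNormL2 {s : ℝ} {φ : L1 d} (h : sqNormL2 s φ < ⊤) :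
    MemLp φ 2 (volume : Measure (V d)) := by
  refine ⟨(Lp.stronglyMeasurable φ).aestronglyMeasurable, ?_⟩
  rw [eLpNorm_lt_top_iff_lintegral_rpow_enorm_lt_top (by norm_num) (by norm_num)]
  refine lt_of_le_of_lt (lintegral_mono fun ξ => ?_) h
  rw [ENNReal.toReal_ofNat, ENNReal.rpow_two, ← ofReal_norm,
    ← ENNReal.ofReal_pow (norm_nonneg _)]
  refine ENNReal.ofReal_le_ofReal ?_
  have : 0 ≤ ‖ξ‖ ^ (2 * s) := by positivity
  nlinarith [sq_nonneg ‖φ ξ‖]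

lemma sq_norm_L2 (f : Lp ℂ 2 (volume : Measure (V d))) :
    ENNReal.ofReal (‖f‖ ^ 2) = ∫⁻ ξ, ENNReal.ofReal (‖f ξ‖ ^ 2) := by
  rw [ENNReal.ofReal_pow (norm_nonneg _), ofReal_norm, ← en2_enorm, en2,
    ← ENNReal.rpow_two, ← ENNReal.rpow_mul]
  norm_num

lemma exists_pair {s : ℝ} {φ : L1 d} (h : sqNormL2 s φ < ⊤) : ∃ x : X d, x.1 = φ ∧ Cons x ∧
    ENNReal.ofReal (‖x.2‖ ^ 2) ≤ sqNormL2 s φ := by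
  have hm := memLp_two_of_sqNormL2 h
  refine ⟨(φ, hm.toLp), rfl, hm.coeFn_toLp, ?_⟩
  rw [sq_norm_L2]
  have : ∫⁻ ξ, ENNReal.ofReal (‖hm.toLp φ ξ‖ ^ 2) = ∫⁻ ξ, ENNReal.ofReal (‖φ ξ‖ ^ 2) := by
    refine lintegral_congr_ae ?_
    filter_upwards [hm.coeFn_toLp] with ξ hξ
    rw [hξ]
  show ∫⁻ ξ, ENNReal.ofReal (‖hm.toLp φ ξ‖ ^ 2) ≤ _
  rw [this]
  refine lintegral_mono fun ξ => ENNReal.ofReal_le_ofReal ?_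
  have : 0 ≤ ‖ξ‖ ^ (2 * s) := by positivity
  nlinarith [sq_nonneg ‖φ ξ‖]

lemma Cons.sqNormL2_zero {x : X d} (hx : Cons x) :
    sqNormL2 0 x.1 = ENNReal.ofReal (2 * ‖x.2‖ ^ 2) := by
  rw [ENNReal.ofReal_mul zero_le_two, sq_norm_L2, sqNormL2, ← lintegral_const_mul]
  · refine lintegral_congr_ae ?_
    filter_upwards [hx] with ξ hξ
    rw [hξ, ← ENNReal.ofReal_mul zero_le_two]
    norm_num
  · exact ((Lp.stronglyMeasurable x.2).measurable.norm.pow_const 2).ennreal_ofReal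

lemma norm_le_of_normL1 {s : ℝ} {φ : L1 d} {M : ℝ≥0} (h : normL1 s φ ≤ M) : ‖φ‖ ≤ M := by
  have h1 : ‖φ‖ₑ ≤ M := by
    rw [← lintegral_enorm_L1]
    refine (lintegral_mono fun ξ => ?_).trans h
    rw [← ofReal_norm]
    refine ENNReal.ofReal_le_ofReal ?_
    have : 0 ≤ ‖ξ‖ ^ s := by positivity
    nlinarith [norm_nonneg (φ ξ)]
  rw [enorm_eq_nnnorm] at h1
  exact_mod_cast h1

/-- The polynomial Hamiltonian of a Hamiltonian vector field. -/
def polyHam (N : ℕ) (ρ : ℕ → ℝ) (h : ℝ) (Z : wordSpace d) (hZ : Cyc (wv Z)) : PolyHam d where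
  deg := 2 * N + 2
  coeff := hamCoeff (fun m => (((h * ((((m - 1) / 2 : ℕ) : ℝ) + 1) * ρ ((m - 1) / 2))⁻¹ : ℝ) : ℂ))
    (wv Z)
  measurable_coeff := measurable_hamCoeff _ (measW_wv Z)
  bounded_coeff := by
    set κ : ℕ → ℂ := fun m => (((h * ((((m - 1) / 2 : ℕ) : ℝ) + 1) * ρ ((m - 1) / 2))⁻¹ : ℝ) : ℂ)
    refine ⟨(∑ m ∈ Finset.Ico 1 (2 * N + 2), ‖κ m‖) * ‖Z‖, fun m hm δ ξ _ => ?_⟩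
    have h1 : ‖κ m‖ ≤ ∑ m ∈ Finset.Ico 1 (2 * N + 2), ‖κ m‖ :=
      Finset.single_le_sum (f := fun m => ‖κ m‖) (fun _ _ => norm_nonneg _) hm
    have h0 := (norm_nonneg _).trans h1
    rw [hamCoeff]
    split_ifs
    · rw [norm_mul, norm_mul, Complex.norm_I, one_mul]
      exact mul_le_mul h1 (norm_wv_le Z _) (norm_nonneg _) h0
    · rw [norm_zero]; positivity
  real := fun φ _ => by
    rw [polyEval_hamCoeff, Complex.im_sum]
    refine Finset.sum_eq_zero fun l _ => ?_
    rw [Complex.im_ofReal_mul, im_form_const (even_two_mul l) hZ, mul_zero]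

lemma QM_eq_re {Z : wordSpace d} (hZ : Cyc (wv Z)) (l : ℕ) {x : X d} (hx : Cons x) :
    QM l (fun _ => x) Z = ((QM l (fun _ => x) Z).re : ℂ) := by
  refine Complex.ext rfl ?_
  rw [Complex.ofReal_im, QM_apply, form_slots_const (even_two_mul l) _ hx,
    im_form_const (even_two_mul l) hZ]

lemma eval_polyHam (N : ℕ) (ρ : ℕ → ℝ) (h : ℝ) {Z : wordSpace d} (hZ : Cyc (wv Z)) {x : X d}
    (hx : Cons x) : (polyHam N ρ h Z hZ).eval x.1 = ((h⁻¹ * hamF N ρ Z x : ℝ) : ℂ) := by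
  rw [PolyHam.eval, polyHam, polyEval_hamCoeff, hamF, Finset.mul_sum, Complex.ofReal_sum]
  refine Finset.sum_congr rfl fun l _ => ?_
  have h1 := QM_eq_re hZ l hx
  rw [QM_apply, form_slots_const (even_two_mul l) _ hx] at h1
  rw [QM_apply, form_slots_const (even_two_mul l) _ hx, h1]
  have h2 : (2 * l + 1 - 1) / 2 = l := by omega
  simp only [h2, Complex.ofReal_re]
  rw [← Complex.ofReal_mul]
  congr 1
  rw [mul_assoc h, mul_inv, mul_assoc]

end PolynomialHamiltonian

section LowDegree

variable {d : ℕ}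

lemma integral_fin_one {E : Type*} [NormedAddCommGroup E] [NormedSpace ℝ E] (F : V d → E) :
    ∫ ξ : Fin 1 → V d, F (ξ 0) = ∫ x, F x :=
  (volume_preserving_funUnique (Fin 1) (V d)).integral_comp' F

lemma QM_zero_re (G : wordSpace d) {g : V d → ℝ} {x : X d}
    (hG : ∀ y, wv G [y] = -(Complex.I * g y)) :
    (QM 0 (fun _ => x) G).re = ∫ y, g y * ‖x.2 y‖ ^ 2 := by
  have h1 : QM 0 (fun _ => x) G = ∫ ξ : Fin 1 → V d, ((g (ξ 0) * ‖x.2 (ξ 0)‖ ^ 2 : ℝ) : ℂ) := by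
    rw [QM_apply, form, ← integral_const_mul]
    refine integral_congr_ae (Filter.Eventually.of_forall fun ξ => ?_)
    have e1 : List.ofFn ξ = [ξ 0] := by
      rw [List.ofFn_succ]; simp
    have e2 : pt ξ 0 = ξ 0 := pt_castSucc ξ 0
    have e3 : pt ξ 1 = ξ 0 := by
      have : pt ξ (Fin.last 1) = alt (List.ofFn ξ) := pt_last ξ
      rw [e1] at this
      simpa [alt] using this
    have e4 : ∏ i : Fin (2 * 0 + 1 + 1), cj i (slotFn i x (pt ξ i)) =
        cj 0 (slotFn (0 : Fin 2) x (pt ξ 0)) * cj 1 (slotFn (1 : Fin 2) x (pt ξ 1)) :=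
      Fin.prod_univ_two _
    have e5 : slotFn (1 : Fin 2) x = x.2 := by simp [slotFn]
    have e6 : slotFn (0 : Fin 2) x = x.2 := by simp [slotFn]
    simp only [tens]
    rw [e4, e1, hG, e2, e3, e5, e6, cj_zero, show cj 1 = starRingEnd ℂ from
      funext fun z => by simp [cj], Complex.mul_conj, Complex.normSq_eq_norm_sq]
    push_cast
    linear_combination (-(g (ξ 0) : ℂ) * (‖x.2 (ξ 0)‖ : ℂ) ^ 2) * Complex.I_sq
  rw [h1, integral_fin_one (fun y => ((g y * ‖x.2 y‖ ^ 2 : ℝ) : ℂ)), integral_complex_ofReal,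
    Complex.ofReal_re]

lemma integral_sq_L2 (f : Lp ℂ 2 (volume : Measure (V d))) : ∫ y, ‖f y‖ ^ 2 = ‖f‖ ^ 2 := by
  rw [integral_eq_lintegral_of_nonneg_ae (Filter.Eventually.of_forall fun _ => by positivity)
    ((Lp.stronglyMeasurable f).measurable.norm.pow_const 2).aestronglyMeasurable, ← sq_norm_L2,
    ENNReal.toReal_ofReal (by positivity)]

/-- The frequency one vector field commutes with `P`: conservation of mass. -/
lemma lastForm_mass {ρ : ℕ → ℝ} (hρ : ρ = fun _ => 1) {x w : X d} (hx : Cons x)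
    (hw : w.1 =ᵐ[volume] quarticField x.1) :
    lastForm 0 (aX 1 ρ (fun _ : V d => (1 : ℝ)) measurable_const (L := 1) (by simp)) x w = 0 := by
  have hρ' : ∀ l, ρ l ≠ 0 := by simp [hρ]
  set a := aX 1 ρ (fun _ : V d => (1 : ℝ)) measurable_const (L := 1) (by simp) with ha
  have hc : Cyc (wv a) := mem_cycSub.1 (aX_mem_cycSub _ _ _)
  have h1 := re_QM_bW (N := 1) (l := 0) le_rfl hρ' 1 hc hx hw
  have h2 : bW 1 ρ (pX 1 ρ 1) a = 0 := by
    refine wv_ext fun u => ?_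
    rw [bW_anti, wv_neg, ha, wv_bW_aX hρ', wv_zero]
    split_ifs with hu
    · rw [wv_pX_eq]
      split_ifs with h3
      · have hl : u.length = 3 := by rw [hu.length_eq, h3.2]
        obtain ⟨p, q, r, rfl⟩ := List.length_eq_three.1 hl
        simp [wFreq, altFreq]
      · simp
    · simp
  rw [h2, map_zero, Complex.zero_re] at h1
  simp only [hρ] at h1
  norm_num at h1
  exact h1

lemma norm_flow_eq {h : ℝ} (hh : 0 ≤ h) {Γ w : ℝ → X d}
    (hΓ : ∀ t ∈ Set.Icc 0 h, HasDerivWithinAt Γ (w t) (Set.Icc 0 h) t ∧ Cons (Γ t) ∧ Cons (w t) ∧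
        ((w t).1 =ᵐ[volume] quarticField (Γ t).1)) : ‖(Γ h).2‖ = ‖(Γ 0).2‖ := by
  set ρ : ℕ → ℝ := fun _ => 1 with hρ
  set a := aX 1 ρ (fun _ : V d => (1 : ℝ)) measurable_const (L := 1) (by simp) with ha
  have hc : Cyc (wv a) := mem_cycSub.1 (aX_mem_cycSub _ _ _)
  have hval : ∀ x : X d, (QM 0 (fun _ => x) a).re = ‖x.2‖ ^ 2 := by
    intro x
    rw [QM_zero_re a (g := fun _ => 1), ← integral_sq_L2]
    · simp
    · intro y
      have : InRange 1 [y] := ⟨by simp, by simp⟩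
      rw [ha, wv_aX, tw, if_pos this]
      simp [hρ, aw]
  have hder : ∀ t ∈ Set.Icc 0 h,
      HasDerivWithinAt (fun t => ‖(Γ t).2‖ ^ 2) 0 (Set.Icc 0 h) t := by
    intro t ht
    obtain ⟨b1, b2, b3, b4⟩ := hΓ t ht
    have := hasDerivWithinAt_QM (l := 0) b1 (hasDerivWithinAt_const t (Set.Icc 0 h) a) hc b2 b3
    simp only [hval] at this
    refine this.congr_deriv ?_
    rw [lastForm_mass hρ b2 b4, map_zero, Complex.zero_re]
    simp
  have := constant_of_has_deriv_right_zero (fun t ht => (hder t ht).continuousWithinAt)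
    (fun t ht => hasDerivWithinAt_Ici ht (hder t (Set.Ico_subset_Icc_self ht))) h ⟨hh, le_rfl⟩
  exact (pow_left_inj₀ (norm_nonneg _) (norm_nonneg _) two_ne_zero).1 this

end LowDegree

section FirstModifiedEnergy

variable {d : ℕ}

lemma measurePreserving_triple : MeasurePreserving (fun p : V d × V d × V d =>
    (Fin.cons p.1 (Fin.cons p.2.2 fun _ => p.2.1 : Fin 2 → V d) : Fin 3 → V d)) := by
  have h1 := (Measure.measurePreserving_swap (μ := (volume : Measure (V d)))
    (ν := (volume : Measure (V d))))
  have h2 := (MeasurePreserving.id (volume : Measure (V d))).prod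
    (volume_preserving_funUnique (Fin 1) (V d)).symm
  have h3 := (measurePreserving_cons (d := d) 1).comp (h2.comp h1)
  have h4 := (MeasurePreserving.id (volume : Measure (V d))).prod h3
  have h5 := (measurePreserving_cons (d := d) 2).comp h4
  exact h5

lemma tens_triple (f : Wd d) (φ : V d → ℂ) (p : V d × V d × V d) :
    tens (m := 3) f (fun _ => φ)
      (Fin.cons p.1 (Fin.cons p.2.2 fun _ => p.2.1 : Fin 2 → V d) : Fin 3 → V d) =
      f [p.1, p.2.2, p.2.1] *
        (φ p.1 * φ p.2.1 * conjF φ p.2.2 * conjF φ (p.1 + p.2.1 - p.2.2)) := by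
  set ξ : Fin 3 → V d := Fin.cons p.1 (Fin.cons p.2.2 fun _ => p.2.1 : Fin 2 → V d) with hξ
  have e1 : List.ofFn ξ = [p.1, p.2.2, p.2.1] := by
    simp [List.ofFn_succ, hξ, Fin.cons]
  have e2 : pt ξ 0 = p.1 := pt_castSucc ξ 0
  have e3 : pt ξ 1 = p.2.2 := pt_castSucc ξ 1
  have e4 : pt ξ 2 = p.2.1 := pt_castSucc ξ 2
  have e5 : pt ξ 3 = p.1 + p.2.1 - p.2.2 := by
    have : pt ξ (Fin.last 3) = alt (List.ofFn ξ) := pt_last ξ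
    rw [e1] at this
    refine Eq.trans this ?_
    simp only [alt]
    abel
  have h2 : Even 2 := even_two
  have h3 : ¬Even 3 := by decide
  rw [tens, e1, Fin.prod_univ_four, e2, e3, e4, e5]
  simp only [cj, conjF, Fin.val_zero, Fin.val_one, Fin.val_two, show ((3 : Fin (3 + 1)) : ℕ) = 3 from rfl,
    h2, h3, Nat.not_even_one, Even.zero, if_true, if_false]
  ring

lemma form_three (f : Wd d) (hf : Measurable fun ξ : Fin 3 → V d => f (List.ofFn ξ))
    {φ : V d → ℂ} (hφ : Measurable φ) :
    ∫ p : V d × V d × V d, f [p.1, p.2.2, p.2.1] *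
        (φ p.1 * φ p.2.1 * conjF φ p.2.2 * conjF φ (p.1 + p.2.1 - p.2.2)) =
      -Complex.I * form (m := 3) f (fun _ => φ) := by
  have hm : Measurable (tens (m := 3) f fun _ => φ) :=
    hf.mul (Finset.measurable_prod _ fun i _ => (measurable_cj i).comp (hφ.comp (measurable_pt i)))
  have hp := measurePreserving_triple (d := d)
  have h := integral_map (μ := volume) hp.measurable.aemeasurable hm.aestronglyMeasurable
  rw [hp.map_eq] at h
  rw [form, h, ← mul_assoc]
  simp only [tens_triple, neg_mul, Complex.I_mul_I, neg_neg, one_mul]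

lemma measurable_freq (h : ℝ) : Measurable (freq h : V d → ℝ) := by
  unfold freq filterFun
  fun_prop

lemma measurable_multiplier : Measurable multiplier := by
  unfold multiplier
  refine Measurable.ite (measurableSet_eq) measurable_const ?_
  fun_prop

lemma wFreq_three (lam : V d → ℝ) (x y z : V d) :
    wFreq lam [x, y, z] = lam x + lam z - lam y - lam (x + z - y) := by
  simp only [wFreq, altFreq, alt, sub_zero]
  rw [show x - (y - z) = x + z - y by abel]
  ring

lemma measW_multiplier (h : ℝ) :
    MeasW fun u : List (V d) => multiplier (wFreq (freq h) u) := fun n =>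
  measurable_multiplier.comp ((measW_altFreq (measurable_freq h) n).sub
    ((measurable_freq h).comp (measW_alt n)))

lemma freq_eq {h : ℝ} (hh : 0 < h) (ξ : V d) :
    freq h ξ = h * (1 / √h * Real.arctan (√h * ‖ξ‖ ^ 2)) := by
  have h1 := Real.sqrt_pos.2 hh
  have h2 : h * ‖ξ‖ ^ 2 / √h = √h * ‖ξ‖ ^ 2 := by
    rw [div_eq_iff h1.ne']
    nth_rewrite 1 [← Real.mul_self_sqrt hh.le]
    ring
  rw [freq, filterFun, h2, ← mul_assoc]
  congr 1
  rw [mul_one_div, Real.div_sqrt]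

/-- The quartic part of the first modified energy. -/
def quarticPart (h : ℝ) (x : X d) : ℂ :=
  -Complex.I * form (m := 3) (fun u => multiplier (wFreq (freq h) u)) (fun i => slotFn i x)

lemma firstModifiedEnergy_eq {h : ℝ} (hh : 0 < h) {x : X d} (hx : Cons x) :
    firstModifiedEnergy h x.1 =
      ((h⁻¹ * ∫ y, freq h y * ‖x.2 y‖ ^ 2 : ℝ) : ℂ) + quarticPart h x := by
  rw [firstModifiedEnergy, quarticPart]
  congr 1
  · rw [← integral_const_mul, ← integral_complex_ofReal]
    refine integral_congr_ae ?_
    filter_upwards [hx] with y hy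
    rw [hy, freq_eq hh, mul_assoc h, inv_mul_cancel_left₀ hh.ne']
  · rw [form_slots_const even_two _ hx, ← form_three _ (measW_multiplier h 3)
      (Lp.stronglyMeasurable x.1).measurable]
    refine integral_congr_ae (Filter.Eventually.of_forall fun p => ?_)
    simp only [wFreq_three]

lemma factorial_le (j : ℕ) : (j + 2).factorial ≤ 2 * (j + 2) ^ j := by
  induction j with
  | zero => simp
  | succ n ih =>
    rw [Nat.factorial_succ, show n + 1 + 2 = n + 2 + 1 from rfl]
    calc (n + 2 + 1) * (n + 2).factorial ≤ (n + 2 + 1) * (2 * (n + 2) ^ n) :=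
          Nat.mul_le_mul_left _ ih
      _ ≤ (n + 2 + 1) * (2 * (n + 2 + 1) ^ n) := 
          Nat.mul_le_mul_left _ (Nat.mul_le_mul_left _ (Nat.pow_le_pow_left (by omega) _))
      _ = 2 * (n + 2 + 1) ^ (n + 1) := by ring

/-- The weights of the degrees. -/
def degWeight (h : ℝ) (l : ℕ) : ℝ := ((200 * h) ^ l * (l + 1).factorial)⁻¹

lemma degWeight_pos {h : ℝ} (hh : 0 < h) (l : ℕ) : 0 < degWeight h l := by
  unfold degWeight; positivity

lemma degWeight_ratio {h : ℝ} (hh : 0 < h) (l : ℕ) :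
    degWeight h (l + 1) * (4 * h * (l + 2)) ≤ 1 / 50 * degWeight h l := by
  refine le_of_eq ?_
  rw [degWeight, degWeight, Nat.factorial_succ (l + 1)]
  push_cast
  field_simp
  ring

lemma norm_QM_le (l : ℕ) (G : wordSpace d) {C : ℝ} (hC : ∀ u, u.length = 2 * l + 1 → ‖wv G u‖ ≤ C)
    (x : X d) : ‖QM l (fun _ => x) G‖ ≤ C * (‖x.2‖ * ‖x.2‖ * ‖x.1‖ ^ (2 * l)) := by
  refine (norm_form_le hC fun _ => x).trans_eq ?_
  simp

lemma norm_eval_sub_le {N : ℕ} (hN : 1 ≤ N) {h : ℝ} (hh : 0 < h) {Z : wordSpace d}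
    (hZ : Cyc (wv Z)) (hZ1 : ∀ x, wv Z [x] = degWeight h 0 * -(Complex.I * freq h x))
    (hZ3 : ∀ u, u.length = 3 →
      wv Z u = -(2 * Complex.I * h) * degWeight h 1 * multiplier (wFreq (freq h) u))
    (hZn : ∀ u, u.length ≠ 1 → ‖wv Z u‖ ≤ 2 * (2 * h * degWeight h 1))
    {M : ℝ} (hM : 200 * h * N * M ^ 2 ≤ 1 / 2) {x : X d} (hx : Cons x) (hxM : ‖x.1‖ ≤ M) :
    ‖(polyHam N (degWeight h) h Z hZ).eval x.1 - firstModifiedEnergy h x.1‖ ≤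
      1600 * M ^ 4 * h * ‖x.2‖ ^ 2 := by
  have hw : ∀ l, 0 < degWeight h l := degWeight_pos hh
  set T : ℕ → ℂ := fun l => ((h⁻¹ * ((l + 1) * degWeight h l)⁻¹ : ℝ) : ℂ) * QM l (fun _ => x) Z
    with hT
  have e1 : (polyHam N (degWeight h) h Z hZ).eval x.1 = ∑ l ∈ Finset.range (N + 1), T l := by
    rw [eval_polyHam N _ h hZ hx, hamF, Finset.mul_sum, Complex.ofReal_sum]
    refine Finset.sum_congr rfl fun l _ => ?_
    rw [hT, ← mul_assoc, Complex.ofReal_mul]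
    simp only []
    rw [← QM_eq_re hZ l hx]
  have e0 : T 0 = ((h⁻¹ * ∫ y, freq h y * ‖x.2 y‖ ^ 2 : ℝ) : ℂ) := by
    have h1 : QM 0 (fun _ => x) Z = ((∫ y, freq h y * ‖x.2 y‖ ^ 2 : ℝ) : ℂ) := by
      rw [QM_eq_re hZ 0 hx, QM_zero_re Z (g := freq h)]
      intro y
      rw [hZ1]
      simp [degWeight]
    rw [hT]
    simp only []
    rw [h1, ← Complex.ofReal_mul]
    simp [degWeight]
  have e2 : T 1 = quarticPart h x := by
    have h1 : QM 1 (fun _ => x) Z = (-(2 * Complex.I * h) * degWeight h 1) *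
        form (m := 3) (fun u => multiplier (wFreq (freq h) u)) (fun i => slotFn i x) := by
      rw [QM_apply, ← form_mul_left]
      exact form_congr (fun u hu => by rw [hZ3 u hu]) _
    rw [hT]
    simp only []
    rw [h1, quarticPart]
    have : (degWeight h 1 : ℂ) ≠ 0 := Complex.ofReal_ne_zero.2 (hw 1).ne'
    have : (h : ℂ) ≠ 0 := Complex.ofReal_ne_zero.2 hh.ne'
    push_cast
    field_simp
    ring
  have e3 : (polyHam N (degWeight h) h Z hZ).eval x.1 - firstModifiedEnergy h x.1 =
      ∑ j ∈ Finset.range (N - 1), T (j + 2) := by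
    obtain ⟨n, rfl⟩ : ∃ n, N = n + 1 := ⟨N - 1, by omega⟩
    rw [e1, firstModifiedEnergy_eq hh hx, Finset.sum_range_succ', Finset.sum_range_succ', e0, e2]
    simp only [Nat.add_sub_cancel]
    ring
  have hM0 : 0 ≤ M := (norm_nonneg _).trans hxM
  have hterm : ∀ j ∈ Finset.range (N - 1),
      ‖T (j + 2)‖ ≤ 800 * M ^ 4 * h * ‖x.2‖ ^ 2 * (1 / 2) ^ j := by
    intro j hj
    have hjN : ((j : ℝ) + 2) ≤ N := by
      have := Finset.mem_range.1 hj
      exact_mod_cast (show j + 2 ≤ N by omega)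
    rw [hT]
    simp only []
    rw [norm_mul, Complex.norm_real, Real.norm_of_nonneg (by have := hw (j + 2); positivity)]
    have h1 := norm_QM_le (j + 2) Z (C := 2 * (2 * h * degWeight h 1))
      (fun u hu => hZn u (by omega)) x
    have h2 : (h⁻¹ * (((j + 2 : ℕ) : ℝ) + 1)⁻¹ * (degWeight h (j + 2))⁻¹) * (2 * (2 * h * degWeight h 1)) =
        h⁻¹ / 100 * ((200 * h) ^ (j + 2) * (j + 2).factorial) := by
      rw [degWeight, degWeight, Nat.factorial_succ (j + 2)]
      push_cast
      field_simp
      norm_num [Nat.factorial]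
    have h3 : ((j + 2).factorial : ℝ) ≤ 2 * N ^ j := by
      calc ((j + 2).factorial : ℝ) ≤ 2 * ((j : ℝ) + 2) ^ j := by exact_mod_cast factorial_le j
        _ ≤ 2 * N ^ j := by gcongr
    calc h⁻¹ * ((((j + 2 : ℕ) : ℝ) + 1) * degWeight h (j + 2))⁻¹ * ‖QM (j + 2) (fun _ => x) Z‖
        ≤ h⁻¹ * ((((j + 2 : ℕ) : ℝ) + 1) * degWeight h (j + 2))⁻¹ *
          (2 * (2 * h * degWeight h 1) * (‖x.2‖ * ‖x.2‖ * ‖x.1‖ ^ (2 * (j + 2)))) := by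
          have := hw (j + 2)
          gcongr
      _ = h⁻¹ / 100 * ((200 * h) ^ (j + 2) * (j + 2).factorial) *
          (‖x.2‖ * ‖x.2‖ * ‖x.1‖ ^ (2 * (j + 2))) := by rw [← h2, mul_inv]; ring
      _ ≤ h⁻¹ / 100 * ((200 * h) ^ (j + 2) * (2 * N ^ j)) *
          (‖x.2‖ * ‖x.2‖ * M ^ (2 * (j + 2))) := by gcongr
      _ = 800 * M ^ 4 * h * ‖x.2‖ ^ 2 * (200 * h * N * M ^ 2) ^ j := by
          rw [mul_pow, mul_pow, ← pow_mul, pow_add, mul_add, pow_add]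
          field_simp
          ring
      _ ≤ 800 * M ^ 4 * h * ‖x.2‖ ^ 2 * (1 / 2) ^ j := by gcongr
  rw [e3]
  calc ‖∑ j ∈ Finset.range (N - 1), T (j + 2)‖
      ≤ ∑ j ∈ Finset.range (N - 1), 800 * M ^ 4 * h * ‖x.2‖ ^ 2 * (1 / 2) ^ j :=
        norm_sum_le_of_le _ hterm
    _ = 800 * M ^ 4 * h * ‖x.2‖ ^ 2 * ∑ j ∈ Finset.range (N - 1), (1 / 2 : ℝ) ^ j := by
        rw [Finset.mul_sum]
    _ ≤ 800 * M ^ 4 * h * ‖x.2‖ ^ 2 * 2 := by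
        gcongr
        exact sum_geometric_two_le _
    _ = 1600 * M ^ 4 * h * ‖x.2‖ ^ 2 := by ring

end FirstModifiedEnergy

section ModifiedEnergy

variable {d : ℕ}

lemma norm_exp_neg_I_mul (t : ℝ) : ‖Complex.exp (-Complex.I * t)‖ = 1 := by
  rw [neg_mul, ← mul_neg, mul_comm, ← Complex.ofReal_neg, Complex.norm_exp_ofReal_mul_I]

lemma LinearStep.exists_pair {h : ℝ} {x : X d} {χ : L1 d} (hl : LinearStep h x.1 χ) (hx : Cons x) :
    ∃ x' : X d, x'.1 = χ ∧ Cons x' ∧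
      (x'.2 =ᵐ[volume] fun ξ => Complex.exp (-Complex.I * freq h ξ) * x.2 ξ) ∧
      ‖x'.2‖ = ‖x.2‖ := by
  have hm : Measurable fun ξ : V d => Complex.exp (-Complex.I * freq h ξ) * x.2 ξ := by
    have h1 := measurable_freq (d := d) h
    exact (Complex.measurable_exp.comp ((Complex.measurable_ofReal.comp h1).const_mul _)).mul
      (Lp.stronglyMeasurable x.2).measurable
  have hn : ∀ᵐ ξ : V d, ‖Complex.exp (-Complex.I * freq h ξ) * x.2 ξ‖ = ‖x.2 ξ‖ :=
    Filter.Eventually.of_forall fun ξ => by rw [norm_mul, norm_exp_neg_I_mul, one_mul]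
  have hL : MemLp (fun ξ : V d => Complex.exp (-Complex.I * freq h ξ) * x.2 ξ) 2 :=
    (Lp.memLp x.2).congr_norm hm.aestronglyMeasurable (hn.mono fun _ h => h.symm)
  refine ⟨(χ, hL.toLp), rfl, ?_, hL.coeFn_toLp, ?_⟩
  · refine hL.coeFn_toLp.trans ?_
    filter_upwards [hl, hx] with ξ h1 h2
    rw [h1, h2]
  · rw [Lp.norm_toLp, Lp.norm_def, eLpNorm_congr_norm_ae hn]

lemma abs_freq_le {h : ℝ} (ξ : V d) : |freq h ξ| ≤ 2 * √h := by
  rw [freq, filterFun, abs_mul, abs_of_nonneg (Real.sqrt_nonneg _), mul_comm]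
  refine mul_le_mul_of_nonneg_right ?_ (Real.sqrt_nonneg _)
  rw [abs_le]
  have h1 := Real.arctan_lt_pi_div_two (h * ‖ξ‖ ^ 2 / √h)
  have h2 := Real.neg_pi_div_two_lt_arctan (h * ‖ξ‖ ^ 2 / √h)
  have h3 := Real.pi_le_four
  constructor <;> linarith

lemma factorial_succ_le_pow (n : ℕ) : (n + 1).factorial ≤ (n + 1) ^ n := by
  induction n with
  | zero => simp
  | succ n ih =>
    rw [Nat.factorial_succ, pow_succ']
    exact Nat.mul_le_mul_left _ (ih.trans (Nat.pow_le_pow_left (by omega) _))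

/-- The optimal degree is proportional to `h ^ (-1/2)`. -/
lemma exists_degree {q : ℝ} (hq : 0 < q) (hq' : q ≤ 1 / 600) :
    ∃ N : ℕ, 2 ≤ N ∧ (N + 1) * q ≤ 1 / 200 ∧ 1 / (200 * q) ≤ N + 2 := by
  have h3 : (3 : ℝ) ≤ 1 / (200 * q) := by
    rw [le_div_iff₀ (by positivity)]; linarith
  have h4 : 3 ≤ ⌊1 / (200 * q)⌋₊ := Nat.le_floor (by exact_mod_cast h3)
  obtain ⟨N, hN⟩ : ∃ N, ⌊1 / (200 * q)⌋₊ = N + 1 := ⟨_, (Nat.sub_add_cancel (by omega)).symm⟩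
  refine ⟨N, by omega, ?_, ?_⟩
  · have := Nat.floor_le (show 0 ≤ 1 / (200 * q) by positivity)
    rw [hN, le_div_iff₀ (by positivity)] at this
    push_cast at this
    linarith
  · have := Nat.lt_floor_add_one (1 / (200 * q))
    rw [hN] at this
    push_cast at this
    linarith

/-- At the optimal degree the remainder is exponentially small. -/
lemma remainder_le {q B : ℝ} (hq : 0 < q) (hB : 0 ≤ B) (hqB : q * B ^ 2 ≤ 1 / 3) {N : ℕ}
    (hN2 : 2 ≤ N) (hN : (N + 1) * q ≤ 1 / 200) (hN' : 1 / (200 * q) ≤ N + 2) :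
    (degWeight (q ^ 2) N)⁻¹ * B ^ (2 * N + 2) ≤
      q ^ 2 * (B ^ 6 * Real.exp 4 * Real.exp (-(1 / (200 * q)))) := by
  have h1 : ((N + 1).factorial : ℝ) ≤ (N + 1) ^ N := by exact_mod_cast factorial_succ_le_pow N
  have h2 : (200 * q ^ 2 * (N + 1)) * B ^ 2 ≤ q * B ^ 2 := by
    refine mul_le_mul_of_nonneg_right ?_ (by positivity)
    nlinarith
  obtain ⟨k, rfl⟩ : ∃ k, N = k + 2 := ⟨N - 2, by omega⟩
  have h3 : (1 / 3 : ℝ) ≤ Real.exp (-1) := by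
    rw [Real.exp_neg, one_div]
    exact inv_anti₀ (Real.exp_pos _) (by linarith [Real.exp_one_lt_d9])
  have h4 : (1 / 3 : ℝ) ^ k ≤ Real.exp 4 * Real.exp (-(1 / (200 * q))) := by
    calc (1 / 3 : ℝ) ^ k ≤ Real.exp (-1) ^ k := by gcongr
      _ = Real.exp (-k) := by rw [← Real.exp_nat_mul]; congr 1; ring
      _ ≤ _ := by
        rw [← Real.exp_add, Real.exp_le_exp]
        push_cast at hN'
        linarith
  rw [degWeight, inv_inv]
  calc (200 * q ^ 2) ^ (k + 2) * (k + 2 + 1).factorial * B ^ (2 * (k + 2) + 2)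
      ≤ (200 * q ^ 2) ^ (k + 2) * ((k + 2 : ℕ) + 1) ^ (k + 2) * B ^ (2 * (k + 2) + 2) := by gcongr
    _ = ((200 * q ^ 2 * ((k + 2 : ℕ) + 1)) * B ^ 2) ^ (k + 2) * B ^ 2 := by
        rw [mul_pow _ (B ^ 2), mul_pow _ (((k + 2 : ℕ) : ℝ) + 1), ← pow_mul B, pow_add B]; ring
    _ ≤ (q * B ^ 2) ^ (k + 2) * B ^ 2 := by gcongr
    _ = q ^ 2 * B ^ 6 * (q * B ^ 2) ^ k := by rw [pow_add]; ring
    _ ≤ q ^ 2 * B ^ 6 * (1 / 3) ^ k := by gcongr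
    _ ≤ q ^ 2 * B ^ 6 * (Real.exp 4 * Real.exp (-(1 / (200 * q)))) := by gcongr
    _ = _ := by ring

lemma exp_half_le_two : Real.exp (1 / 2) ≤ 2 := by
  have h1 : Real.exp (1 / 2) ^ 2 = Real.exp 1 := by
    rw [← Real.exp_nat_mul]; norm_num
  have := Real.exp_one_lt_d9
  nlinarith [Real.exp_pos (1 / 2)]

/-- A modified Hamiltonian that is conserved up to exponentially small errors. -/
theorem exists_modified_energy {M : ℝ} (hM : 0 ≤ M) : ∃ h₀ > (0 : ℝ), h₀ ≤ 1 / 360000 ∧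
    ∃ c > (0 : ℝ), ∃ K : ℝ, 0 ≤ K ∧ ∀ h : ℝ, 0 < h → h ≤ h₀ → ∃ H : PolyHam d,
      (∀ x : X d, Cons x → ‖x.1‖ ≤ M →
        ‖H.eval x.1 - firstModifiedEnergy h x.1‖ ≤ K * h * ‖x.2‖ ^ 2) ∧
      ∀ φ : ℕ → L1 d, IsNumericalSolution h φ → (∀ n, ‖φ n‖ ≤ M) →
        ∀ x₀ : X d, Cons x₀ → x₀.1 = φ 0 → ∀ n : ℕ, ∃ x : X d, x.1 = φ n ∧ Cons x ∧
          ‖x.2‖ = ‖x₀.2‖ ∧ ‖H.eval (φ n) - H.eval (φ 0)‖ ≤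
            n * (h * (K * Real.exp (-(2 * c / √h)) * ‖x₀.2‖ ^ 2)) := by
  set B : ℝ := 2 * (M + 1) with hB
  have hB2 : 2 ≤ B := by rw [hB]; linarith
  set q₀ : ℝ := 1 / (600 * B ^ 2) with hq₀
  have hq₀0 : 0 < q₀ := by positivity
  have hq₀B : q₀ * B ^ 2 ≤ 1 / 600 := by rw [hq₀]; field_simp; exact le_rfl
  have hB4 : 4 ≤ B ^ 2 := by nlinarith
  have hq₀' : q₀ ≤ 1 / 2400 := by
    rw [hq₀]
    exact one_div_le_one_div_of_le (by norm_num) (by linarith)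
  refine ⟨q₀ ^ 2, by positivity, ?_, 1 / 400, by norm_num,
    1600 * M ^ 4 + 32 * B ^ 6 * Real.exp 4, by positivity, fun h hh hh₀ => ?_⟩
  · nlinarith
  set q : ℝ := √h with hq
  have hq0 : 0 < q := Real.sqrt_pos.2 hh
  have hqh : h = q ^ 2 := (Real.sq_sqrt hh.le).symm
  have hqq : q ≤ q₀ := by
    rw [hq, ← Real.sqrt_sq hq₀0.le]
    exact Real.sqrt_le_sqrt hh₀
  have hqB : q * B ^ 2 ≤ 1 / 600 := (mul_le_mul_of_nonneg_right hqq (by positivity)).trans hq₀B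
  have hMB : 4 * M ^ 2 ≤ B ^ 2 := by rw [hB]; nlinarith
  have hqM : q * M ^ 2 ≤ 1 / 2400 := by nlinarith
  have hhM : 2 * M ^ 2 * h ≤ 1 / 2 := by rw [hqh]; nlinarith
  obtain ⟨N, hN2, hN, hN'⟩ := exists_degree hq0 (by linarith)
  have hρ : ∀ l, 0 < degWeight h l := degWeight_pos hh
  have hr := degWeight_ratio hh
  obtain ⟨Z, hZ, hZr, hZc, hZ1, hZ3, hZn⟩ := exists_modified_field (d := d) (N := N) (by omega) hρ
    hh.le hr (freq h) (measurable_freq h) (L := 2 * q) abs_freq_le (by linarith)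
  have h1100 : 2 * (2 * h * degWeight h 1) = 1 / 100 := by
    rw [degWeight]
    norm_num [Nat.factorial]
    field_simp
    norm_num
  have hZ1n : ‖Z‖ ≤ 1 := by
    refine norm_le_of_wv zero_le_one fun u => ?_
    by_cases hu : u.length = 1
    · obtain ⟨y, rfl⟩ := List.length_eq_one_iff.1 hu
      rw [hZ1]
      have h1 : degWeight h 0 = 1 := by simp [degWeight]
      have h2 : |freq h y| ≤ 2 * q := abs_freq_le y
      rw [h1, norm_mul, norm_neg, norm_mul, Complex.norm_I, Complex.norm_real, Complex.norm_real]
      simp only [Real.norm_eq_abs, abs_one, one_mul]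
      linarith
    · refine (hZn u hu).trans ?_
      rw [h1100]; norm_num
  refine ⟨polyHam N (degWeight h) h Z hZc, fun x hx hxM => ?_, fun φ hφ hφM x₀ hx₀ hx₀φ n => ?_⟩
  · refine (norm_eval_sub_le (by omega) hh hZc hZ1 hZ3 hZn (M := M) ?_ hx hxM).trans ?_
    · have : 200 * h * N * M ^ 2 = (200 * (N * q)) * (q * M ^ 2) := by rw [hqh]; ring
      rw [this]
      have h1 : 200 * (N * q) ≤ 1 := by linarith
      have h2 : 0 ≤ q * M ^ 2 := by positivity
      nlinarith
    · gcongr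
      have : 0 ≤ 32 * B ^ 6 * Real.exp 4 := by positivity
      linarith
  · induction n with
    | zero => exact ⟨x₀, hx₀φ, hx₀, rfl, by simp⟩
    | succ n ih =>
      obtain ⟨x, hxφ, hx, hxm, hxe⟩ := ih
      obtain ⟨χ, hl, hnl⟩ := hφ n
      rw [← hxφ] at hl
      obtain ⟨x', hx'χ, hx', hx'2, hx'n⟩ := hl.exists_pair hx
      obtain ⟨Γ, w, hΓ0, hΓh, hΓ⟩ := exists_flow hh.le hnl hx' hx'χ
      have h1 : x'.1 =ᵐ[volume] fun ξ => Complex.exp (-Complex.I * freq h ξ) * x.1 ξ := by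
        rw [hx'χ]; exact hl
      have hχM : ‖χ‖ ≤ M := by
        have : ‖χ‖ = ‖x.1‖ := by
          rw [Lp.norm_def, Lp.norm_def]
          congr 1
          refine eLpNorm_congr_norm_ae ?_
          filter_upwards [hl] with ξ hξ
          rw [hξ, norm_mul, norm_exp_neg_I_mul, one_mul]
        rw [this, hxφ]; exact hφM n
      have hexp : Real.exp (2 * ‖χ‖ ^ 2 * h) ≤ 2 := by
        refine (Real.exp_le_exp.2 ?_).trans exp_half_le_two
        exact le_trans (by gcongr) hhM
      have hMB' : M ≤ B := by rw [hB]; linarith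
      have hstep := abs_hamF_step_le hρ hh hr (freq h) (measurable_freq h) (L := 2 * q)
        abs_freq_le hZ hZc h1 hx'2 hΓ0 (M := B) (m := ‖x₀.2‖ * 2) (fun t ht => by
          obtain ⟨a1, a2, a3, a4, a5, a6, a7⟩ := hΓ t ht
          refine ⟨a1, a2, a3, a4, a5.trans ?_, a6.trans ?_, a7.trans ?_⟩
          · calc ‖χ‖ * Real.exp (2 * ‖χ‖ ^ 2 * h) ≤ M * 2 := by gcongr
              _ ≤ B := by rw [hB]; linarith
          · rw [hx'n, hxm]; gcongr
          · have := hχM.trans hMB'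
            gcongr)
      have hcons := (hΓ h ⟨hh.le, le_rfl⟩).2.1
      have hmass : ‖(Γ h).2‖ = ‖x₀.2‖ := by
        rw [norm_flow_eq hh.le fun t ht => ⟨(hΓ t ht).1, (hΓ t ht).2.1, (hΓ t ht).2.2.1,
          (hΓ t ht).2.2.2.1⟩, hΓ0, hx'n, hxm]
      refine ⟨Γ h, hΓh, hcons, hmass, ?_⟩
      have hrem := remainder_le (N := N) hq0 (by linarith) (by linarith : q * B ^ 2 ≤ 1 / 3) hN2 hN hN'
      rw [← hqh] at hrem
      have hstep' : ‖(polyHam N (degWeight h) h Z hZc).eval (φ (n + 1)) -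
          (polyHam N (degWeight h) h Z hZc).eval (φ n)‖ ≤
          h * ((1600 * M ^ 4 + 32 * B ^ 6 * Real.exp 4) * Real.exp (-(2 * (1 / 400) / q)) *
            ‖x₀.2‖ ^ 2) := by
        rw [← hΓh, ← hxφ, eval_polyHam N _ h hZc hcons, eval_polyHam N _ h hZc hx,
          ← Complex.ofReal_sub, Complex.norm_real, ← mul_sub, norm_mul, Real.norm_eq_abs,
          Real.norm_eq_abs, abs_of_pos (inv_pos.2 hh)]
        have e1 : 2 * (1 / 400) / q = 1 / (200 * q) := by
          field_simp; norm_num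
        rw [e1]
        calc h⁻¹ * |hamF N (degWeight h) Z (Γ h) - hamF N (degWeight h) Z x|
            ≤ h⁻¹ * (h * (8 * (degWeight h N)⁻¹ * ‖Z‖ * B ^ (2 * N + 2) * (‖x₀.2‖ * 2) ^ 2)) := by
              gcongr
          _ = 32 * ‖x₀.2‖ ^ 2 * ‖Z‖ * ((degWeight h N)⁻¹ * B ^ (2 * N + 2)) := by
              rw [inv_mul_cancel_left₀ hh.ne']; ring
          _ ≤ 32 * ‖x₀.2‖ ^ 2 * 1 *
              (h * (B ^ 6 * Real.exp 4 * Real.exp (-(1 / (200 * q))))) := by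
              have := hρ N
              gcongr
          _ = h * ((0 + 32 * B ^ 6 * Real.exp 4) * Real.exp (-(1 / (200 * q))) * ‖x₀.2‖ ^ 2) := by
              ring
          _ ≤ _ := by
              gcongr
              positivity
      rw [← sub_add_sub_cancel _ ((polyHam N (degWeight h) h Z hZc).eval (φ n))]
      refine (norm_add_le _ _).trans ?_
      push_cast
      linarith

end ModifiedEnergy

section Multiplier

lemma norm_multiplier_sub_one_le {θ : ℝ} (hθ : |θ| ≤ 1 / 4) : ‖multiplier θ - 1‖ ≤ 2 * |θ| := by
  rw [multiplier]
  split_ifs with h0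
  · simp [h0]
  · set z : ℂ := Complex.I * θ with hz
    have hzn : ‖z‖ = |θ| := by rw [hz, norm_mul, Complex.norm_I, one_mul, Complex.norm_real,
      Real.norm_eq_abs]
    have h1 : ‖Complex.exp z - 1 - z‖ ≤ ‖z‖ ^ 2 :=
      Complex.norm_exp_sub_one_sub_id_le (by rw [hzn]; linarith)
    have h2 : 3 / 4 * |θ| ≤ ‖Complex.exp z - 1‖ := by
      have h3 : ‖z‖ ≤ ‖Complex.exp z - 1‖ + ‖Complex.exp z - 1 - z‖ := by
        have := norm_sub_le (Complex.exp z - 1) (Complex.exp z - 1 - z)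
        rwa [sub_sub_cancel] at this
      rw [hzn] at h1 h3
      nlinarith [abs_nonneg θ]
    have h3 : 0 < |θ| := abs_pos.2 h0
    have h4 : Complex.exp z - 1 ≠ 0 := by
      rw [← norm_pos_iff]; linarith
    rw [div_sub_one h4, norm_div, ← norm_neg, neg_sub, div_le_iff₀ (norm_pos_iff.2 h4)]
    rw [hzn] at h1
    nlinarith

lemma norm_multiplier_le {θ : ℝ} (hθ : |θ| ≤ 1 / 4) : ‖multiplier θ‖ ≤ 2 := by
  have h1 := norm_multiplier_sub_one_le hθ
  have h2 := norm_add_le (multiplier θ - 1) 1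
  rw [sub_add_cancel, norm_one] at h2
  linarith

end Multiplier

section Arctan

lemma arctan_le_self {y : ℝ} (hy : 0 ≤ y) : Real.arctan y ≤ y := by
  have := Real.le_tan (Real.arctan_nonneg.2 hy) (Real.arctan_lt_pi_div_two y)
  rwa [Real.tan_arctan] at this

lemma div_le_arctan {y : ℝ} (hy : 0 ≤ y) : y / (1 + y ^ 2) ≤ Real.arctan y := by
  have h1 := Real.sin_le (x := 2 * Real.arctan y) (by have := Real.arctan_nonneg.2 hy; linarith)
  rw [Real.sin_two_mul, Real.sin_arctan, Real.cos_arctan] at h1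
  have h2 : √(1 + y ^ 2) * √(1 + y ^ 2) = 1 + y ^ 2 := Real.mul_self_sqrt (by positivity)
  have h3 : y / (1 + y ^ 2) = y / √(1 + y ^ 2) * (1 / √(1 + y ^ 2)) := by
    rw [div_mul_div_comm, mul_one, h2]
  rw [h3]
  linarith

lemma self_sub_arctan_le {y : ℝ} (hy : 0 ≤ y) : y - Real.arctan y ≤ y ^ 3 := by
  have h1 := div_le_arctan hy
  have h2 : y - y / (1 + y ^ 2) ≤ y ^ 3 := by
    have : y - y / (1 + y ^ 2) = y ^ 3 / (1 + y ^ 2) := by field_simp; ring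
    rw [this]
    refine div_le_self (by positivity) ?_
    nlinarith [sq_nonneg y]
  linarith

lemma pow_le_one_add_rpow {a t : ℝ} (ha : 0 ≤ a) {n : ℕ} (hn : (n : ℝ) ≤ t) :
    a ^ n ≤ 1 + a ^ t := by
  have h0 : 0 ≤ a ^ t := Real.rpow_nonneg ha t
  rcases le_total a 1 with h | h
  · linarith [pow_le_one₀ ha h (n := n)]
  · have := Real.rpow_le_rpow_of_exponent_le h hn
    rw [Real.rpow_natCast] at this
    linarith

end Arctan

section Frequencies

variable {d : ℕ}

lemma freq_nonneg {h : ℝ} (hh : 0 < h) (ξ : V d) : 0 ≤ freq h ξ := by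
  rw [freq_eq hh]
  have := Real.arctan_nonneg.2 (show 0 ≤ √h * ‖ξ‖ ^ 2 by positivity)
  positivity

lemma freq_le {h : ℝ} (hh : 0 < h) (ξ : V d) : freq h ξ ≤ h * ‖ξ‖ ^ 2 := by
  rw [freq_eq hh]
  have h1 := Real.sqrt_pos.2 hh
  refine mul_le_mul_of_nonneg_left ?_ hh.le
  rw [one_div, inv_mul_le_iff₀ h1]
  exact arctan_le_self (by positivity)

lemma sq_sub_freq_le {h : ℝ} (hh : 0 < h) (ξ : V d) :
    ‖ξ‖ ^ 2 - h⁻¹ * freq h ξ ≤ h * ‖ξ‖ ^ 6 := by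
  have h1 := Real.sqrt_pos.2 hh
  have h2 := self_sub_arctan_le (show 0 ≤ √h * ‖ξ‖ ^ 2 by positivity)
  have h3 : (√h) ^ 2 = h := Real.sq_sqrt hh.le
  rw [freq_eq hh, inv_mul_cancel_left₀ hh.ne']
  calc ‖ξ‖ ^ 2 - 1 / √h * Real.arctan (√h * ‖ξ‖ ^ 2)
      = (√h)⁻¹ * (√h * ‖ξ‖ ^ 2 - Real.arctan (√h * ‖ξ‖ ^ 2)) := by field_simp
    _ ≤ (√h)⁻¹ * (√h * ‖ξ‖ ^ 2) ^ 3 := by gcongr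
    _ = (√h) ^ 2 * ‖ξ‖ ^ 6 := by field_simp
    _ = h * ‖ξ‖ ^ 6 := by rw [h3]

lemma abs_wFreq_three_le {h : ℝ} (hh : h ≤ 1 / 360000) {u : List (V d)}
    (hu : u.length = 3) : |wFreq (freq h) u| ≤ 1 / 4 := by
  obtain ⟨x, y, z, rfl⟩ := List.length_eq_three.1 hu
  have hs : √h ≤ 1 / 600 := by
    rw [Real.sqrt_le_left (by norm_num)]; norm_num; linarith
  have h1 := abs_le.1 (abs_freq_le (h := h) x)
  have h2 := abs_le.1 (abs_freq_le (h := h) y)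
  have h3 := abs_le.1 (abs_freq_le (h := h) z)
  have h4 := abs_le.1 (abs_freq_le (h := h) (x + z - y))
  rw [wFreq_three, abs_le]
  constructor <;> linarith [h1.1, h1.2, h2.1, h2.2, h3.1, h3.2, h4.1, h4.2]

lemma abs_wFreq_three_le_sum {h : ℝ} (hh : 0 < h) (x y z : V d) :
    |wFreq (freq h) [x, y, z]| ≤
      h * ((1 + ‖x‖ ^ 2) * (1 + ‖y‖ ^ 2) * (1 + ‖z‖ ^ 2) * (1 + ‖x + z - y‖ ^ 2)) := by
  have e : ∀ ξ : V d, 0 ≤ freq h ξ ∧ freq h ξ ≤ h * ‖ξ‖ ^ 2 := fun ξ =>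
    ⟨freq_nonneg hh ξ, freq_le hh ξ⟩
  have h1 := e x
  have h2 := e y
  have h3 := e z
  have h4 := e (x + z - y)
  have h5 : ‖x‖ ^ 2 + ‖y‖ ^ 2 + ‖z‖ ^ 2 + ‖x + z - y‖ ^ 2 ≤
      (1 + ‖x‖ ^ 2) * (1 + ‖y‖ ^ 2) * (1 + ‖z‖ ^ 2) * (1 + ‖x + z - y‖ ^ 2) := by
    have key : ∀ a b : ℝ, 0 ≤ a → 0 ≤ b → 1 + (a + b) ≤ (1 + a) * (1 + b) := by
      intro a b ha hb; nlinarith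
    have p1 := key (‖x‖ ^ 2) (‖y‖ ^ 2) (by positivity) (by positivity)
    have p2 := key (‖x‖ ^ 2 + ‖y‖ ^ 2) (‖z‖ ^ 2) (by positivity) (by positivity)
    have p3 := key (‖x‖ ^ 2 + ‖y‖ ^ 2 + ‖z‖ ^ 2) (‖x + z - y‖ ^ 2) (by positivity) (by positivity)
    calc _ ≤ 1 + (‖x‖ ^ 2 + ‖y‖ ^ 2 + ‖z‖ ^ 2 + ‖x + z - y‖ ^ 2) := by linarith
      _ ≤ _ := p3
      _ ≤ _ := by
        gcongr
        refine p2.trans ?_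
        gcongr
  rw [wFreq_three, abs_le]
  constructor <;> nlinarith [mul_le_mul_of_nonneg_left h5 hh.le]

lemma norm_quarticPart_le {h : ℝ} (hh : h ≤ 1 / 360000) (x : X d) :
    ‖quarticPart h x‖ ≤ 2 * (‖x.2‖ ^ 2 * ‖x.1‖ ^ 2) := by
  rw [quarticPart, norm_mul, norm_neg, Complex.norm_I, one_mul]
  refine (norm_form_le (n := 2) (C := 2)
    (fun u hu => norm_multiplier_le (abs_wFreq_three_le hh hu)) fun _ => x).trans_eq ?_
  simp only [Finset.prod_const, Finset.card_univ, Fintype.card_fin]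
  ring

end Frequencies

section QuadraticPart

variable {d : ℕ}

/-- The quadratic part of the first modified energy. -/
def quadraticPart (h : ℝ) (x : X d) : ℝ := h⁻¹ * ∫ y, freq h y * ‖x.2 y‖ ^ 2

lemma measurable_sq_L2 (f : Lp ℂ 2 (volume : Measure (V d))) : Measurable fun y => ‖f y‖ ^ 2 :=
  (Lp.stronglyMeasurable f).measurable.norm.pow_const 2

lemma ofReal_quadraticPart {h : ℝ} (hh : 0 < h) (x : X d) :
    ENNReal.ofReal (quadraticPart h x) =
      ∫⁻ y, ENNReal.ofReal (h⁻¹ * freq h y * ‖x.2 y‖ ^ 2) := by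
  have hsq : Integrable fun y => ‖x.2 y‖ ^ 2 :=
    (memLp_two_iff_integrable_sq_norm (Lp.stronglyMeasurable x.2).aestronglyMeasurable).1
      (Lp.memLp x.2)
  have hint : Integrable fun y => h⁻¹ * freq h y * ‖x.2 y‖ ^ 2 := by
    refine hsq.bdd_mul (c := h⁻¹ * (2 * √h))
      ((measurable_freq h).const_mul _).aestronglyMeasurable
      (Filter.Eventually.of_forall fun y => ?_)
    rw [norm_mul, Real.norm_of_nonneg (by positivity)]
    have : ‖freq h y‖ ≤ 2 * √h := abs_freq_le y
    gcongr
  rw [← ofReal_integral_eq_lintegral_ofReal hint (Filter.Eventually.of_forall fun y => by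
    have := freq_nonneg hh y
    positivity), quadraticPart, ← integral_const_mul]
  simp only [mul_assoc]

lemma quadraticPart_nonneg {h : ℝ} (hh : 0 < h) (x : X d) : 0 ≤ quadraticPart h x :=
  mul_nonneg (inv_nonneg.2 hh.le) (integral_nonneg fun y =>
    mul_nonneg (freq_nonneg hh y) (by positivity))

lemma quadraticPart_le {h : ℝ} (hh : 0 < h) {x : X d} (hx : Cons x) {R : ℝ≥0}
    (hR : sqNormL2 1 x.1 ≤ R) : quadraticPart h x ≤ R := by
  have h1 : ENNReal.ofReal (quadraticPart h x) ≤ R := by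
    rw [ofReal_quadraticPart hh]
    refine (lintegral_mono_ae ?_).trans hR
    filter_upwards [hx] with y hy
    rw [hy]
    refine ENNReal.ofReal_le_ofReal (mul_le_mul_of_nonneg_right ?_ (by positivity))
    have h2 := freq_le hh y
    rw [mul_one, Real.rpow_two, inv_mul_le_iff₀ hh]
    nlinarith
  rw [← ENNReal.ofReal_coe_nnreal] at h1
  exact (ENNReal.ofReal_le_ofReal_iff R.coe_nonneg).1 h1

lemma sq_rpow_neg_quarter {h : ℝ} (hh : 0 < h) :
    √h * (h ^ (-(1 / 4) : ℝ)) ^ 2 = 1 := by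
  rw [Real.sqrt_eq_rpow, ← Real.rpow_natCast, ← Real.rpow_mul hh.le, ← Real.rpow_add hh]
  norm_num

lemma sq_le_of_low {h α : ℝ} (hh : 0 < h) {ξ : V d}
    (hξ : ‖ξ‖ ≤ α * h ^ (-(1 / 4) : ℝ)) : ‖ξ‖ ^ 2 ≤ (1 + α ^ 4) * (h⁻¹ * freq h ξ) := by
  have hs := Real.sqrt_pos.2 hh
  set y : ℝ := √h * ‖ξ‖ ^ 2 with hy
  have hy0 : 0 ≤ y := by positivity
  have hyα : y ≤ α ^ 2 := by
    calc y ≤ √h * (α * h ^ (-(1 / 4) : ℝ)) ^ 2 := by rw [hy]; gcongr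
      _ = α ^ 2 * (√h * (h ^ (-(1 / 4) : ℝ)) ^ 2) := by ring
      _ = α ^ 2 := by rw [sq_rpow_neg_quarter hh, mul_one]
  have h1 := div_le_arctan hy0
  rw [div_le_iff₀ (by positivity)] at h1
  have h2 : 1 + y ^ 2 ≤ 1 + α ^ 4 := by nlinarith
  have h3 : y ≤ Real.arctan y * (1 + α ^ 4) :=
    h1.trans (mul_le_mul_of_nonneg_left h2 (Real.arctan_nonneg.2 hy0))
  rw [freq_eq hh, inv_mul_cancel_left₀ hh.ne']
  calc ‖ξ‖ ^ 2 = 1 / √h * y := by rw [hy]; field_simp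
    _ ≤ 1 / √h * (Real.arctan y * (1 + α ^ 4)) := by gcongr
    _ = _ := by ring

lemma one_div_sqrt_le_of_high {h α : ℝ} (hh : 0 < h) (hα : 0 < α) {ξ : V d}
    (hξ : α * h ^ (-(1 / 4) : ℝ) ≤ ‖ξ‖) :
    1 / √h ≤ (Real.arctan (α ^ 2))⁻¹ * (h⁻¹ * freq h ξ) := by
  have hs := Real.sqrt_pos.2 hh
  have hyα : α ^ 2 ≤ √h * ‖ξ‖ ^ 2 := by
    calc α ^ 2 = α ^ 2 * (√h * (h ^ (-(1 / 4) : ℝ)) ^ 2) := by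
          rw [sq_rpow_neg_quarter hh, mul_one]
      _ = √h * (α * h ^ (-(1 / 4) : ℝ)) ^ 2 := by ring
      _ ≤ √h * ‖ξ‖ ^ 2 := by gcongr
  have ha : 0 < Real.arctan (α ^ 2) := Real.arctan_pos.2 (by positivity)
  rw [freq_eq hh, inv_mul_cancel_left₀ hh.ne', le_inv_mul_iff₀ ha, mul_comm]
  exact mul_le_mul_of_nonneg_left (Real.arctan_strictMono.monotone hyα) (by positivity)

lemma low_high_le {h α : ℝ} (hh : 0 < h) (hα : 0 < α) {x : X d} (hx : Cons x) :
    (∫⁻ ξ in {ξ : V d | ‖ξ‖ ≤ α * h ^ (-(1 / 4) : ℝ)}, ENNReal.ofReal (‖ξ‖ ^ 2 * ‖x.1 ξ‖ ^ 2)) +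
      ENNReal.ofReal (1 / √h) * (∫⁻ ξ in {ξ : V d | α * h ^ (-(1 / 4) : ℝ) ≤ ‖ξ‖},
        ENNReal.ofReal (‖x.1 ξ‖ ^ 2)) ≤
      ENNReal.ofReal ((1 + α ^ 4 + (Real.arctan (α ^ 2))⁻¹) * quadraticPart h x) := by
  have ha : 0 < Real.arctan (α ^ 2) := Real.arctan_pos.2 (by positivity)
  have hm : Measurable fun y => ENNReal.ofReal (h⁻¹ * freq h y * ‖x.2 y‖ ^ 2) :=
    (((measurable_freq h).const_mul _).mul (measurable_sq_L2 x.2)).ennreal_ofReal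
  rw [add_mul, ENNReal.ofReal_add (mul_nonneg (by positivity) (quadraticPart_nonneg hh x))
    (mul_nonneg (by positivity) (quadraticPart_nonneg hh x)),
    ENNReal.ofReal_mul (by positivity), ENNReal.ofReal_mul (by positivity),
    ofReal_quadraticPart hh]
  refine add_le_add ?_ ?_
  · rw [← lintegral_const_mul _ hm]
    refine le_trans (setLIntegral_mono_ae ?_ ?_) (setLIntegral_le_lintegral _ _)
    · exact (hm.const_mul _).aemeasurable
    · filter_upwards [hx] with ξ hξ hl
      rw [hξ, ← ENNReal.ofReal_mul (by positivity), ← mul_assoc]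
      exact ENNReal.ofReal_le_ofReal
        (mul_le_mul_of_nonneg_right (sq_le_of_low hh hl) (by positivity))
  · rw [← lintegral_const_mul' _ _ ENNReal.ofReal_ne_top, ← lintegral_const_mul _ hm]
    refine le_trans (setLIntegral_mono_ae ?_ ?_) (setLIntegral_le_lintegral _ _)
    · exact (hm.const_mul _).aemeasurable
    · filter_upwards [hx] with ξ hξ hl
      rw [hξ, ← ENNReal.ofReal_mul (by positivity), ← ENNReal.ofReal_mul (by positivity),
        ← mul_assoc]
      exact ENNReal.ofReal_le_ofReal
        (mul_le_mul_of_nonneg_right (one_div_sqrt_le_of_high hh hα hl) (by positivity))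

end QuadraticPart

section OriginalEnergy

variable {d : ℕ}

lemma norm_sq_le_weight {s : ℝ} (hs : 3 ≤ s) (ξ : V d) : ‖ξ‖ ^ 2 ≤ 1 + ‖ξ‖ ^ (2 * s) :=
  pow_le_one_add_rpow (norm_nonneg _) (by push_cast; linarith)

lemma integral_sub_freq_le {h : ℝ} (hh : 0 < h) {s : ℝ} (hs : 3 ≤ s) {x : X d} (hx : Cons x)
    {R : ℝ≥0} (hR : sqNormL2 s x.1 ≤ R) :
    ‖(∫ ξ : V d, ((‖ξ‖ ^ 2 * ‖x.1 ξ‖ ^ 2 : ℝ) : ℂ)) - (quadraticPart h x : ℂ)‖ ≤ R * h := by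
  have hmφ : Measurable fun ξ => ‖x.1 ξ‖ ^ 2 :=
    (Lp.stronglyMeasurable x.1).measurable.norm.pow_const 2
  have hmw : Measurable fun ξ : V d => (1 + ‖ξ‖ ^ (2 * s)) * ‖x.1 ξ‖ ^ 2 :=
    (measurable_const.add (measurable_norm.pow_const _)).mul hmφ
  have hw0 : ∀ ξ : V d, 0 ≤ (1 + ‖ξ‖ ^ (2 * s)) * ‖x.1 ξ‖ ^ 2 := fun ξ => by positivity
  have hW : Integrable fun ξ : V d => (1 + ‖ξ‖ ^ (2 * s)) * ‖x.1 ξ‖ ^ 2 := by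
    refine ⟨hmw.aestronglyMeasurable, ?_⟩
    rw [hasFiniteIntegral_iff_ofReal (Filter.Eventually.of_forall hw0)]
    exact lt_of_le_of_lt hR ENNReal.coe_lt_top
  have hWR : ∫ ξ : V d, (1 + ‖ξ‖ ^ (2 * s)) * ‖x.1 ξ‖ ^ 2 ≤ (R : ℝ) := by
    rw [integral_eq_lintegral_of_nonneg_ae (Filter.Eventually.of_forall hw0)
      hmw.aestronglyMeasurable]
    exact ENNReal.toReal_le_of_le_ofReal R.coe_nonneg (by rwa [ENNReal.ofReal_coe_nnreal])
  have hA : Integrable fun ξ : V d => ‖ξ‖ ^ 2 * ‖x.1 ξ‖ ^ 2 := by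
    refine hW.mono' ((measurable_norm.pow_const 2).mul hmφ).aestronglyMeasurable
      (Filter.Eventually.of_forall fun ξ => ?_)
    rw [Real.norm_of_nonneg (by positivity)]
    exact mul_le_mul_of_nonneg_right (norm_sq_le_weight hs ξ) (by positivity)
  have hB : Integrable fun ξ : V d => h⁻¹ * freq h ξ * ‖x.1 ξ‖ ^ 2 := by
    refine hA.mono' (((measurable_freq h).const_mul _).mul hmφ).aestronglyMeasurable
      (Filter.Eventually.of_forall fun ξ => ?_)
    have := freq_nonneg hh ξ
    rw [Real.norm_of_nonneg (by positivity)]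
    refine mul_le_mul_of_nonneg_right ?_ (by positivity)
    rw [inv_mul_le_iff₀ hh]
    exact freq_le hh ξ
  have hQ : quadraticPart h x = ∫ ξ : V d, h⁻¹ * freq h ξ * ‖x.1 ξ‖ ^ 2 := by
    rw [quadraticPart, ← integral_const_mul]
    refine integral_congr_ae ?_
    filter_upwards [hx] with ξ hξ
    rw [hξ, mul_assoc]
  rw [integral_complex_ofReal, ← Complex.ofReal_sub, Complex.norm_real, hQ, ← integral_sub hA hB]
  refine (norm_integral_le_of_norm_le (hW.const_mul h) (Filter.Eventually.of_forall fun ξ => ?_)).trans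
    ?_
  · have h1 := sq_sub_freq_le hh ξ
    have h2 : h⁻¹ * freq h ξ ≤ ‖ξ‖ ^ 2 := by
      rw [inv_mul_le_iff₀ hh]; exact freq_le hh ξ
    have h3 : ‖ξ‖ ^ 6 ≤ 1 + ‖ξ‖ ^ (2 * s) :=
      pow_le_one_add_rpow (norm_nonneg _) (by push_cast; linarith)
    rw [← sub_mul, Real.norm_of_nonneg (mul_nonneg (by linarith) (by positivity)), ← mul_assoc]
    refine mul_le_mul_of_nonneg_right (h1.trans ?_) (by positivity)
    gcongr
  · rw [integral_const_mul, mul_comm]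
    gcongr

lemma norm_form_multiplier_sub_one_le {h : ℝ} (hh : 0 < h) (hh' : h ≤ 1 / 360000) {s : ℝ}
    (hs : 3 ≤ s) {φ : L1 d} {M R : ℝ≥0} (hM : normL1 s φ ≤ M) (hR : sqNormL2 s φ ≤ R) :
    ‖form (m := 3) (fun u => multiplier (wFreq (freq h) u) - 1) (fun _ => φ)‖ ≤
      32 * R * M ^ 2 * h := by
  set a : V d → ℝ≥0∞ := fun ξ => ENNReal.ofReal ((1 + ‖ξ‖ ^ 2) * ‖φ ξ‖) with ha
  have hφ : Measurable fun ξ => ‖φ ξ‖ := (Lp.stronglyMeasurable φ).measurable.norm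
  have ham : Measurable a :=
    ((measurable_const.add (measurable_norm.pow_const 2)).mul hφ).ennreal_ofReal
  have ha1 : ∫⁻ ξ, a ξ ≤ ENNReal.ofReal (2 * M) := by
    rw [ENNReal.ofReal_mul zero_le_two, ENNReal.ofReal_coe_nnreal]
    refine le_trans ?_ (mul_le_mul_right hM _)
    rw [normL1, ← lintegral_const_mul' _ _ ENNReal.ofReal_ne_top]
    refine lintegral_mono fun ξ => ?_
    rw [← ENNReal.ofReal_mul zero_le_two, ← mul_assoc]
    refine ENNReal.ofReal_le_ofReal (mul_le_mul_of_nonneg_right ?_ (norm_nonneg _))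
    have h1 : ‖ξ‖ ^ 2 ≤ 1 + ‖ξ‖ ^ s :=
      pow_le_one_add_rpow (norm_nonneg _) (by push_cast; linarith)
    have h2 : 0 ≤ ‖ξ‖ ^ s := by positivity
    linarith
  have ha2 : en2 a * en2 a ≤ ENNReal.ofReal (4 * R) := by
    rw [en2, ← ENNReal.rpow_add_of_nonneg _ _ (by norm_num) (by norm_num)]
    norm_num only [add_halves, ENNReal.rpow_one]
    rw [ENNReal.ofReal_mul (by norm_num), ENNReal.ofReal_coe_nnreal]
    refine le_trans ?_ (mul_le_mul_right hR _)
    rw [sqNormL2, ← lintegral_const_mul' _ _ ENNReal.ofReal_ne_top]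
    refine lintegral_mono fun ξ => ?_
    rw [ha, ENNReal.rpow_two, ← ENNReal.ofReal_pow (by positivity),
      ← ENNReal.ofReal_mul (by norm_num), ← mul_assoc, mul_pow]
    refine ENNReal.ofReal_le_ofReal (mul_le_mul_of_nonneg_right ?_ (by positivity))
    have h1 : ‖ξ‖ ^ 4 ≤ 1 + ‖ξ‖ ^ (2 * s) :=
      pow_le_one_add_rpow (norm_nonneg _) (by push_cast; linarith)
    have h2 : 0 ≤ ‖ξ‖ ^ (2 * s) := by positivity
    nlinarith [sq_nonneg (‖ξ‖ ^ 2 - 1)]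
  rw [form, norm_mul, Complex.norm_I, one_mul]
  refine (norm_integral_le_lintegral_norm _).trans
    (ENNReal.toReal_le_of_le_ofReal (by positivity) ?_)
  have key : ∀ ξ : Fin 3 → V d,
      ENNReal.ofReal ‖tens (m := 3) (fun u => multiplier (wFreq (freq h) u) - 1) (fun _ => φ) ξ‖ ≤
        ENNReal.ofReal (2 * h) * ∏ i, a (pt ξ i) := by
    intro ξ
    have e : List.ofFn ξ = [ξ 0, ξ 1, ξ 2] := by simp [List.ofFn_succ]
    have e1 : pt ξ 0 = ξ 0 := pt_castSucc ξ 0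
    have e2 : pt ξ 1 = ξ 1 := pt_castSucc ξ 1
    have e3 : pt ξ 2 = ξ 2 := pt_castSucc ξ 2
    have e4 : pt ξ 3 = ξ 0 + ξ 2 - ξ 1 := by
      have : pt ξ (Fin.last 3) = alt (List.ofFn ξ) := pt_last ξ
      rw [e] at this
      refine Eq.trans this ?_
      simp only [alt]
      abel
    rw [ha, ← ENNReal.ofReal_prod_of_nonneg fun i _ => by positivity,
      ← ENNReal.ofReal_mul (by positivity)]
    refine ENNReal.ofReal_le_ofReal ?_
    have h1 : ‖multiplier (wFreq (freq h) (List.ofFn ξ)) - 1‖ ≤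
        2 * (h * ∏ i, (1 + ‖pt ξ i‖ ^ 2)) := by
      refine (norm_multiplier_sub_one_le (abs_wFreq_three_le hh' List.length_ofFn)).trans ?_
      refine mul_le_mul_of_nonneg_left ?_ zero_le_two
      rw [e, Fin.prod_univ_four, e1, e2, e3, e4]
      exact abs_wFreq_three_le_sum hh _ _ _
    rw [tens, norm_mul, norm_prod, Finset.prod_mul_distrib]
    simp only [norm_cj]
    rw [show 2 * h * ((∏ i, (1 + ‖pt ξ i‖ ^ 2)) * ∏ i, ‖φ (pt ξ i)‖) =
      2 * (h * ∏ i, (1 + ‖pt ξ i‖ ^ 2)) * ∏ i, ‖φ (pt ξ i)‖ by ring]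
    exact mul_le_mul_of_nonneg_right h1 (Finset.prod_nonneg fun i _ => norm_nonneg _)
  calc ∫⁻ ξ : Fin 3 → V d, ENNReal.ofReal
        ‖tens (m := 3) (fun u => multiplier (wFreq (freq h) u) - 1) (fun _ => φ) ξ‖
      ≤ ∫⁻ ξ : Fin 3 → V d, ENNReal.ofReal (2 * h) * ∏ i, a (pt ξ i) := lintegral_mono key
    _ = ENNReal.ofReal (2 * h) * ∫⁻ ξ : Fin 3 → V d, ∏ i, a (pt ξ i) :=
        lintegral_const_mul' _ _ ENNReal.ofReal_ne_top
    _ ≤ ENNReal.ofReal (2 * h) * (en2 a * en2 a * ∏ i : Fin 2, ∫⁻ x, a x) := by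
        gcongr
        exact lintegral_pt_le (n := 2) (fun _ => a) fun _ => ham
    _ ≤ ENNReal.ofReal (2 * h) * (ENNReal.ofReal (4 * R) *
          ∏ i : Fin 2, ENNReal.ofReal (2 * M)) := by
        gcongr
    _ = ENNReal.ofReal (32 * R * M ^ 2 * h) := by
        rw [Finset.prod_const, Finset.card_univ, Fintype.card_fin,
          ← ENNReal.ofReal_pow (by positivity), ← ENNReal.ofReal_mul (by positivity),
          ← ENNReal.ofReal_mul (by positivity)]
        congr 1
        ring

lemma energy_eq (φ : L1 d) : energy φ = (∫ ξ : V d, ((‖ξ‖ ^ 2 * ‖φ ξ‖ ^ 2 : ℝ) : ℂ)) +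
    -Complex.I * form (m := 3) (fun _ => 1) (fun _ => φ) := by
  rw [energy, quartic, ← form_three _ measurable_const (Lp.stronglyMeasurable φ).measurable]
  simp only [one_mul]

lemma norm_energy_sub_le {h : ℝ} (hh : 0 < h) (hh' : h ≤ 1 / 360000) {s : ℝ} (hs : 3 ≤ s)
    {x : X d} (hx : Cons x) {M R : ℝ≥0} (hM : normL1 s x.1 ≤ M) (hR : sqNormL2 s x.1 ≤ R) :
    ‖energy x.1 - firstModifiedEnergy h x.1‖ ≤ (R + 32 * R * M ^ 2) * h := by
  have h1 : form (m := 3) (fun u => multiplier (wFreq (freq h) u)) (fun i => slotFn i x) =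
      form (m := 3) (fun u => multiplier (wFreq (freq h) u) - 1) (fun _ => ⇑x.1) +
        form (m := 3) (fun _ => 1) (fun _ => ⇑x.1) := by
    rw [← form_slots_const even_two _ hx, ← form_slots_const even_two _ hx,
      ← form_add (n := 2) (C := 3) (C' := 1) (fun n => (measW_multiplier h n).sub_const 1)
        (measW_const 1)]
    · simp only [sub_add_cancel]
    · intro u hu
      refine (norm_sub_le _ _).trans ?_
      have := norm_multiplier_le (abs_wFreq_three_le hh' hu)
      rw [norm_one]
      linarith
    · intro u _
      rw [norm_one]
  have h2 := integral_sub_freq_le hh hs hx hR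
  have h3 := norm_form_multiplier_sub_one_le hh hh' hs hM hR
  have h4 : energy x.1 - firstModifiedEnergy h x.1 =
      ((∫ ξ : V d, ((‖ξ‖ ^ 2 * ‖x.1 ξ‖ ^ 2 : ℝ) : ℂ)) - (quadraticPart h x : ℂ)) +
        Complex.I * form (m := 3) (fun u => multiplier (wFreq (freq h) u) - 1) (fun _ => ⇑x.1) := by
    rw [energy_eq, firstModifiedEnergy_eq hh hx, quarticPart, h1, quadraticPart]
    ring
  rw [h4]
  refine (norm_add_le _ _).trans ?_
  rw [norm_mul, Complex.norm_I, one_mul]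
  linarith

end OriginalEnergy

section LongTime

variable {d : ℕ}

instance : Nonempty (PolyHam d) :=
  ⟨{ deg := 0
     coeff := 0
     measurable_coeff := fun _ _ => measurable_const
     bounded_coeff := ⟨0, by simp⟩
     real := fun φ _ => by simp [polyEval] }⟩

lemma exp_neg_div_le {c q : ℝ} (hc : 0 < c) (hq : 0 < q) :
    Real.exp (-c / q) ≤ 2 / c ^ 2 * q ^ 2 := by
  have h1 := Real.quadratic_le_exp_of_nonneg (show 0 ≤ c / q by positivity)
  have h2 : (c / q) ^ 2 / 2 ≤ Real.exp (c / q) := by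
    have : 0 ≤ c / q := by positivity
    linarith
  rw [neg_div, Real.exp_neg]
  calc (Real.exp (c / q))⁻¹ ≤ ((c / q) ^ 2 / 2)⁻¹ := inv_anti₀ (by positivity) h2
    _ = 2 / c ^ 2 * q ^ 2 := by field_simp

/-- Conservation of the modified energies over exponentially long times. -/
theorem exists_conserved_energy {M : ℝ} (hM : 0 ≤ M) : ∃ h₀ > (0 : ℝ), h₀ ≤ 1 / 360000 ∧
    ∃ c > (0 : ℝ), ∃ K : ℝ, 0 ≤ K ∧ ∃ H : ℝ → PolyHam d, ∀ h : ℝ, 0 < h → h ≤ h₀ →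
      (∀ x : X d, Cons x → ‖x.1‖ ≤ M →
        ‖(H h).eval x.1 - firstModifiedEnergy h x.1‖ ≤ K * h * ‖x.2‖ ^ 2) ∧
      ∀ φ : ℕ → L1 d, IsNumericalSolution h φ → (∀ n, ‖φ n‖ ≤ M) →
        ∀ x₀ : X d, Cons x₀ → x₀.1 = φ 0 → ∀ n : ℕ, n * h ≤ Real.exp (c / √h) →
          ∃ x : X d, x.1 = φ n ∧ Cons x ∧ ‖x.2‖ = ‖x₀.2‖ ∧
            ‖(H h).eval (φ n) - (H h).eval (φ 0)‖ ≤
              K * ‖x₀.2‖ ^ 2 * Real.exp (-c / √h) ∧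
            ‖firstModifiedEnergy h (φ n) - firstModifiedEnergy h (φ 0)‖ ≤
              K * (2 + 2 / c ^ 2) * ‖x₀.2‖ ^ 2 * h := by
  obtain ⟨h₀, hh₀, hh₀', c, hc, K, hK, hH⟩ := exists_modified_energy (d := d) hM
  refine ⟨h₀, hh₀, hh₀', c, hc, K, hK, ?_⟩
  have hH' : ∀ h : ℝ, ∃ H : PolyHam d, ∀ (_ : 0 < h) (_ : h ≤ h₀),
      (∀ x : X d, Cons x → ‖x.1‖ ≤ M →
        ‖H.eval x.1 - firstModifiedEnergy h x.1‖ ≤ K * h * ‖x.2‖ ^ 2) ∧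
      ∀ φ : ℕ → L1 d, IsNumericalSolution h φ → (∀ n, ‖φ n‖ ≤ M) →
        ∀ x₀ : X d, Cons x₀ → x₀.1 = φ 0 → ∀ n : ℕ, ∃ x : X d, x.1 = φ n ∧ Cons x ∧
          ‖x.2‖ = ‖x₀.2‖ ∧ ‖H.eval (φ n) - H.eval (φ 0)‖ ≤
            n * (h * (K * Real.exp (-(2 * c / √h)) * ‖x₀.2‖ ^ 2)) := by
    intro h
    by_cases hb : 0 < h ∧ h ≤ h₀
    · obtain ⟨H, hH1⟩ := hH h hb.1 hb.2
      exact ⟨H, fun _ _ => hH1⟩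
    · exact ⟨Classical.arbitrary _, fun h1 h2 => absurd ⟨h1, h2⟩ hb⟩
  choose H hH using hH'
  refine ⟨H, fun h hh hhh => ?_⟩
  obtain ⟨hA, hB⟩ := hH h hh hhh
  refine ⟨hA, fun φ hφ hφM x₀ hx₀ hx₀φ n hn => ?_⟩
  obtain ⟨x, hxφ, hx, hxm, hxe⟩ := hB φ hφ hφM x₀ hx₀ hx₀φ n
  have hq := Real.sqrt_pos.2 hh
  have h1 : ‖(H h).eval (φ n) - (H h).eval (φ 0)‖ ≤ K * ‖x₀.2‖ ^ 2 * Real.exp (-c / √h) := by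
    refine hxe.trans ?_
    calc (n : ℝ) * (h * (K * Real.exp (-(2 * c / √h)) * ‖x₀.2‖ ^ 2))
        = n * h * (K * Real.exp (-(2 * c / √h)) * ‖x₀.2‖ ^ 2) := by ring
      _ ≤ Real.exp (c / √h) * (K * Real.exp (-(2 * c / √h)) * ‖x₀.2‖ ^ 2) := by gcongr
      _ = K * ‖x₀.2‖ ^ 2 * (Real.exp (c / √h) * Real.exp (-(2 * c / √h))) := by ring
      _ = K * ‖x₀.2‖ ^ 2 * Real.exp (-c / √h) := by
          rw [← Real.exp_add]; congr 2; ring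
  refine ⟨x, hxφ, hx, hxm, h1, ?_⟩
  have h2 := hA x hx (by rw [hxφ]; exact hφM n)
  have h3 := hA x₀ hx₀ (by rw [hx₀φ]; exact hφM 0)
  rw [hxφ, hxm] at h2
  rw [hx₀φ] at h3
  have h4 : K * ‖x₀.2‖ ^ 2 * Real.exp (-c / √h) ≤ K * ‖x₀.2‖ ^ 2 * (2 / c ^ 2 * h) := by
    gcongr
    have := exp_neg_div_le hc hq
    rwa [Real.sq_sqrt hh.le] at this
  have h5 : firstModifiedEnergy h (φ n) - firstModifiedEnergy h (φ 0) =
      -((H h).eval (φ n) - firstModifiedEnergy h (φ n)) +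
        ((H h).eval (φ n) - (H h).eval (φ 0)) +
        ((H h).eval (φ 0) - firstModifiedEnergy h (φ 0)) := by ring
  rw [h5]
  refine (norm_add₃_le ..).trans ?_
  rw [norm_neg]
  linarith

lemma exists_pair_of_le {s : ℝ} {φ : L1 d} {R : ℝ≥0} (h : sqNormL2 s φ ≤ R) :
    ∃ x : X d, x.1 = φ ∧ Cons x ∧ ‖x.2‖ ^ 2 ≤ R := by
  obtain ⟨x, h1, h2, h3⟩ := exists_pair (h.trans_lt ENNReal.coe_lt_top)
  refine ⟨x, h1, h2, ?_⟩
  have := h3.trans h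
  rw [← ENNReal.ofReal_coe_nnreal] at this
  exact (ENNReal.ofReal_le_ofReal_iff R.coe_nonneg).1 this

end LongTime

end NLSSplitting

end

open NLSSplitting
theorem theoremt (d : ℕ) (hd : 1 ≤ d) (M : ℝ≥0) :
    ∃ h₀ > (0 : ℝ), ∃ c > (0 : ℝ), ∃ H : ℝ → PolyHam d,
      -- the modified Hamiltonian and the first modified energy
      (∀ R : ℝ≥0, ∃ C : ℝ≥0, ∀ h : ℝ, 0 < h → h ≤ h₀ →
        (∀ φ : L1 d, normL1 0 φ ≤ M → sqNormL2 0 φ ≤ R →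
          ‖(H h).eval φ - firstModifiedEnergy h φ‖ ≤ C * h) ∧
        ∀ φ : ℕ → L1 d, IsNumericalSolution h φ → (∀ n, normL1 0 (φ n) ≤ M) →
          sqNormL2 0 (φ 0) ≤ R →
          ∀ n : ℕ, n * h ≤ Real.exp (c / Real.sqrt h) →
            sqNormL2 0 (φ n) < ⊤ ∧
            ‖(H h).eval (φ n) - (H h).eval (φ 0)‖ ≤ C * Real.exp (-c / Real.sqrt h) ∧
            ‖firstModifiedEnergy h (φ n) - firstModifiedEnergy h (φ 0)‖ ≤ C * h) ∧
      -- low and high frequencies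
      (∀ α : ℝ, 0 < α → ∀ R : ℝ≥0, ∃ C : ℝ≥0, ∀ h : ℝ, 0 < h → h ≤ h₀ →
        ∀ φ : ℕ → L1 d, IsNumericalSolution h φ → (∀ n, normL1 0 (φ n) ≤ M) →
          sqNormL2 1 (φ 0) ≤ R →
          ∀ n : ℕ, n * h ≤ Real.exp (c / Real.sqrt h) →
            (∫⁻ ξ in {ξ : V d | ‖ξ‖ ≤ α * h ^ (-(1 / 4) : ℝ)},
                ENNReal.ofReal (‖ξ‖ ^ 2 * ‖φ n ξ‖ ^ 2)) +
              ENNReal.ofReal (1 / Real.sqrt h) *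
                (∫⁻ ξ in {ξ : V d | α * h ^ (-(1 / 4) : ℝ) ≤ ‖ξ‖},
                  ENNReal.ofReal (‖φ n ξ‖ ^ 2)) ≤ C) ∧
      -- the original energy
      (∀ s : ℝ, 3 ≤ s → ∀ R : ℝ≥0, ∃ C : ℝ≥0, ∀ h : ℝ, 0 < h → h ≤ h₀ →
        ∀ φ : ℕ → L1 d, IsNumericalSolution h φ →
          (∀ n, normL1 s (φ n) ≤ M ∧ sqNormL2 s (φ n) ≤ R) →
          ∀ n : ℕ, n * h ≤ Real.exp (c / Real.sqrt h) →
            ‖energy (φ n) - energy (φ 0)‖ ≤ C * h) := by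
  obtain ⟨h₀, hh₀, hh₀', c, hc, K, hK, H, hH⟩ := exists_conserved_energy (d := d) M.coe_nonneg
  lift K to ℝ≥0 using hK
  have hcc : (0 : ℝ) ≤ 2 / c ^ 2 := by positivity
  refine ⟨h₀, hh₀, c, hc, H, fun R => ?_, fun α hα R => ?_, fun s hs R => ?_⟩
  · refine ⟨K * R * (2 + ⟨2 / c ^ 2, hcc⟩), fun h hh hhh => ?_⟩
    obtain ⟨hA, hB⟩ := hH h hh hhh
    have hC : (K : ℝ) * R ≤ (K * R * (2 + ⟨2 / c ^ 2, hcc⟩) : ℝ≥0) := by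
      push_cast
      refine le_mul_of_one_le_right (by positivity) ?_
      show (1 : ℝ) ≤ 2 + 2 / c ^ 2
      linarith
    refine ⟨fun φ hφM hφR => ?_, fun φ hφ hφM hφR n hn => ?_⟩
    · obtain ⟨x, rfl, hx, hxR⟩ := exists_pair_of_le hφR
      refine (hA x hx (norm_le_of_normL1 hφM)).trans ?_
      calc K * h * ‖x.2‖ ^ 2 ≤ K * h * R := by gcongr
        _ = K * R * h := by ring
        _ ≤ _ := by gcongr
    · obtain ⟨x₀, hx₀, hx₀c, hx₀R⟩ := exists_pair_of_le hφR
      obtain ⟨x, hx, hxc, hxm, h1, h2⟩ := hB φ hφ (fun n => norm_le_of_normL1 (hφM n)) x₀ hx₀c hx₀ n hn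
      refine ⟨?_, h1.trans ?_, h2.trans ?_⟩
      · rw [← hx, hxc.sqNormL2_zero]
        exact ENNReal.ofReal_lt_top
      · refine mul_le_mul_of_nonneg_right (le_trans ?_ hC) (Real.exp_pos _).le
        gcongr
      · push_cast
        show _ ≤ K * R * (2 + 2 / c ^ 2) * h
        calc K * (2 + 2 / c ^ 2) * ‖x₀.2‖ ^ 2 * h ≤ K * (2 + 2 / c ^ 2) * R * h := by gcongr
          _ = _ := by ring
  · have hα' : 0 < Real.arctan (α ^ 2) := Real.arctan_pos.2 (by positivity)
    refine ⟨Real.toNNReal ((1 + α ^ 4 + (Real.arctan (α ^ 2))⁻¹) *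
      (R + 4 * (R * M ^ 2) + K * (2 + 2 / c ^ 2) * R)), fun h hh hhh φ hφ hφM hφR n hn => ?_⟩
    have hφM' := fun n => norm_le_of_normL1 (hφM n)
    obtain ⟨x₀, hx₀, hx₀c, hx₀R⟩ := exists_pair_of_le hφR
    obtain ⟨x, hx, hxc, hxm, -, h2⟩ := (hH h hh hhh).2 φ hφ hφM' x₀ hx₀c hx₀ n hn
    have hsm : h ≤ 1 / 360000 := hhh.trans hh₀'
    have h3 := low_high_le hh hα hxc
    rw [hx] at h3
    refine h3.trans ?_
    refine ENNReal.ofReal_le_ofReal (mul_le_mul_of_nonneg_left ?_ (by positivity))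
    have hq : ∀ y : X d, ‖y.2‖ ^ 2 ≤ R → ‖y.1‖ ≤ M → ‖quarticPart h y‖ ≤ 2 * (R * M ^ 2) :=
      fun y h1 h2 => (norm_quarticPart_le hsm y).trans (by gcongr)
    have h4 := hq x (by rw [hxm]; exact hx₀R) (by rw [hx]; exact hφM' n)
    have h5 := hq x₀ hx₀R (by rw [hx₀]; exact hφM' 0)
    have h6 : quadraticPart h x₀ ≤ R := quadraticPart_le hh hx₀c (by rw [hx₀]; exact hφR)
    have h7 : ((quadraticPart h x - quadraticPart h x₀ : ℝ) : ℂ) =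
        (firstModifiedEnergy h (φ n) - firstModifiedEnergy h (φ 0)) - quarticPart h x +
          quarticPart h x₀ := by
      rw [← hx, ← hx₀, firstModifiedEnergy_eq hh hxc, firstModifiedEnergy_eq hh hx₀c,
        Complex.ofReal_sub]
      simp only [quadraticPart]
      ring
    have h8 : quadraticPart h x - quadraticPart h x₀ ≤
        K * (2 + 2 / c ^ 2) * R + 2 * (R * M ^ 2) + 2 * (R * M ^ 2) := by
      refine (le_abs_self _).trans ?_
      rw [← Real.norm_eq_abs, ← Complex.norm_real, h7]
      refine (norm_add_le _ _).trans (add_le_add ((norm_sub_le _ _).trans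
        (add_le_add (h2.trans ?_) h4)) h5)
      calc K * (2 + 2 / c ^ 2) * ‖x₀.2‖ ^ 2 * h ≤ K * (2 + 2 / c ^ 2) * R * 1 := by
            gcongr
            linarith
        _ = _ := mul_one _
    linarith
  · refine ⟨2 * (R + 32 * R * M ^ 2) + K * R * (2 + ⟨2 / c ^ 2, hcc⟩),
      fun h hh hhh φ hφ hφR n hn => ?_⟩
    have hsm : h ≤ 1 / 360000 := hhh.trans hh₀'
    have hd : ∀ k, ‖energy (φ k) - firstModifiedEnergy h (φ k)‖ ≤ (R + 32 * R * M ^ 2) * h := by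
      intro k
      obtain ⟨y, hy, hyc, -⟩ := exists_pair_of_le (hφR k).2
      rw [← hy]
      exact norm_energy_sub_le hh hsm hs hyc (by rw [hy]; exact (hφR k).1)
        (by rw [hy]; exact (hφR k).2)
    obtain ⟨x₀, hx₀, hx₀c, hx₀R⟩ := exists_pair_of_le (hφR 0).2
    obtain ⟨x, -, -, -, -, h2⟩ := (hH h hh hhh).2 φ hφ
      (fun n => norm_le_of_normL1 (hφR n).1) x₀ hx₀c hx₀ n hn
    have h3 : energy (φ n) - energy (φ 0) = (energy (φ n) - firstModifiedEnergy h (φ n)) +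
        (firstModifiedEnergy h (φ n) - firstModifiedEnergy h (φ 0)) -
        (energy (φ 0) - firstModifiedEnergy h (φ 0)) := by ring
    have h4 : K * (2 + 2 / c ^ 2) * ‖x₀.2‖ ^ 2 * h ≤ K * (2 + 2 / c ^ 2) * R * h := by gcongr
    rw [h3]
    refine (norm_sub_le _ _).trans ((add_le_add (norm_add_le _ _) le_rfl).trans ?_)
    push_cast
    show _ ≤ (2 * (R + 32 * R * M ^ 2) + K * R * (2 + 2 / c ^ 2)) * h
    linarith [hd n, hd 0]
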